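/- **Setting.** A $\mathbf{Ch}^{[-1,0]}$-category $\mathbf{C}$ is a category enriched in complex cochain complexes concentrated in degrees $-1,0$ (composites of two elements of degree $-1$ vanish); $\partial$ is the differential. For two such categories, $\mathbf{C}\boxtimes\mathbf{D}$ has pairs as objects and, as hom-complexes, the tensor products truncated to degrees $-1,0$; $\tau$ is its symmetry. For enriched functors $F,G:\mathbf{C}\to\mathbf{D}$, a *pseudonatural transformation* $\xi:F\Rightarrow G$ consists of $\xi_U\in\mathbf{D}[FU,GU]^0$ and linear maps $f\mapsto\xi_f$, $\mathbf{C}[U,U']^0\to\mathbf{D}[FU,GU']^{-1}$, with $G(f)\xi_U-\xi_{U'}F(f)=\partial\xi_f$ for $f$ of degree $0$, $G(k)\xi_U-\xi_{U'}F(k)=\xi_{\partial k}$ for $k$ of degree $-1$, and $\xi_{f'f}=\xi_{f'}F(f)+G(f')\xi_f$. With $(\theta\xi)_U=\theta_U\xi_U$, $(\theta\xi)_f=\theta_f\xi_U+\theta_{U'}\xi_f$, the pseudonatural endomorphisms of $F$ form an algebra. A *modification* $\Xi:\xi\Rrightarrow\xi'$ is a family $\Xi_U\in\mathbf{D}[FU,GU]^{-1}$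 with $\partial\Xi_U=\xi_U-\xi'_U$ and $\Xi_{U'}F(f)+\xi_f=\xi'_f+G(f)\Xi_U$. Any family $\Xi_U\in\mathbf{D}[FU,GU]^{-1}$ has a coboundary $\partial\Xi:F\Rightarrow G$, $(\partial\Xi)_U=\partial\Xi_U$, $(\partial\Xi)_f=G(f)\Xi_U-\Xi_{U'}F(f)$. Let $(\mathbf{C},\otimes,\gamma)$ be a symmetric strict monoidal $\mathbf{Ch}^{[-1,0]}$-category (with $\gamma$ natural, involutive and satisfying the hexagon axiom) and let $t:\otimes\Rightarrow\otimes$ be pseudonatural. Define pseudonatural endomorphisms of $\otimes^2:\mathbf{C}^{\boxtimes3}\to\mathbf{C}$ by $t_{12}=\otimes(t\boxtimes1)$, $t_{23}=\otimes(1\boxtimes t)$, $t_{(12)3}=t_{\otimes\boxtimes\mathrm{id}}$, $t_{1(23)}=t_{\mathrm{id}\boxtimes\otimes}$ and $t_{13}=\otimes\big([\gamma^{-1}\boxtimes1](1\boxtimes t)_{\tau\boxtimes\mathrm{id}}[\gamma\boxtimes1]\big)$. Assume that $t$ is *strict*: $t_{1(23)}=t_{12}+t_{13}$ and $t_{(12)3}=t_{23}+t_{13}$.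 The 4-term relationators are the modifications $\mathcal{L}:[t_{12},t_{(12)3}]\Rrightarrow0$, $\mathcal{L}_{UVW}=t_{t_{UV}\boxtimes1_W}$, and $\mathcal{R}:[t_{23},t_{1(23)}]\Rrightarrow0$, $\mathcal{R}_{UVW}=t_{1_U\boxtimes t_{VW}}$. **Formal 2-connection and 2-holonomy.** Everything below is a formal power series in $\hbar$, where $t$ carries a factor $\hbar$ and $\mathcal{L},\mathcal{R}$ carry a factor $\hbar^2$ (these factors are suppressed). A modification between formal power series of pseudonatural endomorphisms is a formal power series of modifications. On $\{(z,v):z\neq0,1,\ v\neq0\}\subset\mathbb{C}^2$ put $$\nabla=\Big(\frac{t_{12}}z+\frac{t_{23}}{z-1}\Big)dz+\frac{t_{12}+t_{23}+t_{13}}v\,dv,\qquad \Delta=2\Big(\frac{\mathcal{L}}{zv}+\frac{\mathcal{R}}{(z-1)v}\Big)dz\wedge dv,$$ with the convention $(dz\wedge dv)[X,Y]=\tfrac12\big(dz(X)dv(Y)-dz(Y)dv(X)\big)$. For a path $p$ let $W^p_{r r'}$ be the parallel transport: $W^p_{r'r'}=1$, $\frac{d}{dr}W^p_{rr'}=\nabla[p'(r)]\,W^p_{rr'}$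 (the series of iterated integrals), and $W^p=W^p_{10}$. For a 2-path $\mathcal{P}(s,r)$ with cross-sections $\mathcal{P}^s=\mathcal{P}(s,\cdot)$, the 2-holonomy is the modification $$W^{\mathcal{P}}=\int_0^1\!\!\int_0^1W^{\mathcal{P}^s}_{1r}\,\Delta\Big[\frac{\partial\mathcal{P}}{\partial s},\frac{\partial\mathcal{P}}{\partial r}\Big]W^{\mathcal{P}^s}_{r0}\,dr\,ds+\mathrm{ID}_{W^{\mathcal{P}^1}},$$ whose target is $W^{\mathcal{P}^1}$ and whose source is $W^{\mathcal{P}^1}$ plus the coboundary of the double integral. **Paths.** Let $a\in\mathbb{C}\setminus\{0\}$, $0<\varepsilon\le\frac14$, and $$c_{\mathrm{VI}}(r)=\frac{2\varepsilon}{\varepsilon+(2-\varepsilon)e^{i\pi(1-r)}},\qquad c_{\mathrm{IV}}(r)=\tfrac12+\big(\tfrac1\varepsilon-\tfrac12\big)e^{-i\pi r},$$ $$q_{\mathrm{VI}}(r)=\Big(\frac{\varepsilon}{\frac\varepsilon2+(1-\frac\varepsilon2)e^{i\pi r}},\big[\tfrac\varepsilon2+(1-\tfrac\varepsilon2)e^{i\pi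 r}\big]a\Big),\qquad q_{\searrow}(r)=\Big(\frac{2\varepsilon}{\varepsilon+(\varepsilon-2)e^{i\pi r}},\big[\tfrac\varepsilon2+(1-\tfrac\varepsilon2)e^{i\pi r}\big]a\Big),$$ $$\mathcal{P}_{\mathcal{L}}(s,r)=\begin{cases}q_{\mathrm{VI}}(2r),&0\le r\le\frac{1-s}2,\\ \big(c_{\mathrm{VI}}(2r+2s-1),\,c_{\mathrm{IV}}(s-1)\varepsilon a\big),&\frac{1-s}2\le r\le1-\frac s2,\\ q_{\searrow}(2r-1),&1-\frac s2\le r\le1.\end{cases}$$ Write $qp$ for the concatenation "first $p$, then $q$". **Statement.** 1. For all $0<\varepsilon\le\frac14$, $\mathcal{P}_{\mathcal{L}}$ is a 2-path (continuous, and smooth on each polygon of a finite partition of the unit square) in $\{z\ne0,1,\ v\neq0\}$ from the 1-path $\big(c_{\mathrm{VI}},(\varepsilon-1)a\big)\,q_{\mathrm{VI}}$ to the 1-path $q_{\searrow}\,\big(c_{\mathrm{VI}}(r+1),a\big)$. 2. As $\varepsilon\to0^+$, the 2-holonomy $W^{\mathcal{P}_{\mathcal{L}}}$ converges (in every coefficient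 of $\hbar$ and every component, together with its source and target) to the left congruence $$\underline{\mathcal{L}}=\big(e^{i\pi t}\big)_{e^{i\pi t_{12}}}:\ e^{i\pi t_{12}}e^{i\pi t_{(12)3}}\Rrightarrow e^{i\pi t_{(12)3}}e^{i\pi t_{12}},$$ the modification whose component at $(U,V,W)$ is the homotopy component of $e^{i\pi t}$ at the arrow $(e^{i\pi t})_{U,V}\boxtimes1_W$. 3. The left congruence is the double series $$\underline{\mathcal{L}}=\sum_{m,n\ge1}\frac{(i\pi)^{m+n}}{m!\,n!}\sum_{j=0}^{m-1}\sum_{k=0}^{n-1}t_{(12)3}^{\,j}\,t_{12}^{\,k}\,\mathcal{L}\,t_{12}^{\,n-1-k}\,t_{(12)3}^{\,m-1-j}.$$ -/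

import Mathlib

open Filter Topology
open scoped TensorProduct

universe v u

noncomputable section

/-! ### Two-term complexes and their truncated tensor product -/

namespace TwoTerm

variable {A0 A1 B0 B1 E : Type v}
  [AddCommGroup A0] [Module ℂ A0] [AddCommGroup A1] [Module ℂ A1]
  [AddCommGroup B0] [Module ℂ B0] [AddCommGroup B1] [Module ℂ B1]
  [AddCommGroup E] [Module ℂ E]

/-- The differential from degree `-2` to degree `-1` in the tensor product of the complexes
`A1 → A0` and `B1 → B0`: `κ ⊗ μ ↦ dκ ⊗ μ - κ ⊗ dμ`. -/
def bdry (dA : A1 →ₗ[ℂ] A0) (dB : B1 →ₗ[ℂ] B0) :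
    (A1 ⊗[ℂ] B1) →ₗ[ℂ] (A1 ⊗[ℂ] B0) × (A0 ⊗[ℂ] B1) :=
  LinearMap.prod (-TensorProduct.map (LinearMap.id : A1 →ₗ[ℂ] A1) dB)
    (TensorProduct.map dA (LinearMap.id : B1 →ₗ[ℂ] B1))

/-- The degree `-1` part of the tensor product of two-term complexes, truncated to degrees
`-1, 0`: the cokernel of the differential out of degree `-2`. -/
abbrev T1 (dA : A1 →ₗ[ℂ] A0) (dB : B1 →ₗ[ℂ] B0) : Type v :=
  ((A1 ⊗[ℂ] B0) × (A0 ⊗[ℂ] B1)) ⧸ LinearMap.range (bdry dA dB)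

variable (dA : A1 →ₗ[ℂ] A0) (dB : B1 →ₗ[ℂ] B0)

/-- The class of `κ ⊗ g` with `κ` of degree `-1` and `g` of degree `0`. -/
def inl : (A1 ⊗[ℂ] B0) →ₗ[ℂ] T1 dA dB :=
  (LinearMap.range (bdry dA dB)).mkQ ∘ₗ LinearMap.inl ℂ _ _

/-- The class of `f ⊗ κ` with `f` of degree `0` and `κ` of degree `-1`. -/
def inr : (A0 ⊗[ℂ] B1) →ₗ[ℂ] T1 dA dB :=
  (LinearMap.range (bdry dA dB)).mkQ ∘ₗ LinearMap.inr ℂ _ _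

theorem rel (κ : A1) (μ : B1) :
    inr dA dB (dA κ ⊗ₜ μ) = inl dA dB (κ ⊗ₜ dB μ) := by
  simp only [inl, inr, LinearMap.comp_apply, Submodule.mkQ_apply]
  rw [Submodule.Quotient.eq]
  exact ⟨κ ⊗ₜ μ, by simp [bdry]⟩

variable {dA dB}

theorem ind {P : T1 dA dB → Prop}
    (hl : ∀ κ g, P (inl dA dB (κ ⊗ₜ g))) (hr : ∀ f κ, P (inr dA dB (f ⊗ₜ κ)))
    (ha : ∀ x y, P x → P y → P (x + y)) (x : T1 dA dB) : P x := by
  have h1 : ∀ y : A1 ⊗[ℂ] B0, P (inl dA dB y) := by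
    intro y
    induction y using TensorProduct.induction_on with
    | zero => simpa using hl 0 0
    | tmul a b => exact hl a b
    | add a b h h' => rw [map_add]; exact ha _ _ h h'
  have h2 : ∀ y : A0 ⊗[ℂ] B1, P (inr dA dB y) := by
    intro y
    induction y using TensorProduct.induction_on with
    | zero => simpa using hr 0 0
    | tmul a b => exact hr a b
    | add a b h h' => rw [map_add]; exact ha _ _ h h'
  obtain ⟨⟨a, b⟩, rfl⟩ := Submodule.mkQ_surjective _ x
  have : (LinearMap.range (bdry dA dB)).mkQ (a, b) = inl dA dB a + inr dA dB b := by
    simp only [inl, inr, LinearMap.comp_apply, ← map_add]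
    simp
  rw [this]
  exact ha _ _ (h1 a) (h2 b)

/-- A linear map out of the truncated tensor product. -/
def lift (φ : (A1 ⊗[ℂ] B0) →ₗ[ℂ] E) (ψ : (A0 ⊗[ℂ] B1) →ₗ[ℂ] E)
    (h : ∀ κ μ, ψ (dA κ ⊗ₜ μ) = φ (κ ⊗ₜ dB μ)) : T1 dA dB →ₗ[ℂ] E :=
  (LinearMap.range (bdry dA dB)).liftQ (LinearMap.coprod φ ψ) (by
    rw [LinearMap.range_le_ker_iff]
    ext κ μ
    simp [bdry, h])

theorem lift_inl (φ : (A1 ⊗[ℂ] B0) →ₗ[ℂ] E) (ψ : (A0 ⊗[ℂ] B1) →ₗ[ℂ] E)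
    (h : ∀ κ μ, ψ (dA κ ⊗ₜ μ) = φ (κ ⊗ₜ dB μ)) (x) : lift φ ψ h (inl dA dB x) = φ x := by
  simp [lift, inl]

theorem lift_inr (φ : (A1 ⊗[ℂ] B0) →ₗ[ℂ] E) (ψ : (A0 ⊗[ℂ] B1) →ₗ[ℂ] E)
    (h : ∀ κ μ, ψ (dA κ ⊗ₜ μ) = φ (κ ⊗ₜ dB μ)) (x) : lift φ ψ h (inr dA dB x) = ψ x := by
  simp [lift, inr]

end TwoTerm

/-! ### Categories enriched in complexes concentrated in degrees `-1, 0` -/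

/-- A category enriched in complex cochain complexes concentrated in degrees `-1, 0`:
`H0 U V` and `H1 U V` are the parts of the hom-complex of degree `0` and `-1`, `d` is the
differential, and `c00 g f`, `c01 g k`, `c10 k f` are the composites `g f`, `g k`, `k f`
(the composite of two elements of degree `-1` vanishes). -/
class ChCat (C : Type u) where
  H0 : C → C → Type v
  H1 : C → C → Type v
  [acg0 : ∀ U V, AddCommGroup (H0 U V)]
  [acg1 : ∀ U V, AddCommGroup (H1 U V)]
  [mod0 : ∀ U V, Module ℂ (H0 U V)]
  [mod1 : ∀ U V, Module ℂ (H1 U V)]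
  d : ∀ {U V : C}, H1 U V →ₗ[ℂ] H0 U V
  one : ∀ U : C, H0 U U
  c00 : ∀ {U V W : C}, H0 V W →ₗ[ℂ] H0 U V →ₗ[ℂ] H0 U W
  c01 : ∀ {U V W : C}, H0 V W →ₗ[ℂ] H1 U V →ₗ[ℂ] H1 U W
  c10 : ∀ {U V W : C}, H1 V W →ₗ[ℂ] H0 U V →ₗ[ℂ] H1 U W
  one_c00 : ∀ {U V : C} (f : H0 U V), c00 (one V) f = f
  c00_one : ∀ {U V : C} (f : H0 U V), c00 f (one U) = f
  one_c01 : ∀ {U V : C} (k : H1 U V), c01 (one V) k = k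
  c10_one : ∀ {U V : C} (k : H1 U V), c10 k (one U) = k
  assoc000 : ∀ {U V W X : C} (h : H0 W X) (g : H0 V W) (f : H0 U V),
    c00 (c00 h g) f = c00 h (c00 g f)
  assoc001 : ∀ {U V W X : C} (h : H0 W X) (g : H0 V W) (k : H1 U V),
    c01 (c00 h g) k = c01 h (c01 g k)
  assoc010 : ∀ {U V W X : C} (h : H0 W X) (k : H1 V W) (f : H0 U V),
    c10 (c01 h k) f = c01 h (c10 k f)
  assoc100 : ∀ {U V W X : C} (k : H1 W X) (g : H0 V W) (f : H0 U V),
    c10 (c10 k g) f = c10 k (c00 g f)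
  d_c01 : ∀ {U V W : C} (g : H0 V W) (k : H1 U V), d (c01 g k) = c00 g (d k)
  d_c10 : ∀ {U V W : C} (k : H1 V W) (f : H0 U V), d (c10 k f) = c00 (d k) f
  peiffer : ∀ {U V W : C} (k' : H1 V W) (k : H1 U V), c10 k' (d k) = c01 (d k') k

attribute [reducible, instance] ChCat.acg0 ChCat.acg1 ChCat.mod0 ChCat.mod1

open ChCat

/-! ### The tensor product of two such categories -/

section Prod

variable {C D : Type u} [ChCat.{v} C] [ChCat.{v} D]

/-- Degree `0` hom-spaces of `C ⊠ D`. -/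
abbrev P0 (U V : C × D) : Type v := H0 U.1 V.1 ⊗[ℂ] H0 U.2 V.2

/-- Degree `-1` hom-spaces of `C ⊠ D`. -/
abbrev P1 (U V : C × D) : Type v :=
  TwoTerm.T1 (d : H1 U.1 V.1 →ₗ[ℂ] H0 U.1 V.1) (d : H1 U.2 V.2 →ₗ[ℂ] H0 U.2 V.2)

def pinl {U V : C × D} : (H1 U.1 V.1 ⊗[ℂ] H0 U.2 V.2) →ₗ[ℂ] P1 U V := TwoTerm.inl _ _

def pinr {U V : C × D} : (H0 U.1 V.1 ⊗[ℂ] H1 U.2 V.2) →ₗ[ℂ] P1 U V := TwoTerm.inr _ _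

theorem prel {U V : C × D} (κ : H1 U.1 V.1) (μ : H1 U.2 V.2) :
    (pinr (d κ ⊗ₜ μ) : P1 U V) = pinl (κ ⊗ₜ d μ) := TwoTerm.rel _ _ κ μ

def plift {U V : C × D} {E : Type v} [AddCommGroup E] [Module ℂ E]
    (φ : (H1 U.1 V.1 ⊗[ℂ] H0 U.2 V.2) →ₗ[ℂ] E) (ψ : (H0 U.1 V.1 ⊗[ℂ] H1 U.2 V.2) →ₗ[ℂ] E)
    (h : ∀ κ μ, ψ (d κ ⊗ₜ μ) = φ (κ ⊗ₜ d μ)) : P1 U V →ₗ[ℂ] E := TwoTerm.lift φ ψ h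

theorem plift_pinl {U V : C × D} {E : Type v} [AddCommGroup E] [Module ℂ E]
    (φ : (H1 U.1 V.1 ⊗[ℂ] H0 U.2 V.2) →ₗ[ℂ] E) (ψ : (H0 U.1 V.1 ⊗[ℂ] H1 U.2 V.2) →ₗ[ℂ] E)
    (h : ∀ κ μ, ψ (d κ ⊗ₜ μ) = φ (κ ⊗ₜ d μ)) (x) : plift φ ψ h (pinl x : P1 U V) = φ x :=
  TwoTerm.lift_inl φ ψ h x

theorem plift_pinr {U V : C × D} {E : Type v} [AddCommGroup E] [Module ℂ E]
    (φ : (H1 U.1 V.1 ⊗[ℂ] H0 U.2 V.2) →ₗ[ℂ] E) (ψ : (H0 U.1 V.1 ⊗[ℂ] H1 U.2 V.2) →ₗ[ℂ] E)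
    (h : ∀ κ μ, ψ (d κ ⊗ₜ μ) = φ (κ ⊗ₜ d μ)) (x) : plift φ ψ h (pinr x : P1 U V) = ψ x :=
  TwoTerm.lift_inr φ ψ h x

/-- The differential: `κ ⊗ g ↦ dκ ⊗ g` and `f ⊗ κ ↦ f ⊗ dκ`. -/
def pd {U V : C × D} : P1 U V →ₗ[ℂ] P0 U V :=
  plift (TensorProduct.map d LinearMap.id) (TensorProduct.map LinearMap.id d) (fun κ μ => by
    rw [TensorProduct.map_tmul, TensorProduct.map_tmul, LinearMap.id_apply, LinearMap.id_apply])

theorem pd_pinl {U V : C × D} (κ : H1 U.1 V.1) (g : H0 U.2 V.2) :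
    pd (pinl (κ ⊗ₜ g) : P1 U V) = d κ ⊗ₜ g := by
  rw [pd, plift_pinl, TensorProduct.map_tmul]; rfl

theorem pd_pinr {U V : C × D} (f : H0 U.1 V.1) (κ : H1 U.2 V.2) :
    pd (pinr (f ⊗ₜ κ) : P1 U V) = f ⊗ₜ d κ := by
  rw [pd, plift_pinr, TensorProduct.map_tmul]; rfl

/-- `(f' ⊗ g') (f ⊗ g) = f' f ⊗ g' g`. -/
def pc00 {U V W : C × D} : P0 V W →ₗ[ℂ] P0 U V →ₗ[ℂ] P0 U W :=
  TensorProduct.map₂ c00 c00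

theorem pc00_tmul {U V W : C × D} (f' : H0 V.1 W.1) (g' : H0 V.2 W.2)
    (f : H0 U.1 V.1) (g : H0 U.2 V.2) :
    (pc00 (f' ⊗ₜ g' : P0 V W) (f ⊗ₜ g : P0 U V) : P0 U W) = c00 f' f ⊗ₜ c00 g' g := by
  simp [pc00]

/-- `(f ⊗ g) (κ ⊗ h) = f κ ⊗ g h` and `(f ⊗ g) (h ⊗ κ) = f h ⊗ g κ`. -/
def pc01 {U V W : C × D} : P0 V W →ₗ[ℂ] P1 U V →ₗ[ℂ] P1 U W :=
  (plift (((TensorProduct.map₂ c01 c00).compr₂ (pinl : _ →ₗ[ℂ] P1 U W)).flip)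
    (((TensorProduct.map₂ c00 c01).compr₂ (pinr : _ →ₗ[ℂ] P1 U W)).flip) (by
      intro κ μ
      ext f g
      simp only [TensorProduct.AlgebraTensorModule.curry_apply, LinearMap.restrictScalars_self,
        TensorProduct.curry_apply, LinearMap.flip_apply, LinearMap.compr₂_apply,
        TensorProduct.map₂_apply_tmul, TensorProduct.map_tmul]
      rw [← d_c01, ← d_c01]
      exact prel _ _)).flip

theorem pc01_pinl {U V W : C × D} (f : H0 V.1 W.1) (g : H0 V.2 W.2)
    (κ : H1 U.1 V.1) (h : H0 U.2 V.2) :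
    (pc01 (f ⊗ₜ g : P0 V W) (pinl (κ ⊗ₜ h) : P1 U V) : P1 U W)
      = pinl (c01 f κ ⊗ₜ c00 g h) := by
  simp [pc01, LinearMap.flip_apply, plift_pinl]

theorem pc01_pinr {U V W : C × D} (f : H0 V.1 W.1) (g : H0 V.2 W.2)
    (h : H0 U.1 V.1) (κ : H1 U.2 V.2) :
    (pc01 (f ⊗ₜ g : P0 V W) (pinr (h ⊗ₜ κ) : P1 U V) : P1 U W)
      = pinr (c00 f h ⊗ₜ c01 g κ) := by
  simp [pc01, LinearMap.flip_apply, plift_pinr]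

/-- `(κ ⊗ h) (f ⊗ g) = κ f ⊗ h g` and `(h ⊗ κ) (f ⊗ g) = h f ⊗ κ g`. -/
def pc10 {U V W : C × D} : P1 V W →ₗ[ℂ] P0 U V →ₗ[ℂ] P1 U W :=
  plift ((TensorProduct.map₂ c10 c00).compr₂ (pinl : _ →ₗ[ℂ] P1 U W))
    ((TensorProduct.map₂ c00 c10).compr₂ (pinr : _ →ₗ[ℂ] P1 U W)) (by
      intro κ μ
      ext f g
      simp only [TensorProduct.AlgebraTensorModule.curry_apply, LinearMap.restrictScalars_self,
        TensorProduct.curry_apply, LinearMap.compr₂_apply,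
        TensorProduct.map₂_apply_tmul, TensorProduct.map_tmul]
      rw [← d_c10, ← d_c10]
      exact prel _ _)

theorem pc10_pinl {U V W : C × D} (κ : H1 V.1 W.1) (h : H0 V.2 W.2)
    (f : H0 U.1 V.1) (g : H0 U.2 V.2) :
    (pc10 (pinl (κ ⊗ₜ h) : P1 V W) (f ⊗ₜ g : P0 U V) : P1 U W)
      = pinl (c10 κ f ⊗ₜ c00 h g) := by
  simp [pc10, plift_pinl]

theorem pc10_pinr {U V W : C × D} (h : H0 V.1 W.1) (κ : H1 V.2 W.2)
    (f : H0 U.1 V.1) (g : H0 U.2 V.2) :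
    (pc10 (pinr (h ⊗ₜ κ) : P1 V W) (f ⊗ₜ g : P0 U V) : P1 U W)
      = pinr (c00 h f ⊗ₜ c10 κ g) := by
  simp [pc10, plift_pinr]

theorem ind0 {U V : C × D} {P : P0 U V → Prop}
    (ht : ∀ (f : H0 U.1 V.1) (g : H0 U.2 V.2), P (f ⊗ₜ g))
    (ha : ∀ x y, P x → P y → P (x + y)) (x : P0 U V) : P x := by
  induction x using TensorProduct.induction_on with
  | zero => simpa using ht 0 0
  | tmul a b => exact ht a b
  | add a b h h' => exact ha _ _ h h'

theorem ind1 {U V : C × D} {P : P1 U V → Prop}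
    (hl : ∀ (κ : H1 U.1 V.1) (g : H0 U.2 V.2), P (pinl (κ ⊗ₜ g)))
    (hr : ∀ (f : H0 U.1 V.1) (κ : H1 U.2 V.2), P (pinr (f ⊗ₜ κ)))
    (ha : ∀ x y, P x → P y → P (x + y)) (x : P1 U V) : P x :=
  TwoTerm.ind hl hr ha x

/-- The tensor product `C ⊠ D`: objects are pairs and hom-complexes are truncated tensor products.
No Koszul sign survives the truncation. -/
instance instChCatProd : ChCat.{v} (C × D) where
  H0 := P0
  H1 := P1
  d := pd
  one U := one U.1 ⊗ₜ one U.2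
  c00 := pc00
  c01 := pc01
  c10 := pc10
  one_c00 f := by
    induction f using ind0 with
    | ht f g => rw [pc00_tmul, one_c00, one_c00]
    | ha x y h h' => rw [map_add, h, h']
  c00_one f := by
    induction f using ind0 with
    | ht f g => rw [pc00_tmul, c00_one, c00_one]
    | ha x y h h' => rw [map_add, LinearMap.add_apply, h, h']
  one_c01 k := by
    induction k using ind1 with
    | hl f g => rw [pc01_pinl, one_c00, one_c01]
    | hr f g => rw [pc01_pinr, one_c00, one_c01]
    | ha x y h h' => rw [map_add, h, h']
  c10_one k := by
    induction k using ind1 with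
    | hl f g => rw [pc10_pinl, c00_one, c10_one]
    | hr f g => rw [pc10_pinr, c00_one, c10_one]
    | ha x y h h' => rw [map_add, LinearMap.add_apply, h, h']
  assoc000 h g f := by
    induction h using ind0 with
    | ha x y h h' => simp only [map_add, LinearMap.add_apply, h, h']
    | ht h₁ h₂ =>
    induction g using ind0 with
    | ha x y h h' => simp only [map_add, LinearMap.add_apply, h, h']
    | ht g₁ g₂ =>
    induction f using ind0 with
    | ha x y h h' => simp only [map_add, h, h']
    | ht f₁ f₂ => simp only [pc00_tmul, assoc000]
  assoc001 h g k := by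
    induction h using ind0 with
    | ha x y h h' => simp only [map_add, LinearMap.add_apply, h, h']
    | ht h₁ h₂ =>
    induction g using ind0 with
    | ha x y h h' => simp only [map_add, LinearMap.add_apply, h, h']
    | ht g₁ g₂ =>
    induction k using ind1 with
    | ha x y h h' => simp only [map_add, h, h']
    | hl f₁ f₂ => simp only [pc00_tmul, pc01_pinl, assoc000, assoc001]
    | hr f₁ f₂ => simp only [pc00_tmul, pc01_pinr, assoc000, assoc001]
  assoc010 h k f := by
    induction h using ind0 with
    | ha x y h h' => simp only [map_add, LinearMap.add_apply, h, h']
    | ht h₁ h₂ =>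
    induction f using ind0 with
    | ha x y h h' => simp only [map_add, h, h']
    | ht g₁ g₂ =>
    induction k using ind1 with
    | ha x y h h' => simp only [map_add, LinearMap.add_apply, h, h']
    | hl f₁ f₂ => simp only [pc10_pinl, pc01_pinl, assoc000, assoc010]
    | hr f₁ f₂ => simp only [pc10_pinr, pc01_pinr, assoc000, assoc010]
  assoc100 k g f := by
    induction g using ind0 with
    | ha x y h h' => simp only [map_add, LinearMap.add_apply, h, h']
    | ht h₁ h₂ =>
    induction f using ind0 with
    | ha x y h h' => simp only [map_add, h, h']
    | ht g₁ g₂ =>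
    induction k using ind1 with
    | ha x y h h' => simp only [map_add, LinearMap.add_apply, h, h']
    | hl f₁ f₂ => simp only [pc00_tmul, pc10_pinl, assoc000, assoc100]
    | hr f₁ f₂ => simp only [pc00_tmul, pc10_pinr, assoc000, assoc100]
  d_c01 g k := by
    induction g using ind0 with
    | ha x y h h' => simp only [map_add, LinearMap.add_apply, h, h']
    | ht h₁ h₂ =>
    induction k using ind1 with
    | ha x y h h' => simp only [map_add, h, h']
    | hl f₁ f₂ => simp only [pc01_pinl, pd_pinl, pc00_tmul, d_c01]
    | hr f₁ f₂ => simp only [pc01_pinr, pd_pinr, pc00_tmul, d_c01]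
  d_c10 k f := by
    induction f using ind0 with
    | ha x y h h' => simp only [map_add, h, h']
    | ht h₁ h₂ =>
    induction k using ind1 with
    | ha x y h h' => simp only [map_add, LinearMap.add_apply, h, h']
    | hl f₁ f₂ => simp only [pc10_pinl, pd_pinl, pc00_tmul, d_c10]
    | hr f₁ f₂ => simp only [pc10_pinr, pd_pinr, pc00_tmul, d_c10]
  peiffer k' k := by
    induction k using ind1 with
    | ha x y h h' => simp only [map_add, h, h']
    | hl f₁ f₂ =>
      induction k' using ind1 with
      | ha x y h h' => simp only [map_add, LinearMap.add_apply, h, h']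
      | hl g₁ g₂ => simp only [pc10_pinl, pc01_pinl, pd_pinl, peiffer]
      | hr g₁ g₂ => simp only [pc10_pinr, pc01_pinl, pd_pinl, pd_pinr, ← d_c01, ← d_c10, prel]
    | hr f₁ f₂ =>
      induction k' using ind1 with
      | ha x y h h' => simp only [map_add, LinearMap.add_apply, h, h']
      | hl g₁ g₂ => simp only [pc10_pinl, pc01_pinr, pd_pinl, pd_pinr, ← d_c01, ← d_c10, prel]
      | hr g₁ g₂ => simp only [pc10_pinr, pc01_pinr, pd_pinr, peiffer]

end Prod

/-! ### Functors -/

/-- An enriched functor: a map of objects and linear maps of hom-complexes compatible with the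
differentials, the units and the composition. -/
structure ChFunctor (C D : Type u) [ChCat.{v} C] [ChCat.{v} D] where
  obj : C → D
  map0 : ∀ {U V : C}, H0 U V →ₗ[ℂ] H0 (obj U) (obj V)
  map1 : ∀ {U V : C}, H1 U V →ₗ[ℂ] H1 (obj U) (obj V)
  map_d : ∀ {U V : C} (k : H1 U V), map0 (d k) = d (map1 k)
  map_one : ∀ U : C, map0 (one U) = one (obj U)
  map_c00 : ∀ {U V W : C} (g : H0 V W) (f : H0 U V), map0 (c00 g f) = c00 (map0 g) (map0 f)
  map_c01 : ∀ {U V W : C} (g : H0 V W) (k : H1 U V), map1 (c01 g k) = c01 (map0 g) (map1 k)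
  map_c10 : ∀ {U V W : C} (k : H1 V W) (f : H0 U V), map1 (c10 k f) = c10 (map1 k) (map0 f)

namespace ChFunctor

variable {A B C D E : Type u} [ChCat.{v} A] [ChCat.{v} B] [ChCat.{v} C] [ChCat.{v} D] [ChCat.{v} E]

theorem ext_maps {o : C → D} {F G : ChFunctor C D} (hF : F.obj = o) (hG : G.obj = o)
    (h0 : ∀ U V (f : H0 U V), HEq (F.map0 f) (G.map0 f))
    (h1 : ∀ U V (k : H1 U V), HEq (F.map1 k) (G.map1 k)) : F = G := by
  subst hF
  cases F with | mk o f0 f1 =>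
  cases G with | mk o' g0 g1 =>
  dsimp only at hG
  subst hG
  have e0 : @f0 = @g0 := by
    funext U V; ext f; exact eq_of_heq (h0 U V f)
  have e1 : @f1 = @g1 := by
    funext U V; ext f; exact eq_of_heq (h1 U V f)
  subst e0 e1
  rfl

/-- The identity functor. -/
def id (C : Type u) [ChCat.{v} C] : ChFunctor C C where
  obj U := U
  map0 := LinearMap.id
  map1 := LinearMap.id
  map_d _ := rfl
  map_one _ := rfl
  map_c00 _ _ := rfl
  map_c01 _ _ := rfl
  map_c10 _ _ := rfl

/-- The composite functor: first `F`, then `G`. -/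
def comp (G : ChFunctor D E) (F : ChFunctor C D) : ChFunctor C E where
  obj U := G.obj (F.obj U)
  map0 := G.map0 ∘ₗ F.map0
  map1 := G.map1 ∘ₗ F.map1
  map_d k := by simp only [LinearMap.comp_apply, map_d]
  map_one U := by simp only [LinearMap.comp_apply, map_one]
  map_c00 g f := by simp only [LinearMap.comp_apply, map_c00]
  map_c01 g f := by simp only [LinearMap.comp_apply, map_c01]
  map_c10 g f := by simp only [LinearMap.comp_apply, map_c10]

/-- Degree `0` part of `F ⊠ G`. -/
def box0 (F : ChFunctor A C) (G : ChFunctor B D) {U V : A × B} :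
    P0 U V →ₗ[ℂ] P0 (F.obj U.1, G.obj U.2) (F.obj V.1, G.obj V.2) :=
  TensorProduct.map F.map0 G.map0

theorem box0_tmul (F : ChFunctor A C) (G : ChFunctor B D) {U V : A × B}
    (f : H0 U.1 V.1) (g : H0 U.2 V.2) :
    box0 F G (f ⊗ₜ g : P0 U V) = F.map0 f ⊗ₜ G.map0 g := TensorProduct.map_tmul _ _ _ _

/-- Degree `-1` part of `F ⊠ G`. -/
def box1 (F : ChFunctor A C) (G : ChFunctor B D) {U V : A × B} :
    P1 U V →ₗ[ℂ] P1 (F.obj U.1, G.obj U.2) (F.obj V.1, G.obj V.2) :=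
  plift (pinl ∘ₗ TensorProduct.map F.map1 G.map0) (pinr ∘ₗ TensorProduct.map F.map0 G.map1) (by
    intro κ μ
    simp only [LinearMap.comp_apply, TensorProduct.map_tmul, map_d]
    exact prel _ _)

theorem box1_pinl (F : ChFunctor A C) (G : ChFunctor B D) {U V : A × B}
    (κ : H1 U.1 V.1) (g : H0 U.2 V.2) :
    box1 F G (pinl (κ ⊗ₜ g) : P1 U V) = pinl (F.map1 κ ⊗ₜ G.map0 g) := by
  rw [box1, plift_pinl, LinearMap.comp_apply, TensorProduct.map_tmul]

theorem box1_pinr (F : ChFunctor A C) (G : ChFunctor B D) {U V : A × B}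
    (f : H0 U.1 V.1) (κ : H1 U.2 V.2) :
    box1 F G (pinr (f ⊗ₜ κ) : P1 U V) = pinr (F.map0 f ⊗ₜ G.map1 κ) := by
  rw [box1, plift_pinr, LinearMap.comp_apply, TensorProduct.map_tmul]

/-- The functor `F ⊠ G`. -/
def box (F : ChFunctor A C) (G : ChFunctor B D) : ChFunctor (A × B) (C × D) where
  obj U := (F.obj U.1, G.obj U.2)
  map0 := box0 F G
  map1 := box1 F G
  map_d k := by
    change box0 F G (pd k) = pd (box1 F G k)
    induction k using ind1 with
    | ha x y h h' => simp only [map_add, h, h']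
    | hl a b => rw [pd_pinl, box0_tmul, box1_pinl, pd_pinl, map_d]
    | hr a b => rw [pd_pinr, box0_tmul, box1_pinr, pd_pinr, map_d]
  map_one U := by
    change box0 F G (one U.1 ⊗ₜ one U.2) = one (F.obj U.1) ⊗ₜ one (G.obj U.2)
    rw [box0_tmul, map_one, map_one]
  map_c00 g f := by
    change box0 F G (pc00 g f) = pc00 (box0 F G g) (box0 F G f)
    induction g using ind0 with
    | ha x y h h' => simp only [map_add, LinearMap.add_apply, h, h']
    | ht g₁ g₂ =>
    induction f using ind0 with
    | ha x y h h' => simp only [map_add, h, h']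
    | ht f₁ f₂ => rw [pc00_tmul, box0_tmul, box0_tmul, box0_tmul, pc00_tmul, map_c00, map_c00]
  map_c01 g k := by
    change box1 F G (pc01 g k) = pc01 (box0 F G g) (box1 F G k)
    induction g using ind0 with
    | ha x y h h' => simp only [map_add, LinearMap.add_apply, h, h']
    | ht g₁ g₂ =>
    induction k using ind1 with
    | ha x y h h' => simp only [map_add, h, h']
    | hl a b => rw [pc01_pinl, box0_tmul, box1_pinl, box1_pinl, pc01_pinl, map_c00, map_c01]
    | hr a b => rw [pc01_pinr, box0_tmul, box1_pinr, box1_pinr, pc01_pinr, map_c00, map_c01]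
  map_c10 k f := by
    change box1 F G (pc10 k f) = pc10 (box1 F G k) (box0 F G f)
    induction f using ind0 with
    | ha x y h h' => simp only [map_add, h, h']
    | ht f₁ f₂ =>
    induction k using ind1 with
    | ha x y h h' => simp only [map_add, LinearMap.add_apply, h, h']
    | hl a b => rw [pc10_pinl, box0_tmul, box1_pinl, box1_pinl, pc10_pinl, map_c00, map_c10]
    | hr a b => rw [pc10_pinr, box0_tmul, box1_pinr, box1_pinr, pc10_pinr, map_c00, map_c10]

/-- Degree `0` part of the swap. -/
def swap0 {U V : A × B} : P0 U V →ₗ[ℂ] P0 U.swap V.swap :=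
  (TensorProduct.comm ℂ (H0 U.1 V.1) (H0 U.2 V.2)).toLinearMap

theorem swap0_tmul {U V : A × B} (f : H0 U.1 V.1) (g : H0 U.2 V.2) :
    swap0 (f ⊗ₜ g : P0 U V) = g ⊗ₜ f := TensorProduct.comm_tmul _ _ _ _ _

/-- Degree `-1` part of the swap. -/
def swap1 {U V : A × B} : P1 U V →ₗ[ℂ] P1 U.swap V.swap :=
  plift ((pinr : _ →ₗ[ℂ] P1 U.swap V.swap) ∘ₗ
      (TensorProduct.comm ℂ (H1 U.1 V.1) (H0 U.2 V.2)).toLinearMap)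
    ((pinl : _ →ₗ[ℂ] P1 U.swap V.swap) ∘ₗ
      (TensorProduct.comm ℂ (H0 U.1 V.1) (H1 U.2 V.2)).toLinearMap) (by
    intro κ μ
    simp only [LinearMap.comp_apply, LinearEquiv.coe_coe, TensorProduct.comm_tmul]
    exact (prel (U := U.swap) (V := V.swap) μ κ).symm)

theorem swap1_pinl {U V : A × B} (κ : H1 U.1 V.1) (g : H0 U.2 V.2) :
    swap1 (pinl (κ ⊗ₜ g) : P1 U V) = (pinr (g ⊗ₜ κ) : P1 U.swap V.swap) := by
  rw [swap1, plift_pinl]; rfl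

theorem swap1_pinr {U V : A × B} (f : H0 U.1 V.1) (κ : H1 U.2 V.2) :
    swap1 (pinr (f ⊗ₜ κ) : P1 U V) = (pinl (κ ⊗ₜ f) : P1 U.swap V.swap) := by
  rw [swap1, plift_pinr]; rfl

/-- The symmetry `τ` of `⊠`, `(U, V) ↦ (V, U)`. -/
def swap (A B : Type u) [ChCat.{v} A] [ChCat.{v} B] : ChFunctor (A × B) (B × A) where
  obj U := U.swap
  map0 := swap0
  map1 := swap1
  map_d {U V} k := by
    change swap0 (pd k) = pd (swap1 k)
    induction k using ind1 with
    | ha x y h h' => simp only [map_add, h, h']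
    | hl a b => rw [pd_pinl, swap0_tmul, swap1_pinl]; exact (pd_pinr (U := U.swap) (V := V.swap) b a).symm
    | hr a b => rw [pd_pinr, swap0_tmul, swap1_pinr]; exact (pd_pinl (U := U.swap) (V := V.swap) b a).symm
  map_one U := by
    change swap0 (one U.1 ⊗ₜ one U.2) = one U.2 ⊗ₜ one U.1
    rw [swap0_tmul]
  map_c00 {U V W} g f := by
    change swap0 (pc00 g f) = pc00 (swap0 g) (swap0 f)
    induction g using ind0 with
    | ha x y h h' => simp only [map_add, LinearMap.add_apply, h, h']
    | ht g₁ g₂ =>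
    induction f using ind0 with
    | ha x y h h' => simp only [map_add, h, h']
    | ht f₁ f₂ =>
      rw [pc00_tmul, swap0_tmul, swap0_tmul, swap0_tmul]
      exact (pc00_tmul (U := U.swap) (V := V.swap) (W := W.swap) g₂ g₁ f₂ f₁).symm
  map_c01 {U V W} g k := by
    change swap1 (pc01 g k) = pc01 (swap0 g) (swap1 k)
    induction g using ind0 with
    | ha x y h h' => simp only [map_add, LinearMap.add_apply, h, h']
    | ht g₁ g₂ =>
    induction k using ind1 with
    | ha x y h h' => simp only [map_add, h, h']
    | hl a b =>
      rw [pc01_pinl, swap0_tmul, swap1_pinl, swap1_pinl]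
      exact (pc01_pinr (U := U.swap) (V := V.swap) (W := W.swap) g₂ g₁ b a).symm
    | hr a b =>
      rw [pc01_pinr, swap0_tmul, swap1_pinr, swap1_pinr]
      exact (pc01_pinl (U := U.swap) (V := V.swap) (W := W.swap) g₂ g₁ b a).symm
  map_c10 {U V W} k f := by
    change swap1 (pc10 k f) = pc10 (swap1 k) (swap0 f)
    induction f using ind0 with
    | ha x y h h' => simp only [map_add, h, h']
    | ht f₁ f₂ =>
    induction k using ind1 with
    | ha x y h h' => simp only [map_add, LinearMap.add_apply, h, h']
    | hl a b =>
      rw [pc10_pinl, swap0_tmul, swap1_pinl, swap1_pinl]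
      exact (pc10_pinr (U := U.swap) (V := V.swap) (W := W.swap) b a f₂ f₁).symm
    | hr a b =>
      rw [pc10_pinr, swap0_tmul, swap1_pinr, swap1_pinr]
      exact (pc10_pinl (U := U.swap) (V := V.swap) (W := W.swap) b a f₂ f₁).symm

/-- The functor `V ↦ (I, V)`. -/
def insL (I : A) : ChFunctor B (A × B) where
  obj V := (I, V)
  map0 {U V} := (TensorProduct.mk ℂ (H0 I I) (H0 U V) (one I) : _ →ₗ[ℂ] P0 (I, U) (I, V))
  map1 {U V} := (pinr : _ →ₗ[ℂ] P1 (I, U) (I, V)) ∘ₗ TensorProduct.mk ℂ (H0 I I) (H1 U V) (one I)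
  map_d {U V} k := (pd_pinr (U := (I, U)) (V := (I, V)) (one I) k).symm
  map_one _ := rfl
  map_c00 {U V W} g f := by
    refine Eq.trans ?_ (pc00_tmul (U := (I, U)) (V := (I, V)) (W := (I, W)) (one I) g (one I) f).symm
    rw [c00_one]; rfl
  map_c01 {U V W} g f := by
    refine Eq.trans ?_ (pc01_pinr (U := (I, U)) (V := (I, V)) (W := (I, W)) (one I) g (one I) f).symm
    rw [c00_one]; rfl
  map_c10 {U V W} g f := by
    refine Eq.trans ?_ (pc10_pinr (U := (I, U)) (V := (I, V)) (W := (I, W)) (one I) g (one I) f).symm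
    rw [c00_one]; rfl

/-- The functor `V ↦ (V, I)`. -/
def insR (I : B) : ChFunctor A (A × B) := (swap B A).comp (insL I)

section Assoc

theorem ind3 {U V : (A × B) × E} {P : P0 U V → Prop}
    (ht : ∀ (f : H0 U.1.1 V.1.1) (g : H0 U.1.2 V.1.2) (h : H0 U.2 V.2),
      P ((f ⊗ₜ g : P0 U.1 V.1) ⊗ₜ h))
    (ha : ∀ x y, P x → P y → P (x + y)) (x : P0 U V) : P x := by
  refine ind0 (fun f h => ?_) ha x
  refine ind0 (U := U.1) (V := V.1) (P := fun f => P (f ⊗ₜ h)) (fun f g => ht f g h) ?_ f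
  intro x y hx hy
  exact (congrArg P (TensorProduct.add_tmul x y h)).mpr (ha _ _ hx hy)

theorem ind31 {U V : (A × B) × E} {P : P1 U V → Prop}
    (h1 : ∀ (κ : H1 U.1.1 V.1.1) (g : H0 U.1.2 V.1.2) (h : H0 U.2 V.2),
      P (pinl ((pinl (κ ⊗ₜ g) : P1 U.1 V.1) ⊗ₜ h)))
    (h2 : ∀ (f : H0 U.1.1 V.1.1) (κ : H1 U.1.2 V.1.2) (h : H0 U.2 V.2),
      P (pinl ((pinr (f ⊗ₜ κ) : P1 U.1 V.1) ⊗ₜ h)))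
    (h3 : ∀ (f : H0 U.1.1 V.1.1) (g : H0 U.1.2 V.1.2) (κ : H1 U.2 V.2),
      P (pinr ((f ⊗ₜ g : P0 U.1 V.1) ⊗ₜ κ)))
    (ha : ∀ x y, P x → P y → P (x + y)) (x : P1 U V) : P x := by
  refine ind1 (fun κ h => ?_) (fun f κ => ?_) ha x
  · refine ind1 (U := U.1) (V := V.1) (P := fun k => P (pinl (k ⊗ₜ h)))
      (fun k g => h1 k g h) (fun f k => h2 f k h) ?_ κ
    intro x y hx hy
    have e : (pinl ((x + y : P1 U.1 V.1) ⊗ₜ h) : P1 U V)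
        = pinl (x ⊗ₜ h) + pinl (y ⊗ₜ h) := by
      rw [← map_add]; exact congrArg _ (TensorProduct.add_tmul x y h)
    exact (congrArg P e).mpr (ha _ _ hx hy)
  · refine ind0 (U := U.1) (V := V.1) (P := fun f => P (pinr (f ⊗ₜ κ)))
      (fun f g => h3 f g κ) ?_ f
    intro x y hx hy
    have e : (pinr ((x + y : P0 U.1 V.1) ⊗ₜ κ) : P1 U V)
        = pinr (x ⊗ₜ κ) + pinr (y ⊗ₜ κ) := by
      rw [← map_add]; exact congrArg _ (TensorProduct.add_tmul x y κ)
    exact (congrArg P e).mpr (ha _ _ hx hy)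

/-- Objects of `A ⊠ (B ⊠ E)` from objects of `(A ⊠ B) ⊠ E`. -/
abbrev reb (U : (A × B) × E) : A × (B × E) := (U.1.1, (U.1.2, U.2))

/-- Degree `0` part of the associator of `⊠`. -/
def assoc0 {U V : (A × B) × E} : P0 U V →ₗ[ℂ] P0 (reb U) (reb V) :=
  (TensorProduct.assoc ℂ (H0 U.1.1 V.1.1) (H0 U.1.2 V.1.2) (H0 U.2 V.2)).toLinearMap

theorem assoc0_tmul {U V : (A × B) × E} (f : H0 U.1.1 V.1.1) (g : H0 U.1.2 V.1.2)
    (h : H0 U.2 V.2) :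
    assoc0 ((f ⊗ₜ g : P0 U.1 V.1) ⊗ₜ h : P0 U V)
      = (f ⊗ₜ (g ⊗ₜ h : P0 (U.1.2, U.2) (V.1.2, V.2)) : P0 (reb U) (reb V)) := rfl

/-- The associator on `H1 ⊗ H0`, where `H1` belongs to `A ⊠ B`. -/
def assocL {U V : (A × B) × E} : P1 U.1 V.1 →ₗ[ℂ] H0 U.2 V.2 →ₗ[ℂ] P1 (reb U) (reb V) :=
  plift (TensorProduct.curry ((pinl : _ →ₗ[ℂ] P1 (reb U) (reb V)) ∘ₗ
      (TensorProduct.assoc ℂ (H1 U.1.1 V.1.1) (H0 U.1.2 V.1.2) (H0 U.2 V.2)).toLinearMap))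
    (TensorProduct.curry ((pinr : _ →ₗ[ℂ] P1 (reb U) (reb V)) ∘ₗ
      LinearMap.lTensor (H0 U.1.1 V.1.1) (pinl : _ →ₗ[ℂ] P1 (U.1.2, U.2) (V.1.2, V.2)) ∘ₗ
      (TensorProduct.assoc ℂ (H0 U.1.1 V.1.1) (H1 U.1.2 V.1.2) (H0 U.2 V.2)).toLinearMap)) (by
    intro κ μ
    ext h
    have e := prel (U := reb U) (V := reb V) κ
      (pinl (μ ⊗ₜ h) : P1 (U.1.2, U.2) (V.1.2, V.2))
    exact e.trans (congrArg (fun z => (pinl (κ ⊗ₜ z) : P1 (reb U) (reb V)))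
      (pd_pinl (U := (U.1.2, U.2)) (V := (V.1.2, V.2)) μ h)))

theorem assocL_pinl {U V : (A × B) × E} (κ : H1 U.1.1 V.1.1) (g : H0 U.1.2 V.1.2)
    (h : H0 U.2 V.2) :
    assocL (U := U) (V := V) (pinl (κ ⊗ₜ g)) h
      = (pinl (κ ⊗ₜ (g ⊗ₜ h : P0 (U.1.2, U.2) (V.1.2, V.2))) : P1 (reb U) (reb V)) := by
  rw [assocL, plift_pinl]; rfl

theorem assocL_pinr {U V : (A × B) × E} (f : H0 U.1.1 V.1.1) (κ : H1 U.1.2 V.1.2)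
    (h : H0 U.2 V.2) :
    assocL (U := U) (V := V) (pinr (f ⊗ₜ κ)) h
      = (pinr (f ⊗ₜ (pinl (κ ⊗ₜ h) : P1 (U.1.2, U.2) (V.1.2, V.2))) : P1 (reb U) (reb V)) := by
  rw [assocL, plift_pinr]; rfl

/-- The associator on `H0 ⊗ H1`, where `H0` belongs to `A ⊠ B`. -/
def assocR {U V : (A × B) × E} : (P0 U.1 V.1 ⊗[ℂ] H1 U.2 V.2) →ₗ[ℂ] P1 (reb U) (reb V) :=
  (pinr : _ →ₗ[ℂ] P1 (reb U) (reb V)) ∘ₗ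
    LinearMap.lTensor (H0 U.1.1 V.1.1) (pinr : _ →ₗ[ℂ] P1 (U.1.2, U.2) (V.1.2, V.2)) ∘ₗ
    (TensorProduct.assoc ℂ (H0 U.1.1 V.1.1) (H0 U.1.2 V.1.2) (H1 U.2 V.2)).toLinearMap

theorem assocR_tmul {U V : (A × B) × E} (f : H0 U.1.1 V.1.1) (g : H0 U.1.2 V.1.2)
    (κ : H1 U.2 V.2) :
    assocR (U := U) (V := V) ((f ⊗ₜ g : P0 U.1 V.1) ⊗ₜ κ)
      = (pinr (f ⊗ₜ (pinr (g ⊗ₜ κ) : P1 (U.1.2, U.2) (V.1.2, V.2))) : P1 (reb U) (reb V)) := rfl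

theorem assoc_rel {U V : (A × B) × E} (κ : P1 U.1 V.1) (μ : H1 U.2 V.2) :
    assocR (U := U) (V := V) (pd κ ⊗ₜ μ) = assocL (U := U) (V := V) κ (d μ) := by
  induction κ using ind1 with
  | ha x y h h' => rw [map_add, map_add, TensorProduct.add_tmul, map_add, h, h']; rfl
  | hl k g =>
    rw [pd_pinl, assocR_tmul, assocL_pinl]
    have e := prel (U := reb U) (V := reb V) k (pinr (g ⊗ₜ μ) : P1 (U.1.2, U.2) (V.1.2, V.2))
    exact e.trans (congrArg (fun z => (pinl (k ⊗ₜ z) : P1 (reb U) (reb V)))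
      (pd_pinr (U := (U.1.2, U.2)) (V := (V.1.2, V.2)) g μ))
  | hr f k =>
    rw [pd_pinr, assocR_tmul, assocL_pinr]
    exact congrArg (fun z => (pinr (f ⊗ₜ z) : P1 (reb U) (reb V)))
      (prel (U := (U.1.2, U.2)) (V := (V.1.2, V.2)) k μ)

/-- Degree `-1` part of the associator of `⊠`. -/
def assoc1 {U V : (A × B) × E} : P1 U V →ₗ[ℂ] P1 (reb U) (reb V) :=
  plift (TensorProduct.lift assocL) assocR (fun κ μ =>
    (assoc_rel κ μ).trans (TensorProduct.lift.tmul _ _).symm)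

theorem assoc1_1 {U V : (A × B) × E} (κ : H1 U.1.1 V.1.1) (g : H0 U.1.2 V.1.2)
    (h : H0 U.2 V.2) :
    assoc1 (pinl ((pinl (κ ⊗ₜ g) : P1 U.1 V.1) ⊗ₜ h) : P1 U V)
      = (pinl (κ ⊗ₜ (g ⊗ₜ h : P0 (U.1.2, U.2) (V.1.2, V.2))) : P1 (reb U) (reb V)) := by
  rw [assoc1, plift_pinl]; exact assocL_pinl κ g h

theorem assoc1_2 {U V : (A × B) × E} (f : H0 U.1.1 V.1.1) (κ : H1 U.1.2 V.1.2)
    (h : H0 U.2 V.2) :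
    assoc1 (pinl ((pinr (f ⊗ₜ κ) : P1 U.1 V.1) ⊗ₜ h) : P1 U V)
      = (pinr (f ⊗ₜ (pinl (κ ⊗ₜ h) : P1 (U.1.2, U.2) (V.1.2, V.2))) : P1 (reb U) (reb V)) := by
  rw [assoc1, plift_pinl]; exact assocL_pinr f κ h

theorem assoc1_3 {U V : (A × B) × E} (f : H0 U.1.1 V.1.1) (g : H0 U.1.2 V.1.2)
    (κ : H1 U.2 V.2) :
    assoc1 (pinr ((f ⊗ₜ g : P0 U.1 V.1) ⊗ₜ κ) : P1 U V)
      = (pinr (f ⊗ₜ (pinr (g ⊗ₜ κ) : P1 (U.1.2, U.2) (V.1.2, V.2))) : P1 (reb U) (reb V)) := by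
  rw [assoc1, plift_pinr]; rfl

/-- The associator of `⊠`. -/
def assoc (A B E : Type u) [ChCat.{v} A] [ChCat.{v} B] [ChCat.{v} E] :
    ChFunctor ((A × B) × E) (A × (B × E)) where
  obj := reb
  map0 := assoc0
  map1 := assoc1
  map_d {U V} k := by
    change assoc0 (pd k) = pd (assoc1 k)
    induction k using ind31 with
    | ha x y h h' => simp only [map_add, h, h']
    | h1 k g h =>
      rw [pd_pinl, assoc1_1]
      change assoc0 (pd (pinl (k ⊗ₜ g)) ⊗ₜ h) = _
      rw [pd_pinl, assoc0_tmul]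
      exact (pd_pinl (U := reb U) (V := reb V) _ _).symm
    | h2 f k h =>
      rw [pd_pinl, assoc1_2]
      change assoc0 (pd (pinr (f ⊗ₜ k)) ⊗ₜ h) = _
      rw [pd_pinr, assoc0_tmul]
      refine Eq.trans ?_ (pd_pinr (U := reb U) (V := reb V) _ _).symm
      exact congrArg (fun z => (f ⊗ₜ z : P0 (reb U) (reb V))) (pd_pinl (U := (U.1.2, U.2)) (V := (V.1.2, V.2)) k h).symm
    | h3 f g k =>
      rw [pd_pinr, assoc1_3, assoc0_tmul]
      refine Eq.trans ?_ (pd_pinr (U := reb U) (V := reb V) _ _).symm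
      exact congrArg (fun z => (f ⊗ₜ z : P0 (reb U) (reb V))) (pd_pinr (U := (U.1.2, U.2)) (V := (V.1.2, V.2)) g k).symm
  map_one U := rfl
  map_c00 {U V W} g f := by
    change assoc0 (pc00 g f) = pc00 (assoc0 g) (assoc0 f)
    induction g using ind3 with
    | ha x y h h' => simp only [map_add, LinearMap.add_apply, h, h']
    | ht g₁ g₂ g₃ =>
    induction f using ind3 with
    | ha x y h h' => simp only [map_add, h, h']
    | ht f₁ f₂ f₃ =>
      rw [pc00_tmul, assoc0_tmul, assoc0_tmul]
      change assoc0 (pc00 (U := U.1) (V := V.1) (W := W.1) (g₁ ⊗ₜ g₂) (f₁ ⊗ₜ f₂) ⊗ₜ _) = _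
      rw [pc00_tmul, assoc0_tmul]
      refine Eq.trans ?_ (pc00_tmul (U := reb U) (V := reb V) (W := reb W) _ _ _ _).symm
      exact congrArg (fun z => (c00 g₁ f₁ ⊗ₜ z : P0 (reb U) (reb W)))
        (pc00_tmul (U := (U.1.2, U.2)) (V := (V.1.2, V.2)) (W := (W.1.2, W.2)) g₂ g₃ f₂ f₃).symm
  map_c01 {U V W} g k := by
    change assoc1 (pc01 g k) = pc01 (assoc0 g) (assoc1 k)
    induction g using ind3 with
    | ha x y h h' => simp only [map_add, LinearMap.add_apply, h, h']
    | ht g₁ g₂ g₃ =>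
    induction k using ind31 with
    | ha x y h h' => simp only [map_add, h, h']
    | h1 f₁ f₂ f₃ =>
      rw [pc01_pinl, assoc0_tmul, assoc1_1]
      change assoc1 (pinl (pc01 (U := U.1) (V := V.1) (W := W.1) (g₁ ⊗ₜ g₂) (pinl (f₁ ⊗ₜ f₂)) ⊗ₜ _)) = _
      rw [pc01_pinl, assoc1_1]
      refine Eq.trans ?_ (pc01_pinl (U := reb U) (V := reb V) (W := reb W) _ _ _ _).symm
      exact congrArg (fun z => (pinl (c01 g₁ f₁ ⊗ₜ z) : P1 (reb U) (reb W)))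
        (pc00_tmul (U := (U.1.2, U.2)) (V := (V.1.2, V.2)) (W := (W.1.2, W.2)) g₂ g₃ f₂ f₃).symm
    | h2 f₁ f₂ f₃ =>
      rw [pc01_pinl, assoc0_tmul, assoc1_2]
      change assoc1 (pinl (pc01 (U := U.1) (V := V.1) (W := W.1) (g₁ ⊗ₜ g₂) (pinr (f₁ ⊗ₜ f₂)) ⊗ₜ _)) = _
      rw [pc01_pinr, assoc1_2]
      refine Eq.trans ?_ (pc01_pinr (U := reb U) (V := reb V) (W := reb W) _ _ _ _).symm
      exact congrArg (fun z => (pinr (c00 g₁ f₁ ⊗ₜ z) : P1 (reb U) (reb W)))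
        (pc01_pinl (U := (U.1.2, U.2)) (V := (V.1.2, V.2)) (W := (W.1.2, W.2)) g₂ g₃ f₂ f₃).symm
    | h3 f₁ f₂ f₃ =>
      rw [pc01_pinr, assoc0_tmul, assoc1_3]
      change assoc1 (pinr (pc00 (U := U.1) (V := V.1) (W := W.1) (g₁ ⊗ₜ g₂) (f₁ ⊗ₜ f₂) ⊗ₜ _)) = _
      rw [pc00_tmul, assoc1_3]
      refine Eq.trans ?_ (pc01_pinr (U := reb U) (V := reb V) (W := reb W) _ _ _ _).symm
      exact congrArg (fun z => (pinr (c00 g₁ f₁ ⊗ₜ z) : P1 (reb U) (reb W)))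
        (pc01_pinr (U := (U.1.2, U.2)) (V := (V.1.2, V.2)) (W := (W.1.2, W.2)) g₂ g₃ f₂ f₃).symm
  map_c10 {U V W} k g := by
    change assoc1 (pc10 k g) = pc10 (assoc1 k) (assoc0 g)
    induction g using ind3 with
    | ha x y h h' => simp only [map_add, h, h']
    | ht g₁ g₂ g₃ =>
    induction k using ind31 with
    | ha x y h h' => simp only [map_add, LinearMap.add_apply, h, h']
    | h1 f₁ f₂ f₃ =>
      rw [pc10_pinl, assoc0_tmul, assoc1_1]
      change assoc1 (pinl (pc10 (U := U.1) (V := V.1) (W := W.1) (pinl (f₁ ⊗ₜ f₂)) (g₁ ⊗ₜ g₂) ⊗ₜ _)) = _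
      rw [pc10_pinl, assoc1_1]
      refine Eq.trans ?_ (pc10_pinl (U := reb U) (V := reb V) (W := reb W) _ _ _ _).symm
      exact congrArg (fun z => (pinl (c10 f₁ g₁ ⊗ₜ z) : P1 (reb U) (reb W)))
        (pc00_tmul (U := (U.1.2, U.2)) (V := (V.1.2, V.2)) (W := (W.1.2, W.2)) f₂ f₃ g₂ g₃).symm
    | h2 f₁ f₂ f₃ =>
      rw [pc10_pinl, assoc0_tmul, assoc1_2]
      change assoc1 (pinl (pc10 (U := U.1) (V := V.1) (W := W.1) (pinr (f₁ ⊗ₜ f₂)) (g₁ ⊗ₜ g₂) ⊗ₜ _)) = _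
      rw [pc10_pinr, assoc1_2]
      refine Eq.trans ?_ (pc10_pinr (U := reb U) (V := reb V) (W := reb W) _ _ _ _).symm
      exact congrArg (fun z => (pinr (c00 f₁ g₁ ⊗ₜ z) : P1 (reb U) (reb W)))
        (pc10_pinl (U := (U.1.2, U.2)) (V := (V.1.2, V.2)) (W := (W.1.2, W.2)) f₂ f₃ g₂ g₃).symm
    | h3 f₁ f₂ f₃ =>
      rw [pc10_pinr, assoc0_tmul, assoc1_3]
      change assoc1 (pinr (pc00 (U := U.1) (V := V.1) (W := W.1) (f₁ ⊗ₜ f₂) (g₁ ⊗ₜ g₂) ⊗ₜ _)) = _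
      rw [pc00_tmul, assoc1_3]
      refine Eq.trans ?_ (pc10_pinr (U := reb U) (V := reb V) (W := reb W) _ _ _ _).symm
      exact congrArg (fun z => (pinr (c00 f₁ g₁ ⊗ₜ z) : P1 (reb U) (reb W)))
        (pc10_pinr (U := (U.1.2, U.2)) (V := (V.1.2, V.2)) (W := (W.1.2, W.2)) f₂ f₃ g₂ g₃).symm

end Assoc

/-- `τ τ = id`. -/
theorem swap_swap (A B : Type u) [ChCat.{v} A] [ChCat.{v} B] :
    (swap B A).comp (swap A B) = ChFunctor.id (A × B) := by
  refine ext_maps (o := fun U => U) rfl rfl (fun U V f => heq_of_eq ?_) (fun U V k => heq_of_eq ?_)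
  · change swap0 (U := U.swap) (V := V.swap) (swap0 f) = f
    induction f using ind0 with
    | ha x y h h' =>
      rw [map_add]
      exact (map_add (swap0 (U := U.swap) (V := V.swap)) _ _).trans (congrArg₂ _ h h')
    | ht f g => rw [swap0_tmul]; exact swap0_tmul (U := U.swap) (V := V.swap) g f
  · change swap1 (U := U.swap) (V := V.swap) (swap1 k) = k
    induction k using ind1 with
    | ha x y h h' =>
      rw [map_add]
      exact (map_add (swap1 (U := U.swap) (V := V.swap)) _ _).trans (congrArg₂ _ h h')
    | hl f g => rw [swap1_pinl]; exact swap1_pinr (U := U.swap) (V := V.swap) g f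
    | hr f g => rw [swap1_pinr]; exact swap1_pinl (U := U.swap) (V := V.swap) g f

/-- `(G F) ⊠ (G' F') = (G ⊠ G') (F ⊠ F')`. -/
theorem box_comp {A' C' E' : Type u} [ChCat.{v} A'] [ChCat.{v} C'] [ChCat.{v} E']
    (G : ChFunctor C E) (F : ChFunctor A C) (G' : ChFunctor C' E') (F' : ChFunctor A' C') :
    box (G.comp F) (G'.comp F') = (box G G').comp (box F F') := by
  refine ext_maps rfl rfl (fun U V f => heq_of_eq ?_) (fun U V k => heq_of_eq ?_)
  · change box0 (G.comp F) (G'.comp F') f = box0 G G' (box0 F F' f)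
    induction f using ind0 with
    | ha x y h h' =>
      rw [map_add, map_add]
      exact (congrArg₂ (· + ·) h h').trans (map_add (box0 G G' (U := (F.obj U.1, F'.obj U.2)) (V := (F.obj V.1, F'.obj V.2))) _ _).symm
    | ht f g => rw [box0_tmul, box0_tmul]; exact (box0_tmul G G' (U := (F.obj U.1, F'.obj U.2)) (V := (F.obj V.1, F'.obj V.2)) (F.map0 f) (F'.map0 g)).symm
  · change box1 (G.comp F) (G'.comp F') k = box1 G G' (box1 F F' k)
    induction k using ind1 with
    | ha x y h h' =>
      rw [map_add, map_add]
      exact (congrArg₂ (· + ·) h h').trans (map_add (box1 G G' (U := (F.obj U.1, F'.obj U.2)) (V := (F.obj V.1, F'.obj V.2))) _ _).symm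
    | hl f g => rw [box1_pinl, box1_pinl]; exact (box1_pinl G G' (U := (F.obj U.1, F'.obj U.2)) (V := (F.obj V.1, F'.obj V.2)) (F.map1 f) (F'.map0 g)).symm
    | hr f g => rw [box1_pinr, box1_pinr]; exact (box1_pinr G G' (U := (F.obj U.1, F'.obj U.2)) (V := (F.obj V.1, F'.obj V.2)) (F.map0 f) (F'.map1 g)).symm

end ChFunctor

/-! ### Pseudonatural transformations -/

/-- A pseudonatural transformation `ξ : F ⇒ G`: the components `ξ_U` are `app U`, and the homotopy
components `ξ_f` are `hpy U V f`. The homotopy takes values in degree `-1` on degree `0` and vanishes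
on degree `-1` for degree reasons, so that the single homotopy axiom splits into `nat0`, `nat1`. -/
@[ext]
structure PsNat {C D : Type u} [ChCat.{v} C] [ChCat.{v} D] (F G : ChFunctor C D) where
  app : ∀ U : C, H0 (F.obj U) (G.obj U)
  hpy : ∀ U V : C, H0 U V →ₗ[ℂ] H1 (F.obj U) (G.obj V)
  nat0 : ∀ {U V : C} (f : H0 U V),
    c00 (G.map0 f) (app U) - c00 (app V) (F.map0 f) = d (hpy U V f)
  nat1 : ∀ {U V : C} (k : H1 U V),
    c10 (G.map1 k) (app U) - c01 (app V) (F.map1 k) = hpy U V (d k)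
  split : ∀ {U V W : C} (g : H0 V W) (f : H0 U V),
    hpy U W (c00 g f) = c10 (hpy V W g) (F.map0 f) + c01 (G.map0 g) (hpy U V f)

namespace PsNat

variable {A B C D E : Type u} [ChCat.{v} A] [ChCat.{v} B] [ChCat.{v} C] [ChCat.{v} D] [ChCat.{v} E]
variable {F G H K : ChFunctor C D}

instance : Zero (PsNat F G) where
  zero :=
    { app := fun _ => 0
      hpy := fun _ _ => 0
      nat0 := fun f => by simp
      nat1 := fun f => by simp
      split := fun g f => by simp }

instance : Add (PsNat F G) where
  add ξ θ :=
    { app := fun U => ξ.app U + θ.app U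
      hpy := fun U V => ξ.hpy U V + θ.hpy U V
      nat0 := fun f => by
        simp only [map_add, LinearMap.add_apply, ← nat0]; abel
      nat1 := fun f => by
        simp only [map_add, LinearMap.add_apply, ← nat1]; abel
      split := fun g f => by
        simp only [map_add, LinearMap.add_apply, split]; abel }

instance : Neg (PsNat F G) where
  neg ξ :=
    { app := fun U => -ξ.app U
      hpy := fun U V => -ξ.hpy U V
      nat0 := fun f => by
        simp only [map_neg, LinearMap.neg_apply, ← nat0]; abel
      nat1 := fun f => by
        simp only [map_neg, LinearMap.neg_apply, ← nat1]; abel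
      split := fun g f => by
        simp only [map_neg, LinearMap.neg_apply, split]; abel }

instance : SMul ℂ (PsNat F G) where
  smul c ξ :=
    { app := fun U => c • ξ.app U
      hpy := fun U V => c • ξ.hpy U V
      nat0 := fun f => by
        simp only [map_smul, LinearMap.smul_apply, ← nat0, smul_sub]
      nat1 := fun f => by
        simp only [map_smul, LinearMap.smul_apply, ← nat1, smul_sub]
      split := fun g f => by
        simp only [map_smul, LinearMap.smul_apply, split, smul_add] }

@[simp] theorem zero_app (U : C) : (0 : PsNat F G).app U = 0 := rfl
@[simp] theorem zero_hpy (U V : C) : (0 : PsNat F G).hpy U V = 0 := rfl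
@[simp] theorem add_app (ξ θ : PsNat F G) (U : C) : (ξ + θ).app U = ξ.app U + θ.app U := rfl
@[simp] theorem add_hpy (ξ θ : PsNat F G) (U V : C) :
    (ξ + θ).hpy U V = ξ.hpy U V + θ.hpy U V := rfl
@[simp] theorem neg_app (ξ : PsNat F G) (U : C) : (-ξ).app U = -ξ.app U := rfl
@[simp] theorem neg_hpy (ξ : PsNat F G) (U V : C) : (-ξ).hpy U V = -ξ.hpy U V := rfl
@[simp] theorem smul_app (c : ℂ) (ξ : PsNat F G) (U : C) : (c • ξ).app U = c • ξ.app U := rfl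
@[simp] theorem smul_hpy (c : ℂ) (ξ : PsNat F G) (U V : C) :
    (c • ξ).hpy U V = c • ξ.hpy U V := rfl

instance : AddCommGroup (PsNat F G) where
  add_assoc a b c := by ext <;> simp [add_assoc]
  zero_add a := by ext <;> simp
  add_zero a := by ext <;> simp
  add_comm a b := by ext <;> simp [add_comm]
  neg_add_cancel a := by ext <;> simp
  nsmul := nsmulRec
  zsmul := zsmulRec

instance : Module ℂ (PsNat F G) where
  one_smul a := by ext <;> simp
  mul_smul a b c := by ext <;> simp [mul_smul]
  smul_zero a := by ext <;> simp
  smul_add a b c := by ext <;> simp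
  add_smul a b c := by ext <;> simp [add_smul]
  zero_smul a := by ext <;> simp

@[simp] theorem sub_app (ξ θ : PsNat F G) (U : C) : (ξ - θ).app U = ξ.app U - θ.app U := by
  simp [sub_eq_add_neg]
@[simp] theorem sub_hpy (ξ θ : PsNat F G) (U V : C) :
    (ξ - θ).hpy U V = ξ.hpy U V - θ.hpy U V := by
  simp [sub_eq_add_neg]

/-- The identity pseudonatural transformation. -/
def id (F : ChFunctor C D) : PsNat F F where
  app U := ChCat.one (F.obj U)
  hpy _ _ := 0
  nat0 f := by simp [c00_one, one_c00]
  nat1 k := by simp [c10_one, one_c01]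
  split g f := by simp

/-- The vertical composite `θ ξ`. -/
def vcomp (θ : PsNat G H) (ξ : PsNat F G) : PsNat F H where
  app U := c00 (θ.app U) (ξ.app U)
  hpy U V := c10.flip (ξ.app U) ∘ₗ θ.hpy U V + c01 (θ.app V) ∘ₗ ξ.hpy U V
  nat0 {U V} f := by
    simp only [LinearMap.add_apply, LinearMap.comp_apply, LinearMap.flip_apply, map_add, d_c10,
      d_c01, ← nat0, map_sub, LinearMap.sub_apply, assoc000]
    abel
  nat1 {U V} k := by
    simp only [LinearMap.add_apply, LinearMap.comp_apply, LinearMap.flip_apply,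
      ← nat1, map_sub, assoc001, assoc010, assoc100]
    abel
  split {U V W} g f := by
    have h1 := peiffer (θ.hpy V W g) (ξ.hpy U V f)
    rw [← nat0, ← nat0] at h1
    simp only [map_sub, LinearMap.sub_apply, assoc001, ← assoc100] at h1
    simp only [LinearMap.add_apply, LinearMap.comp_apply, LinearMap.flip_apply, split,
      map_add, ← assoc001, assoc100, ← assoc010] at h1 ⊢
    simp only [assoc010, assoc001, ← assoc100] at h1 ⊢
    have h2 : c10 (c10 (θ.hpy V W g) (G.map0 f)) (ξ.app U)
        = c10 (c10 (θ.hpy V W g) (ξ.app V)) (F.map0 f)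
          + (c01 (H.map0 g) (c01 (θ.app V) (ξ.hpy U V f))
            - c01 (θ.app W) (c01 (G.map0 g) (ξ.hpy U V f))) := by
      rw [← h1]; abel
    rw [h2]
    abel

instance : One (PsNat F F) := ⟨id F⟩
instance : Mul (PsNat F F) := ⟨vcomp⟩

@[simp] theorem one_app (U : C) : (1 : PsNat F F).app U = ChCat.one (F.obj U) := rfl
@[simp] theorem one_hpy (U V : C) : (1 : PsNat F F).hpy U V = 0 := rfl
@[simp] theorem mul_app (θ ξ : PsNat F F) (U : C) :
    (θ * ξ).app U = c00 (θ.app U) (ξ.app U) := rfl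
@[simp] theorem mul_hpy (θ ξ : PsNat F F) (U V : C) (f : H0 U V) :
    (θ * ξ).hpy U V f = c10 (θ.hpy U V f) (ξ.app U) + c01 (θ.app V) (ξ.hpy U V f) := rfl

/-- Pseudonatural endomorphisms form a unital associative algebra under vertical composition. -/
instance : Ring (PsNat F F) where
  __ := (inferInstance : AddCommGroup (PsNat F F))
  mul_assoc a b c := by
    ext
    · simp [assoc000]
    · simp [assoc001, assoc010, assoc100, add_assoc]
  one_mul a := by
    ext
    · simp [one_c00]
    · simp [one_c01]
  mul_one a := by
    ext
    · simp [c00_one]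
    · simp [c10_one]
  left_distrib a b c := by
    ext
    · simp
    · simp; abel
  right_distrib a b c := by
    ext
    · simp
    · simp; abel
  zero_mul a := by ext <;> simp
  mul_zero a := by ext <;> simp

instance : Algebra ℂ (PsNat F F) :=
  Algebra.ofModule (fun r x y => by ext <;> simp) (fun r x y => by ext <;> simp)

/-- Components of `ξ ⊠ 1`. -/
def boxIdApp (ξ : PsNat F G) (J : ChFunctor A B) (U : C × A) :
    P0 (F.obj U.1, J.obj U.2) (G.obj U.1, J.obj U.2) :=
  ξ.app U.1 ⊗ₜ ChCat.one (J.obj U.2)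

/-- Homotopy components of `ξ ⊠ 1`. -/
def boxIdHpy (ξ : PsNat F G) (J : ChFunctor A B) (U V : C × A) :
    P0 U V →ₗ[ℂ] P1 (F.obj U.1, J.obj U.2) (G.obj V.1, J.obj V.2) :=
  (pinl : _ →ₗ[ℂ] P1 (F.obj U.1, J.obj U.2) (G.obj V.1, J.obj V.2)) ∘ₗ
    TensorProduct.map (ξ.hpy U.1 V.1) J.map0

theorem boxIdHpy_tmul (ξ : PsNat F G) (J : ChFunctor A B) {U V : C × A} (f : H0 U.1 V.1)
    (g : H0 U.2 V.2) :
    boxIdHpy ξ J U V (f ⊗ₜ g) = pinl (ξ.hpy U.1 V.1 f ⊗ₜ J.map0 g) := by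
  rw [boxIdHpy, LinearMap.comp_apply, TensorProduct.map_tmul]

theorem boxId_nat0 (ξ : PsNat F G) (J : ChFunctor A B) {U V : C × A} (f : P0 U V) :
    pc00 (ChFunctor.box0 G J f) (boxIdApp ξ J U) - pc00 (boxIdApp ξ J V) (ChFunctor.box0 F J f)
      = pd (boxIdHpy ξ J U V f) := by
  induction f using ind0 with
  | ha x y h h' =>
    simp only [map_add, LinearMap.add_apply, ← h, ← h']
    abel
  | ht f g =>
    rw [ChFunctor.box0_tmul, ChFunctor.box0_tmul, boxIdHpy_tmul]
    refine (congrArg₂ (· - ·) (pc00_tmul (U := (F.obj U.1, J.obj U.2))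
      (V := (G.obj U.1, J.obj U.2)) (W := (G.obj V.1, J.obj V.2)) _ _ _ _)
      (pc00_tmul (U := (F.obj U.1, J.obj U.2))
      (V := (F.obj V.1, J.obj V.2)) (W := (G.obj V.1, J.obj V.2)) _ _ _ _)).trans ?_
    refine Eq.trans ?_ (pd_pinl (U := (F.obj U.1, J.obj U.2)) (V := (G.obj V.1, J.obj V.2))
      _ _).symm
    rw [← nat0, TensorProduct.sub_tmul, c00_one, one_c00]

theorem boxId_nat1 (ξ : PsNat F G) (J : ChFunctor A B) {U V : C × A} (k : P1 U V) :
    pc10 (ChFunctor.box1 G J k) (boxIdApp ξ J U) - pc01 (boxIdApp ξ J V) (ChFunctor.box1 F J k)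
      = boxIdHpy ξ J U V (pd k) := by
  induction k using ind1 with
  | ha x y h h' =>
    simp only [map_add, LinearMap.add_apply, ← h, ← h']
    abel
  | hl k g =>
    rw [ChFunctor.box1_pinl, ChFunctor.box1_pinl, pd_pinl, boxIdHpy_tmul]
    refine (congrArg₂ (· - ·) (pc10_pinl (U := (F.obj U.1, J.obj U.2))
      (V := (G.obj U.1, J.obj U.2)) (W := (G.obj V.1, J.obj V.2)) _ _ _ _)
      (pc01_pinl (U := (F.obj U.1, J.obj U.2))
      (V := (F.obj V.1, J.obj V.2)) (W := (G.obj V.1, J.obj V.2)) _ _ _ _)).trans ?_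
    rw [← nat1, c00_one, one_c00, TensorProduct.sub_tmul, map_sub]
  | hr f k =>
    rw [ChFunctor.box1_pinr, ChFunctor.box1_pinr, pd_pinr, boxIdHpy_tmul]
    refine (congrArg₂ (· - ·) (pc10_pinr (U := (F.obj U.1, J.obj U.2))
      (V := (G.obj U.1, J.obj U.2)) (W := (G.obj V.1, J.obj V.2)) _ _ _ _)
      (pc01_pinr (U := (F.obj U.1, J.obj U.2))
      (V := (F.obj V.1, J.obj V.2)) (W := (G.obj V.1, J.obj V.2)) _ _ _ _)).trans ?_
    rw [c10_one, one_c01, ChFunctor.map_d]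
    refine Eq.trans ?_ (prel (U := (F.obj U.1, J.obj U.2)) (V := (G.obj V.1, J.obj V.2)) _ _)
    rw [← nat0, TensorProduct.sub_tmul, map_sub]

theorem boxId_split (ξ : PsNat F G) (J : ChFunctor A B) {U V W : C × A} (g : P0 V W) (f : P0 U V) :
    boxIdHpy ξ J U W (pc00 g f) = pc10 (boxIdHpy ξ J V W g) (ChFunctor.box0 F J f)
      + pc01 (ChFunctor.box0 G J g) (boxIdHpy ξ J U V f) := by
  induction g using ind0 with
  | ha x y h h' => simp only [map_add, LinearMap.add_apply, h, h']; abel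
  | ht g₁ g₂ =>
  induction f using ind0 with
  | ha x y h h' => simp only [map_add, h, h']; abel
  | ht f₁ f₂ =>
    rw [pc00_tmul, ChFunctor.box0_tmul, ChFunctor.box0_tmul, boxIdHpy_tmul, boxIdHpy_tmul, boxIdHpy_tmul]
    refine Eq.trans ?_ (congrArg₂ (· + ·) (pc10_pinl (U := (F.obj U.1, J.obj U.2))
      (V := (F.obj V.1, J.obj V.2)) (W := (G.obj W.1, J.obj W.2)) _ _ _ _)
      (pc01_pinl (U := (F.obj U.1, J.obj U.2))
      (V := (G.obj V.1, J.obj V.2)) (W := (G.obj W.1, J.obj W.2)) _ _ _ _)).symm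
    rw [split, ChFunctor.map_c00, TensorProduct.add_tmul, map_add]

/-- `ξ ⊠ 1`, where `1` is the identity of `J`. -/
def boxId (ξ : PsNat F G) (J : ChFunctor A B) : PsNat (F.box J) (G.box J) where
  app := boxIdApp ξ J
  hpy := boxIdHpy ξ J
  nat0 f := boxId_nat0 ξ J f
  nat1 k := boxId_nat1 ξ J k
  split g f := boxId_split ξ J g f

/-- Components of `1 ⊠ ξ`. -/
def idBoxApp (ξ : PsNat F G) (J : ChFunctor A B) (U : A × C) :
    P0 (J.obj U.1, F.obj U.2) (J.obj U.1, G.obj U.2) :=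
  ChCat.one (J.obj U.1) ⊗ₜ ξ.app U.2

/-- Homotopy components of `1 ⊠ ξ`. -/
def idBoxHpy (ξ : PsNat F G) (J : ChFunctor A B) (U V : A × C) :
    P0 U V →ₗ[ℂ] P1 (J.obj U.1, F.obj U.2) (J.obj V.1, G.obj V.2) :=
  (pinr : _ →ₗ[ℂ] P1 (J.obj U.1, F.obj U.2) (J.obj V.1, G.obj V.2)) ∘ₗ
    TensorProduct.map J.map0 (ξ.hpy U.2 V.2)

theorem idBoxHpy_tmul (ξ : PsNat F G) (J : ChFunctor A B) {U V : A × C} (f : H0 U.1 V.1)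
    (g : H0 U.2 V.2) :
    idBoxHpy ξ J U V (f ⊗ₜ g) = pinr (J.map0 f ⊗ₜ ξ.hpy U.2 V.2 g) := by
  rw [idBoxHpy, LinearMap.comp_apply, TensorProduct.map_tmul]

theorem idBox_nat0 (ξ : PsNat F G) (J : ChFunctor A B) {U V : A × C} (f : P0 U V) :
    pc00 (ChFunctor.box0 J G f) (idBoxApp ξ J U) - pc00 (idBoxApp ξ J V) (ChFunctor.box0 J F f)
      = pd (idBoxHpy ξ J U V f) := by
  induction f using ind0 with
  | ha x y h h' =>
    simp only [map_add, LinearMap.add_apply, ← h, ← h']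
    abel
  | ht f g =>
    rw [ChFunctor.box0_tmul, ChFunctor.box0_tmul, idBoxHpy_tmul]
    refine (congrArg₂ (· - ·) (pc00_tmul (U := (J.obj U.1, F.obj U.2))
      (V := (J.obj U.1, G.obj U.2)) (W := (J.obj V.1, G.obj V.2)) _ _ _ _)
      (pc00_tmul (U := (J.obj U.1, F.obj U.2))
      (V := (J.obj V.1, F.obj V.2)) (W := (J.obj V.1, G.obj V.2)) _ _ _ _)).trans ?_
    refine Eq.trans ?_ (pd_pinr (U := (J.obj U.1, F.obj U.2)) (V := (J.obj V.1, G.obj V.2))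
      _ _).symm
    rw [← nat0, TensorProduct.tmul_sub, c00_one, one_c00]

theorem idBox_nat1 (ξ : PsNat F G) (J : ChFunctor A B) {U V : A × C} (k : P1 U V) :
    pc10 (ChFunctor.box1 J G k) (idBoxApp ξ J U) - pc01 (idBoxApp ξ J V) (ChFunctor.box1 J F k)
      = idBoxHpy ξ J U V (pd k) := by
  induction k using ind1 with
  | ha x y h h' =>
    simp only [map_add, LinearMap.add_apply, ← h, ← h']
    abel
  | hr g k =>
    rw [ChFunctor.box1_pinr, ChFunctor.box1_pinr, pd_pinr, idBoxHpy_tmul]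
    refine (congrArg₂ (· - ·) (pc10_pinr (U := (J.obj U.1, F.obj U.2))
      (V := (J.obj U.1, G.obj U.2)) (W := (J.obj V.1, G.obj V.2)) _ _ _ _)
      (pc01_pinr (U := (J.obj U.1, F.obj U.2))
      (V := (J.obj V.1, F.obj V.2)) (W := (J.obj V.1, G.obj V.2)) _ _ _ _)).trans ?_
    rw [← nat1, c00_one, one_c00, TensorProduct.tmul_sub, map_sub]
  | hl k f =>
    rw [ChFunctor.box1_pinl, ChFunctor.box1_pinl, pd_pinl, idBoxHpy_tmul]
    refine (congrArg₂ (· - ·) (pc10_pinl (U := (J.obj U.1, F.obj U.2))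
      (V := (J.obj U.1, G.obj U.2)) (W := (J.obj V.1, G.obj V.2)) _ _ _ _)
      (pc01_pinl (U := (J.obj U.1, F.obj U.2))
      (V := (J.obj V.1, F.obj V.2)) (W := (J.obj V.1, G.obj V.2)) _ _ _ _)).trans ?_
    rw [c10_one, one_c01, ChFunctor.map_d]
    refine Eq.trans ?_ (prel (U := (J.obj U.1, F.obj U.2)) (V := (J.obj V.1, G.obj V.2)) _ _).symm
    rw [← nat0, TensorProduct.tmul_sub, map_sub]

theorem idBox_split (ξ : PsNat F G) (J : ChFunctor A B) {U V W : A × C} (g : P0 V W) (f : P0 U V) :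
    idBoxHpy ξ J U W (pc00 g f) = pc10 (idBoxHpy ξ J V W g) (ChFunctor.box0 J F f)
      + pc01 (ChFunctor.box0 J G g) (idBoxHpy ξ J U V f) := by
  induction g using ind0 with
  | ha x y h h' => simp only [map_add, LinearMap.add_apply, h, h']; abel
  | ht g₁ g₂ =>
  induction f using ind0 with
  | ha x y h h' => simp only [map_add, h, h']; abel
  | ht f₁ f₂ =>
    rw [pc00_tmul, ChFunctor.box0_tmul, ChFunctor.box0_tmul, idBoxHpy_tmul, idBoxHpy_tmul, idBoxHpy_tmul]
    refine Eq.trans ?_ (congrArg₂ (· + ·) (pc10_pinr (U := (J.obj U.1, F.obj U.2))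
      (V := (J.obj V.1, F.obj V.2)) (W := (J.obj W.1, G.obj W.2)) _ _ _ _)
      (pc01_pinr (U := (J.obj U.1, F.obj U.2))
      (V := (J.obj V.1, G.obj V.2)) (W := (J.obj W.1, G.obj W.2)) _ _ _ _)).symm
    rw [split, ChFunctor.map_c00, TensorProduct.tmul_add, map_add]

/-- `1 ⊠ ξ`, where `1` is the identity of `J`. -/
def idBox (J : ChFunctor A B) (ξ : PsNat F G) : PsNat (J.box F) (J.box G) where
  app := idBoxApp ξ J
  hpy := idBoxHpy ξ J
  nat0 f := idBox_nat0 ξ J f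
  nat1 k := idBox_nat1 ξ J k
  split g f := idBox_split ξ J g f

/-- The whiskering `L(ξ)` by a functor applied after. -/
def post (L : ChFunctor D E) (ξ : PsNat F G) : PsNat (L.comp F) (L.comp G) where
  app U := L.map0 (ξ.app U)
  hpy U V := L.map1 ∘ₗ ξ.hpy U V
  nat0 {U V} f := by
    change c00 (L.map0 (G.map0 f)) (L.map0 (ξ.app U)) - c00 (L.map0 (ξ.app V)) (L.map0 (F.map0 f))
      = d (L.map1 (ξ.hpy U V f))
    rw [← ChFunctor.map_d, ← nat0, map_sub, ChFunctor.map_c00, ChFunctor.map_c00]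
  nat1 {U V} k := by
    change c10 (L.map1 (G.map1 k)) (L.map0 (ξ.app U)) - c01 (L.map0 (ξ.app V)) (L.map1 (F.map1 k))
      = L.map1 (ξ.hpy U V (d k))
    rw [← nat1, map_sub, ChFunctor.map_c10, ChFunctor.map_c01]
  split {U V W} g f := by
    change L.map1 (ξ.hpy U W (c00 g f)) = c10 (L.map1 (ξ.hpy V W g)) (L.map0 (F.map0 f))
      + c01 (L.map0 (G.map0 g)) (L.map1 (ξ.hpy U V f))
    rw [split, map_add, ChFunctor.map_c10, ChFunctor.map_c01]

/-- The whiskering `ξ_L` by a functor applied before. -/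
def pre (ξ : PsNat F G) (L : ChFunctor B C) : PsNat (F.comp L) (G.comp L) where
  app U := ξ.app (L.obj U)
  hpy U V := ξ.hpy (L.obj U) (L.obj V) ∘ₗ L.map0
  nat0 f := ξ.nat0 (L.map0 f)
  nat1 {U V} k := by
    exact (ξ.nat1 (L.map1 k)).trans (congrArg (ξ.hpy (L.obj U) (L.obj V)) (L.map_d k).symm)
  split {U V W} g f :=
    (congrArg (ξ.hpy (L.obj U) (L.obj W)) (L.map_c00 g f)).trans (ξ.split (L.map0 g) (L.map0 f))

/-- Transport along equalities of functors. -/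
def cast {F' G' : ChFunctor C D} (hF : F = F') (hG : G = G') (ξ : PsNat F G) : PsNat F' G' :=
  hF ▸ hG ▸ ξ

/-- The coboundary of a family of degree `-1` elements. -/
def cobdry (Ξ : ∀ U : C, H1 (F.obj U) (G.obj U)) : PsNat F G where
  app U := d (Ξ U)
  hpy U V := (c01 (U := F.obj U) (V := G.obj U) (W := G.obj V)).flip (Ξ U) ∘ₗ G.map0
    - c10 (Ξ V) ∘ₗ F.map0
  nat0 f := by
    simp only [LinearMap.sub_apply, LinearMap.comp_apply, LinearMap.flip_apply, map_sub, d_c01,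
      d_c10]
  nat1 k := by
    simp only [LinearMap.sub_apply, LinearMap.comp_apply, LinearMap.flip_apply, ChFunctor.map_d,
      peiffer]
  split g f := by
    simp only [LinearMap.sub_apply, LinearMap.comp_apply, LinearMap.flip_apply, map_sub,
      ChFunctor.map_c00, assoc001, assoc010, assoc100]
    abel

end PsNat

/-- The algebra homomorphism `ξ ↦ ξ ⊠ 1`. -/
def PsNat.boxIdHom {A B C D : Type u} [ChCat.{v} A] [ChCat.{v} B] [ChCat.{v} C] [ChCat.{v} D]
    (F : ChFunctor C D) (J : ChFunctor A B) : PsNat F F →ₐ[ℂ] PsNat (F.box J) (F.box J) :=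
  AlgHom.ofLinearMap
    { toFun := fun ξ => ξ.boxId J
      map_add' := fun ξ θ => by
        refine PsNat.ext ?_ ?_
        · funext U
          exact TensorProduct.add_tmul _ _ _
        · funext U V
          refine LinearMap.ext fun f => ?_
          change PsNat.boxIdHpy (ξ + θ) J U V f
            = PsNat.boxIdHpy ξ J U V f + PsNat.boxIdHpy θ J U V f
          induction f using ind0 with
          | ha x y h h' => rw [map_add, map_add, map_add, h, h']; abel
          | ht f g =>
            rw [PsNat.boxIdHpy_tmul, PsNat.boxIdHpy_tmul, PsNat.boxIdHpy_tmul, ← map_add,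
              ← TensorProduct.add_tmul]
            rfl
      map_smul' := fun c ξ => by
        refine PsNat.ext ?_ ?_
        · funext U
          exact TensorProduct.smul_tmul' _ _ _
        · funext U V
          refine LinearMap.ext fun f => ?_
          change PsNat.boxIdHpy (c • ξ) J U V f = c • PsNat.boxIdHpy ξ J U V f
          induction f using ind0 with
          | ha x y h h' => rw [map_add, map_add, smul_add, h, h']
          | ht f g =>
            rw [PsNat.boxIdHpy_tmul, PsNat.boxIdHpy_tmul, ← map_smul, TensorProduct.smul_tmul']
            rfl }
    (by
      refine PsNat.ext ?_ ?_
      · funext U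
        rfl
      · funext U V
        refine LinearMap.ext fun f => ?_
        change PsNat.boxIdHpy 1 J U V f = 0
        induction f using ind0 with
        | ha x y h h' => rw [map_add, h, h', add_zero]
        | ht f g =>
          rw [PsNat.boxIdHpy_tmul, PsNat.one_hpy, LinearMap.zero_apply, TensorProduct.zero_tmul,
            map_zero])
    (fun ξ θ => by
      refine PsNat.ext ?_ ?_
      · funext U
        change PsNat.boxIdApp (ξ * θ) J U = pc00 (PsNat.boxIdApp ξ J U) (PsNat.boxIdApp θ J U)
        refine Eq.trans ?_ (pc00_tmul (U := (F.obj U.1, J.obj U.2)) (V := (F.obj U.1, J.obj U.2))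
          (W := (F.obj U.1, J.obj U.2)) _ _ _ _).symm
        rw [c00_one]
        rfl
      · funext U V
        refine LinearMap.ext fun f => ?_
        change PsNat.boxIdHpy (ξ * θ) J U V f
          = pc10 (PsNat.boxIdHpy ξ J U V f) (PsNat.boxIdApp θ J U)
            + pc01 (PsNat.boxIdApp ξ J V) (PsNat.boxIdHpy θ J U V f)
        induction f using ind0 with
        | ha x y h h' => simp only [map_add, LinearMap.add_apply, h, h']; abel
        | ht f g =>
          rw [PsNat.boxIdHpy_tmul, PsNat.boxIdHpy_tmul, PsNat.boxIdHpy_tmul]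
          refine Eq.trans ?_ (congrArg₂ (· + ·) (pc10_pinl (U := (F.obj U.1, J.obj U.2))
            (V := (F.obj U.1, J.obj U.2)) (W := (F.obj V.1, J.obj V.2)) _ _ _ _)
            (pc01_pinl (U := (F.obj U.1, J.obj U.2)) (V := (F.obj V.1, J.obj V.2))
            (W := (F.obj V.1, J.obj V.2)) _ _ _ _)).symm
          rw [c00_one, one_c00, ← map_add, ← TensorProduct.add_tmul]
          rfl)

/-- The algebra homomorphism `ξ ↦ L(ξ)`. -/
def PsNat.postHom {C D E : Type u} [ChCat.{v} C] [ChCat.{v} D] [ChCat.{v} E]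
    (L : ChFunctor D E) (F : ChFunctor C D) : PsNat F F →ₐ[ℂ] PsNat (L.comp F) (L.comp F) :=
  AlgHom.ofLinearMap
    { toFun := fun ξ => ξ.post L
      map_add' := fun ξ θ => by
        refine PsNat.ext (funext fun U => L.map0.map_add _ _) (funext fun U => funext fun V => ?_)
        exact LinearMap.ext fun f => L.map1.map_add _ _
      map_smul' := fun c ξ => by
        refine PsNat.ext (funext fun U => L.map0.map_smul _ _) (funext fun U => funext fun V => ?_)
        exact LinearMap.ext fun f => L.map1.map_smul _ _ }
    (by
      refine PsNat.ext (funext fun U => L.map_one _) (funext fun U => funext fun V => ?_)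
      exact LinearMap.ext fun f => L.map1.map_zero)
    (fun ξ θ => by
      refine PsNat.ext (funext fun U => L.map_c00 _ _) (funext fun U => funext fun V => ?_)
      refine LinearMap.ext fun f => (L.map1.map_add _ _).trans ?_
      exact congrArg₂ (· + ·) (L.map_c10 _ _) (L.map_c01 _ _))

/-- The algebra homomorphism `ξ ↦ ξ_L`. -/
def PsNat.preHom {B C D : Type u} [ChCat.{v} B] [ChCat.{v} C] [ChCat.{v} D]
    (F : ChFunctor C D) (L : ChFunctor B C) : PsNat F F →ₐ[ℂ] PsNat (F.comp L) (F.comp L) :=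
  AlgHom.ofLinearMap
    { toFun := fun ξ => ξ.pre L
      map_add' := fun _ _ => rfl
      map_smul' := fun _ _ => rfl }
    rfl (fun _ _ => rfl)

theorem PsNat.cast_mul {C D : Type u} [ChCat.{v} C] [ChCat.{v} D] {F G : ChFunctor C D}
    (h : F = G) (ξ θ : PsNat F F) : (ξ * θ).cast h h = ξ.cast h h * θ.cast h h := by
  subst h
  rfl

/-! ### Modifications -/

/-- A modification `Ξ : ξ ⇛ ξ'`. -/
structure Modif {C D : Type u} [ChCat.{v} C] [ChCat.{v} D] {F G : ChFunctor C D}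
    (ξ ξ' : PsNat F G) where
  app : ∀ U : C, H1 (F.obj U) (G.obj U)
  d_app : ∀ U : C, d (app U) = ξ.app U - ξ'.app U
  nat : ∀ {U V : C} (f : H0 U V),
    c10 (app V) (F.map0 f) + ξ.hpy U V f = ξ'.hpy U V f + c01 (G.map0 f) (app U)

namespace Modif

variable {B C D E : Type u} [ChCat.{v} B] [ChCat.{v} C] [ChCat.{v} D] [ChCat.{v} E]

/-- The exchanger of pseudonatural endomorphisms `θ` of `F` and `ξ` of `G`: the modification with
components `ξ_{θ_U}`. -/
def exchanger {G : ChFunctor D E} {F : ChFunctor C D} (ξ : PsNat G G) (θ : PsNat F F) :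
    Modif (θ.post G * ξ.pre F) (ξ.pre F * θ.post G) where
  app U := ξ.hpy (F.obj U) (F.obj U) (θ.app U)
  d_app U := (ξ.nat0 (θ.app U)).symm
  nat {U V} f := by
    have h := ξ.nat1 (θ.hpy U V f)
    rw [← θ.nat0 f, map_sub, ξ.split, ξ.split] at h
    change c10 (ξ.hpy _ _ (θ.app V)) (G.map0 (F.map0 f))
        + (c10 (G.map1 (θ.hpy U V f)) (ξ.app (F.obj U))
          + c01 (G.map0 (θ.app V)) (ξ.hpy _ _ (F.map0 f)))
      = (c10 (ξ.hpy _ _ (F.map0 f)) (G.map0 (θ.app U))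
          + c01 (ξ.app (F.obj V)) (G.map1 (θ.hpy U V f)))
        + c01 (G.map0 (F.map0 f)) (ξ.hpy _ _ (θ.app U))
    rw [sub_eq_iff_eq_add] at h
    rw [h]
    abel

/-- Whiskering by a functor applied before. -/
def pre {F G : ChFunctor C D} {ξ ξ' : PsNat F G} (Ξ : Modif ξ ξ') (L : ChFunctor B C) :
    Modif (ξ.pre L) (ξ'.pre L) where
  app U := Ξ.app (L.obj U)
  d_app U := Ξ.d_app (L.obj U)
  nat f := Ξ.nat (L.map0 f)

/-- Transport along equalities of functors. -/
def cast {F G F' G' : ChFunctor C D} {ξ ξ' : PsNat F G} (hF : F = F') (hG : G = G')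
    (Ξ : Modif ξ ξ') : Modif (ξ.cast hF hG) (ξ'.cast hF hG) := by
  subst hF
  subst hG
  exact Ξ

/-- The same components, with source and target replaced by equal ones. -/
def copy {F G : ChFunctor C D} {ξ ξ' η η' : PsNat F G} (Ξ : Modif ξ ξ') (h : η = ξ) (h' : η' = ξ') :
    Modif η η' where
  app := Ξ.app
  d_app U := by rw [h, h']; exact Ξ.d_app U
  nat f := by rw [h, h']; exact Ξ.nat f

/-- A finite sum of modifications. -/
def sum {F G : ChFunctor C D} {ι : Type} (s : Finset ι) {ξ ξ' : ι → PsNat F G}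
    (Ξ : ∀ i, Modif (ξ i) (ξ' i)) : Modif (∑ i ∈ s, ξ i) (∑ i ∈ s, ξ' i) where
  app U := ∑ i ∈ s, (Ξ i).app U
  d_app U := by
    classical
    induction s using Finset.induction_on with
    | empty => simp
    | insert i s hi h =>
      simp only [Finset.sum_insert hi, map_add, h, PsNat.add_app, (Ξ i).d_app]
      abel
  nat {U V} f := by
    classical
    induction s using Finset.induction_on with
    | empty => simp
    | insert i s hi h =>
      simp only [Finset.sum_insert hi, map_add, LinearMap.add_apply, PsNat.add_hpy]
      rw [add_add_add_comm, (Ξ i).nat f, h, add_add_add_comm]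

/-- A family of degree `-1` elements is a modification `η + ∂Ξ ⇛ η`, for every `η`. -/
def ofFamily {F G : ChFunctor C D} (η : PsNat F G) (Ξ : ∀ U : C, H1 (F.obj U) (G.obj U)) :
    Modif (η + PsNat.cobdry Ξ) η where
  app := Ξ
  d_app U := (add_sub_cancel_left _ _).symm
  nat {U V} f := by
    change c10 (Ξ V) (F.map0 f) + (η.hpy U V f + (c01 (G.map0 f) (Ξ U) - c10 (Ξ V) (F.map0 f))) = _
    abel

end Modif

/-! ### Symmetric strict monoidal categories and infinitesimal 2-braidings -/

/-- The identity arrow between equal objects. -/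
def eqArrow {C : Type u} [ChCat.{v} C] {U V : C} (h : U = V) : H0 U V := h ▸ one U

/-- The two ways to multiply three objects, as functors on `(C ⊠ C) ⊠ C`. -/
abbrev tensLeft {C : Type u} [ChCat.{v} C] (T : ChFunctor (C × C) C) : ChFunctor ((C × C) × C) C :=
  T.comp (T.box (ChFunctor.id C))

abbrev tensRight {C : Type u} [ChCat.{v} C] (T : ChFunctor (C × C) C) :
    ChFunctor ((C × C) × C) C :=
  (T.comp ((ChFunctor.id C).box T)).comp (ChFunctor.assoc C C C)

/-- `γ_{V,U} : V ⊗ U → U ⊗ V`, as a transformation from `⊗ τ` to `⊗`. -/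
def braidRev {C : Type u} [ChCat.{v} C] {T : ChFunctor (C × C) C}
    (γ : PsNat T (T.comp (ChFunctor.swap C C))) : PsNat (T.comp (ChFunctor.swap C C)) T :=
  PsNat.cast rfl (congrArg T.comp (ChFunctor.swap_swap C C)) (γ.pre (ChFunctor.swap C C))

/-- A symmetric strict monoidal structure: a strictly associative and unital tensor product `⊗`
together with a natural, involutive braiding `γ` satisfying the hexagon axiom. -/
structure SymStrictMon (C : Type u) [ChCat.{v} C] where
  tens : ChFunctor (C × C) C
  unit : C
  tens_assoc : tensLeft tens = tensRight tens
  unit_tens : tens.comp (ChFunctor.insL unit) = ChFunctor.id C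
  tens_unit : tens.comp (ChFunctor.insR unit) = ChFunctor.id C
  braid : PsNat tens (tens.comp (ChFunctor.swap C C))
  braid_natural : ∀ U V : C × C, braid.hpy U V = 0
  braid_invol : (braidRev braid).vcomp braid = PsNat.id tens
  hexagon : ∀ U V W : C,
    braid.app (tens.obj (U, V), W) =
      c00 (eqArrow (congrArg (fun F => F.obj ((W, U), V)) tens_assoc))
        (c00 (tens.map0 (U := (tens.obj (U, W), V)) (V := (tens.obj (W, U), V))
            (braid.app (U, W) ⊗ₜ one V : P0 (tens.obj (U, W), V) (tens.obj (W, U), V)))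
          (c00 (eqArrow (congrArg (fun F => F.obj ((U, W), V)) tens_assoc).symm)
            (c00 (tens.map0 (U := (U, tens.obj (V, W))) (V := (U, tens.obj (W, V)))
                (one U ⊗ₜ braid.app (V, W) : P0 (U, tens.obj (V, W)) (U, tens.obj (W, V))))
              (eqArrow (congrArg (fun F => F.obj ((U, V), W)) tens_assoc)))))

namespace SymStrictMon

variable {C : Type u} [ChCat.{v} C] (M : SymStrictMon.{v} C)

/-- `⊗² : C ⊠ C ⊠ C → C`. -/
abbrev tens2 : ChFunctor ((C × C) × C) C := tensLeft M.tens

variable (t : PsNat M.tens M.tens)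

/-- `t₁₂ = ⊗(t ⊠ 1)`. -/
def t12 : PsNat M.tens2 M.tens2 := (t.boxId (ChFunctor.id C)).post M.tens

/-- `t₍₁₂₎₃ = t_{⊗ ⊠ id}`. -/
def t12_3 : PsNat M.tens2 M.tens2 := t.pre (M.tens.box (ChFunctor.id C))

/-- `t₂₃ = ⊗(1 ⊠ t)`. -/
def t23 : PsNat M.tens2 M.tens2 :=
  PsNat.cast M.tens_assoc.symm M.tens_assoc.symm
    (((t.idBox (ChFunctor.id C)).post M.tens).pre (ChFunctor.assoc C C C))

/-- `t₁₍₂₃₎ = t_{id ⊠ ⊗}`. -/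
def t1_23 : PsNat M.tens2 M.tens2 :=
  PsNat.cast M.tens_assoc.symm M.tens_assoc.symm
    ((t.pre ((ChFunctor.id C).box M.tens)).pre (ChFunctor.assoc C C C))

/-- The functor `τ ⊠ id` exchanging the first two factors. -/
abbrev swap12 (C : Type u) [ChCat.{v} C] : ChFunctor ((C × C) × C) ((C × C) × C) :=
  (ChFunctor.swap C C).box (ChFunctor.id C)

theorem tens2_swap12 :
    M.tens.comp ((M.tens.comp (ChFunctor.swap C C)).box (ChFunctor.id C))
      = M.tens2.comp (swap12 C) :=
  congrArg M.tens.comp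
    (ChFunctor.box_comp M.tens (ChFunctor.swap C C) (ChFunctor.id C) (ChFunctor.id C))

/-- `⊗(γ ⊠ 1)`, with components `γ_{U,V} ⊗ 1_W`. -/
def braid12 : PsNat M.tens2 (M.tens2.comp (swap12 C)) :=
  PsNat.cast rfl M.tens2_swap12 ((M.braid.boxId (ChFunctor.id C)).post M.tens)

/-- `⊗(γ⁻¹ ⊠ 1)`, with components `γ_{V,U} ⊗ 1_W`. -/
def braid12Inv : PsNat (M.tens2.comp (swap12 C)) M.tens2 :=
  PsNat.cast M.tens2_swap12 rfl (((braidRev M.braid).boxId (ChFunctor.id C)).post M.tens)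

/-- `t₁₃ = ⊗([γ⁻¹ ⊠ 1] (1 ⊠ t)_{τ ⊠ id} [γ ⊠ 1])`. -/
def t13 : PsNat M.tens2 M.tens2 :=
  M.braid12Inv.vcomp (((M.t23 t).pre (swap12 C)).vcomp M.braid12)

/-- Strictness of the infinitesimal 2-braiding: `t₁₍₂₃₎ = t₁₂ + t₁₃` and
`t₍₁₂₎₃ = t₂₃ + t₁₃`. -/
structure IsStrict : Prop where
  right : M.t1_23 t = M.t12 t + M.t13 t
  left : M.t12_3 t = M.t23 t + M.t13 t

/-- The left 4-term relationator `L : [t₁₂, t₍₁₂₎₃] ⇛ 0`, `L_{UVW} = t_{t_{UV} ⊠ 1_W}`,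
presented as `t₁₂ t₍₁₂₎₃ ⇛ t₍₁₂₎₃ t₁₂`. -/
def relL : Modif (M.t12 t * M.t12_3 t) (M.t12_3 t * M.t12 t) :=
  Modif.exchanger t (t.boxId (ChFunctor.id C))

/-- The right 4-term relationator `R : [t₂₃, t₁₍₂₃₎] ⇛ 0`, `R_{UVW} = t_{1_U ⊠ t_{VW}}`,
presented as `t₂₃ t₁₍₂₃₎ ⇛ t₁₍₂₃₎ t₂₃`. -/
def relR : Modif (M.t23 t * M.t1_23 t) (M.t1_23 t * M.t23 t) :=
  (((Modif.exchanger t (t.idBox (ChFunctor.id C))).pre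
    (ChFunctor.assoc C C C)).cast M.tens_assoc.symm M.tens_assoc.symm).copy
      (PsNat.cast_mul M.tens_assoc.symm _ _).symm (PsNat.cast_mul M.tens_assoc.symm _ _).symm

end SymStrictMon

/-! ### Formal power series in `ħ` -/

/-- The formal exponential `e^{ħ x} = ∑ ħⁿ xⁿ / n!`. -/
def fexp {R : Type*} [Ring R] [Algebra ℂ R] (x : R) : PowerSeries R :=
  PowerSeries.mk fun n => ((n.factorial : ℂ)⁻¹) • x ^ n

/-- A modification between formal power series of pseudonatural endomorphisms: a formal power series
of modifications. -/
def FormalModif {C D : Type u} [ChCat.{v} C] [ChCat.{v} D] {F : ChFunctor C D}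
    (ξ ξ' : PowerSeries (PsNat F F)) : Type (max u v) :=
  ∀ n : ℕ, Modif (PowerSeries.coeff n ξ) (PowerSeries.coeff n ξ')

theorem coeff_fexp_map {R S : Type*} [Ring R] [Algebra ℂ R] [Ring S] [Algebra ℂ S] (φ : R →ₐ[ℂ] S)
    (x : R) (n : ℕ) :
    PowerSeries.coeff n (fexp (φ x)) = φ (PowerSeries.coeff n (fexp x)) := by
  simp [fexp]

namespace SymStrictMon

variable {C : Type u} [ChCat.{v} C] (M : SymStrictMon.{v} C) (t : PsNat M.tens M.tens)

theorem coeff_fexp_t12 (c : ℂ) (n : ℕ) :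
    PowerSeries.coeff n (fexp (c • M.t12 t))
      = ((PowerSeries.coeff n (fexp (c • t))).boxId (ChFunctor.id C)).post M.tens := by
  have h := coeff_fexp_map ((PsNat.postHom M.tens (M.tens.box (ChFunctor.id C))).comp
    (PsNat.boxIdHom M.tens (ChFunctor.id C))) (c • t) n
  rw [map_smul] at h
  exact h

theorem coeff_fexp_t12_3 (c : ℂ) (n : ℕ) :
    PowerSeries.coeff n (fexp (c • M.t12_3 t))
      = (PowerSeries.coeff n (fexp (c • t))).pre (M.tens.box (ChFunctor.id C)) := by
  have h := coeff_fexp_map (PsNat.preHom M.tens (M.tens.box (ChFunctor.id C))) (c • t) n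
  rw [map_smul] at h
  exact h

/-- The left congruence `(e^{iπħt})_{e^{iπħt₁₂}}`: its component at `(U, V, W)` is the homotopy
component of `e^{iπħt}` at the arrow `(e^{iπħt})_{U,V} ⊠ 1_W`, expanded in powers of `ħ`. -/
def leftCongruence : FormalModif
    (fexp ((Real.pi * Complex.I : ℂ) • M.t12 t) * fexp ((Real.pi * Complex.I : ℂ) • M.t12_3 t))
    (fexp ((Real.pi * Complex.I : ℂ) • M.t12_3 t) * fexp ((Real.pi * Complex.I : ℂ) • M.t12 t)) :=
  fun n =>
    (Modif.sum (Finset.HasAntidiagonal.antidiagonal n) (fun p : ℕ × ℕ => Modif.exchanger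
      (PowerSeries.coeff p.1 (fexp ((Real.pi * Complex.I : ℂ) • t)))
      ((PowerSeries.coeff p.2 (fexp ((Real.pi * Complex.I : ℂ) • t))).boxId (ChFunctor.id C)))).copy
    (by
      rw [PowerSeries.coeff_mul, ← Finset.Nat.sum_antidiagonal_swap]
      refine Finset.sum_congr rfl fun p _ => ?_
      rw [coeff_fexp_t12, coeff_fexp_t12_3]
      rfl)
    (by
      rw [PowerSeries.coeff_mul]
      refine Finset.sum_congr rfl fun p _ => ?_
      rw [coeff_fexp_t12, coeff_fexp_t12_3])

/-! ### Parallel transport and 2-holonomy -/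

end SymStrictMon

/-- Iterated integrals: `∫_{a ≤ x_k ≤ ⋯ ≤ x_1 ≤ b} Y_{i₁}(x₁) ⋯ Y_{i_k}(x_k)` for the word
`i₁ ⋯ i_k`, so that the first letter of the word is integrated last. -/
def iterInt {ι : Type} (Y : ι → ℝ → ℂ) : List ι → ℝ → ℝ → ℂ
  | [], _, _ => 1
  | i :: w, a, b => ∫ x in a..b, Y i x * iterInt Y w a x

/-- The base space `(ℂ ∖ {0, 1}) × (ℂ ∖ {0})` with coordinates `(z, v)`. -/
def baseSpace : Set (ℂ × ℂ) := {x | x.1 ≠ 0 ∧ x.1 ≠ 1 ∧ x.2 ≠ 0}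

/-- The values of the 1-forms `dz/z`, `dz/(z-1)`, `dv/v` on the velocity of the path `p`. -/
def connForm (p : ℝ → ℂ × ℂ) : Fin 3 → ℝ → ℂ :=
  ![fun r => deriv (fun x => (p x).1) r / (p r).1,
    fun r => deriv (fun x => (p x).1) r / ((p r).1 - 1),
    fun r => deriv (fun x => (p x).2) r / (p r).2]

/-- The value `(dz ∧ dv)[X, Y] = (dz(X) dv(Y) - dz(Y) dv(X)) / 2`. -/
def wedge (X Y : ℂ × ℂ) : ℂ := (X.1 * Y.2 - Y.1 * X.2) / 2

/-- The partial derivatives of a 2-path. -/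
def partialS (P : ℝ → ℝ → ℂ × ℂ) (s r : ℝ) : ℂ × ℂ :=
  (deriv (fun x => (P x r).1) s, deriv (fun x => (P x r).2) s)

def partialR (P : ℝ → ℝ → ℂ × ℂ) (s r : ℝ) : ℂ × ℂ :=
  (deriv (fun x => (P s x).1) r, deriv (fun x => (P s x).2) r)

/-- The coefficients of `L` and of `R` in `Δ[∂P/∂s, ∂P/∂r]`, where
`Δ = 2 (L / (z v) + R / ((z - 1) v)) dz ∧ dv`. -/
def formL (P : ℝ → ℝ → ℂ × ℂ) (s r : ℝ) : ℂ :=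
  2 / ((P s r).1 * (P s r).2) * wedge (partialS P s r) (partialR P s r)

def formR (P : ℝ → ℝ → ℂ × ℂ) (s r : ℝ) : ℂ :=
  2 / (((P s r).1 - 1) * (P s r).2) * wedge (partialS P s r) (partialR P s r)

namespace SymStrictMon

variable {C : Type u} [ChCat.{v} C] (M : SymStrictMon.{v} C) (t : PsNat M.tens M.tens)

/-- The coefficients of `dz/z`, `dz/(z-1)`, `dv/v` in the connection
`∇ = (t₁₂/z + t₂₃/(z-1)) dz + ((t₁₂ + t₂₃ + t₁₃)/v) dv`. -/
def letter : Fin 3 → PsNat M.tens2 M.tens2 :=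
  ![M.t12 t, M.t23 t, M.t12 t + M.t23 t + M.t13 t]

/-- The product of the letters of a word. -/
def word {n : ℕ} (w : Fin n → Fin 3) : PsNat M.tens2 M.tens2 :=
  (List.ofFn fun i => M.letter t (w i)).prod

/-- The parallel transport `W^p_{ba}` of `ħ∇` along the path `p`, from the parameter `a` to the
parameter `b`, as a series of iterated integrals: the formal solution of
`dW_{ba}/db = ħ∇[p'(b)] W_{ba}`, `W_{aa} = 1`. -/
def transport (p : ℝ → ℂ × ℂ) (a b : ℝ) : PowerSeries (PsNat M.tens2 M.tens2) :=
  PowerSeries.mk fun n => ∑ w : Fin n → Fin 3,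
    iterInt (connForm p) (List.ofFn w) a b • M.word t w

/-- The components of `∫₀¹ ∫₀¹ W_{1r} ħ²Δ[∂P/∂s, ∂P/∂r] W_{r0} dr ds`, by powers of `ħ`, where `W` is
the parallel transport along the cross-section `P s`. -/
def surfaceApp (P : ℝ → ℝ → ℂ × ℂ) : ℕ → ∀ U : (C × C) × C, H1 (M.tens2.obj U) (M.tens2.obj U)
  | 0, _ => 0
  | 1, _ => 0
  | n + 2, U => ∑ p ∈ Finset.HasAntidiagonal.antidiagonal n, ∑ w : Fin p.1 → Fin 3, ∑ w' : Fin p.2 → Fin 3,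
      ((∫ s in (0 : ℝ)..1, ∫ r in (0 : ℝ)..1,
          iterInt (connForm (P s)) (List.ofFn w) r 1 * formL P s r *
            iterInt (connForm (P s)) (List.ofFn w') 0 r) •
          c01 ((M.word t w).app U) (c10 ((M.relL t).app U) ((M.word t w').app U))
        + (∫ s in (0 : ℝ)..1, ∫ r in (0 : ℝ)..1,
          iterInt (connForm (P s)) (List.ofFn w) r 1 * formR P s r *
            iterInt (connForm (P s)) (List.ofFn w') 0 r) •
          c01 ((M.word t w).app U) (c10 ((M.relR t).app U) ((M.word t w').app U)))

/-- The 2-holonomy `W^P = ∫₀¹ ∫₀¹ W_{1r} Δ[∂P/∂s, ∂P/∂r] W_{r0} dr ds + ID_{W^{P¹}}` along a 2-path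
`P`, a modification from `∂(∫₀¹ ∫₀¹ W_{1r} Δ[∂P/∂s, ∂P/∂r] W_{r0} dr ds) + W^{P¹}` to `W^{P¹}`. -/
def twoHol (P : ℝ → ℝ → ℂ × ℂ) : FormalModif
    (M.transport t (P 1) 0 1 + PowerSeries.mk fun n => PsNat.cobdry (M.surfaceApp t P n))
    (M.transport t (P 1) 0 1) :=
  fun n => (Modif.ofFamily (PowerSeries.coeff n (M.transport t (P 1) 0 1))
    (M.surfaceApp t P n)).copy (by rw [map_add, PowerSeries.coeff_mk]) rfl

end SymStrictMon

/-! ### Limits -/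

/-- Convergence in a complex vector space with its canonical (finest) vector space topology; in
finite dimension this is the usual notion. -/
def VTendsto {E : Type*} [AddCommGroup E] [Module ℂ E] (f : ℝ → E) (l : Filter ℝ) (x : E) : Prop :=
  Tendsto f l (@nhds E (moduleTopology ℂ E) x)

/-- Convergence of formal power series of pseudonatural endomorphisms: all components of all
coefficients converge. -/
def PsTendsto {C D : Type u} [ChCat.{v} C] [ChCat.{v} D] {F : ChFunctor C D}
    (ξ : ℝ → PowerSeries (PsNat F F)) (l : Filter ℝ) (ξ₀ : PowerSeries (PsNat F F)) : Prop :=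
  ∀ n : ℕ,
    (∀ U : C, VTendsto (fun ε => (PowerSeries.coeff n (ξ ε)).app U) l
      ((PowerSeries.coeff n ξ₀).app U)) ∧
    ∀ (U V : C) (f : H0 U V), VTendsto (fun ε => (PowerSeries.coeff n (ξ ε)).hpy U V f) l
      ((PowerSeries.coeff n ξ₀).hpy U V f)

/-- Convergence of modifications, together with their sources and targets. -/
def ModTendsto {C D : Type u} [ChCat.{v} C] [ChCat.{v} D] {F : ChFunctor C D}
    {ξ ξ' : ℝ → PowerSeries (PsNat F F)} (Ξ : ∀ ε : ℝ, FormalModif (ξ ε) (ξ' ε)) (l : Filter ℝ)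
    {ξ₀ ξ₀' : PowerSeries (PsNat F F)} (Ξ₀ : FormalModif ξ₀ ξ₀') : Prop :=
  PsTendsto ξ l ξ₀ ∧ PsTendsto ξ' l ξ₀' ∧
    ∀ (n : ℕ) (U : C), VTendsto (fun ε => (Ξ ε n).app U) l ((Ξ₀ n).app U)

/-! ### Paths and 2-paths -/

/-- A 1-path in the base space: continuous and smooth on each interval of a finite partition. -/
def IsOnePath (p : ℝ → ℂ × ℂ) : Prop :=
  ContinuousOn p (Set.Icc 0 1) ∧ Set.MapsTo p (Set.Icc 0 1) baseSpace ∧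
    ∃ (n : ℕ) (x : ℕ → ℝ), x 0 = 0 ∧ x n = 1 ∧ ∀ i < n, x i < x (i + 1) ∧
      ContDiffOn ℝ (⊤ : ℕ∞) p (Set.Icc (x i) (x (i + 1)))

/-- A 2-path in the base space between the 1-paths `p` and `q` with the same endpoints: a continuous
map on the unit square which is smooth on each polygon of a finite partition of the square (into
convex polygons, given by their vertices). -/
def IsTwoPath (P : ℝ → ℝ → ℂ × ℂ) (p q : ℝ → ℂ × ℂ) : Prop :=
  IsOnePath p ∧ IsOnePath q ∧ p 0 = q 0 ∧ p 1 = q 1 ∧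
  ContinuousOn (fun x : ℝ × ℝ => P x.1 x.2) (Set.Icc 0 1 ×ˢ Set.Icc 0 1) ∧
  Set.MapsTo (fun x : ℝ × ℝ => P x.1 x.2) (Set.Icc 0 1 ×ˢ Set.Icc 0 1) baseSpace ∧
  (∃ (n : ℕ) (A : Fin n → Finset (ℝ × ℝ)),
    (⋃ i, convexHull ℝ (A i : Set (ℝ × ℝ))) = Set.Icc 0 1 ×ˢ Set.Icc 0 1 ∧
    (∀ i, (interior (convexHull ℝ (A i : Set (ℝ × ℝ)))).Nonempty) ∧
    (∀ i j, i ≠ j → Disjoint (interior (convexHull ℝ (A i : Set (ℝ × ℝ))))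
      (interior (convexHull ℝ (A j : Set (ℝ × ℝ))))) ∧
    ∀ i, ContDiffOn ℝ (⊤ : ℕ∞) (fun x : ℝ × ℝ => P x.1 x.2)
      (convexHull ℝ (A i : Set (ℝ × ℝ)))) ∧
  (∀ s ∈ Set.Icc (0 : ℝ) 1, P s 0 = p 0 ∧ P s 1 = p 1) ∧
  ∀ r ∈ Set.Icc (0 : ℝ) 1, P 0 r = p r ∧ P 1 r = q r

/-- The concatenation `q p`: first `p`, then `q`. -/
def concat (q p : ℝ → ℂ × ℂ) (r : ℝ) : ℂ × ℂ := if r ≤ 1 / 2 then p (2 * r) else q (2 * r - 1)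

/-- `e^{iπx}`. -/
def expPi (x : ℝ) : ℂ := Complex.exp (Real.pi * Complex.I * x)

def cVI (ε r : ℝ) : ℂ := 2 * ε / (ε + (2 - ε) * expPi (1 - r))

def cIV (ε r : ℝ) : ℂ := 1 / 2 + (1 / ε - 1 / 2) * expPi (-r)

def qVI (ε : ℝ) (a : ℂ) (r : ℝ) : ℂ × ℂ :=
  (ε / (ε / 2 + (1 - ε / 2) * expPi r), (ε / 2 + (1 - ε / 2) * expPi r) * a)

def qSE (ε : ℝ) (a : ℂ) (r : ℝ) : ℂ × ℂ :=
  (2 * ε / (ε + (ε - 2) * expPi r), (ε / 2 + (1 - ε / 2) * expPi r) * a)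

/-- The horizontally-interpolative 2-path for the left congruence. -/
def pathL (ε : ℝ) (a : ℂ) (s r : ℝ) : ℂ × ℂ :=
  if r ≤ (1 - s) / 2 then qVI ε a (2 * r)
  else if r ≤ 1 - s / 2 then (cVI ε (2 * r + 2 * s - 1), cIV ε (s - 1) * ε * a)
  else qSE ε a (2 * r - 1)

end

open MeasureTheory

/-! ### Iterated integrals -/

section IterInt

variable {ι : Type}

/-! In the coordinates `ε / z` and `v / a` every curve of the 2-path runs on one circle, of centre
`ε / 2` and radius `1 - ε / 2`. Hence `pathL` is a piecewise affine map from the square to a torus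
of angles `(α, β)` (`pathL_eq`). The lines `2r + s = 1` and `2r + s = 2` cut the square into two
triangles and a parallelogram on which the angles are affine, and the circle avoids `0` and `ε` when
`ε < 1/2`; this gives the 2-path property.

As `ε → 0` the circle becomes the unit circle: `dz/z → -iπ dα` and `dv/v → iπ dβ`, while `dz/(z-1)`
is `dz/z` times a factor of order `ε`, so its coefficient and the relator `R` drop out. The limit
connection is constant on each piece of a cross-section: `2πi t₁₂` on the parallelogram, and `2πi
(t₂₃ + t₁₃) = 2πi T` on the triangles, with `T = t₍₁₂₎₃` by strictness. The limit transport along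
the section `s` is therefore `e^{iπsT} e^{iπt₁₂} e^{iπ(1-s)T}`. The surface form of `L` vanishes on
the triangles and tends to `2(iπ)²` on the parallelogram, so with `x = 2r + s - 1` the surface
integral tends to `(iπ)² ∫∫ e^{iπsT} e^{iπ(1-x)t₁₂} L e^{iπxt₁₂} e^{iπ(1-s)T} dx ds`. Expanding the
exponentials leaves products of Beta integrals `∫ s^j (1-s)^{j'} ds = j! j'! / (j+j'+1)!`
(`squareInt_bandMonomial`, `sum_surfCoeff_limit`), which produce the double series.

The left congruence has the same expansion for algebraic reasons: `ξ ↦ ξ_f` obeys a Leibniz rule for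
products of endomorphisms and `f ↦ ξ_f` one for composites of arrows, so the homotopy component of a
power at a power is a double sum of whiskered exchangers (`PsNat.hpy_pow_app_pow`).

The limits come from dominated convergence, with bounds uniform in `ε ≤ 1/4` (`tendsto_iterInt`,
`tendsto_surfCoeff`). Every coefficient in `ħ` is a finite sum of scalar integrals times fixed
algebraic elements, so only scalars have to converge; identities between vector-valued expressions
are tested on linear functionals. The source converges because target and components do
(`ModTendsto.of_target`). -/

theorem norm_iterInt_le {Y : ι → ℝ → ℂ} {K : ℝ} (hY : ∀ i x, ‖Y i x‖ ≤ K) (w : List ι) :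
    ∀ {a b : ℝ}, |b - a| ≤ 1 → ‖iterInt Y w a b‖ ≤ K ^ w.length := by
  induction w with
  | nil => intro a b _; simp [iterInt]
  | cons i w ih =>
    intro a b h
    have hK : 0 ≤ K := (norm_nonneg _).trans (hY i 0)
    have h1 : ‖iterInt Y (i :: w) a b‖ ≤ (K * K ^ w.length) * |b - a| := by
      refine intervalIntegral.norm_integral_le_of_norm_le_const fun x hx => ?_
      rw [norm_mul]
      refine mul_le_mul (hY i x) (ih ?_) (norm_nonneg _) hK
      exact (Set.abs_sub_left_of_mem_uIcc (Set.uIoc_subset_uIcc hx)).trans h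
    refine h1.trans ?_
    rw [List.length_cons, pow_succ', ← mul_one (K * K ^ w.length)]
    exact mul_le_mul (by rw [mul_one]) h (abs_nonneg _) (by positivity)

/-- The surface integral moves the endpoints and the parameter `s` together, so joint measurability
is needed. An integral with moving endpoints is rewritten as an integral over the whole line of an
indicator of a measurable set, to which the measurability part of Fubini applies. -/
theorem measurable_iterInt_param {Y : ℝ → ι → ℝ → ℂ}
    (hY : ∀ i, Measurable fun p : ℝ × ℝ => Y p.1 i p.2) (w : List ι) :
    Measurable fun p : ℝ × ℝ × ℝ => iterInt (Y p.1) w p.2.1 p.2.2 := by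
  induction w with
  | nil => simp only [iterInt]; exact measurable_const
  | cons i w ih =>
    have hf : Measurable fun q : (ℝ × ℝ × ℝ) × ℝ =>
        Y q.1.1 i q.2 * iterInt (Y q.1.1) w q.1.2.1 q.2 := by
      refine Measurable.mul ?_ ?_
      · exact (hY i).comp (by fun_prop : Measurable fun q : (ℝ × ℝ × ℝ) × ℝ => (q.1.1, q.2))
      · exact ih.comp (by fun_prop : Measurable fun q : (ℝ × ℝ × ℝ) × ℝ => (q.1.1, q.1.2.1, q.2))
    have key : ∀ u v : ℝ × ℝ × ℝ → ℝ, Measurable u → Measurable v →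
        Measurable fun p : ℝ × ℝ × ℝ =>
          ∫ x in Set.Ioc (u p) (v p), Y p.1 i x * iterInt (Y p.1) w p.2.1 x := by
      intro u v hu hv
      have hS : MeasurableSet {q : (ℝ × ℝ × ℝ) × ℝ | u q.1 < q.2 ∧ q.2 ≤ v q.1} :=
        (measurableSet_lt (hu.comp measurable_fst) measurable_snd).inter
          (measurableSet_le measurable_snd (hv.comp measurable_fst))
      have h := ((hf.indicator hS).stronglyMeasurable.integral_prod_right'
        (ν := (volume : Measure ℝ))).measurable
      convert h using 2 with p
      rw [← integral_indicator measurableSet_Ioc]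
      rfl
    simp only [iterInt, intervalIntegral]
    exact (key _ _ (by fun_prop) (by fun_prop)).sub (key _ _ (by fun_prop) (by fun_prop))

theorem measurable_iterInt {Y : ι → ℝ → ℂ} (hY : ∀ i, Measurable (Y i)) (w : List ι) (a : ℝ) :
    Measurable fun b => iterInt Y w a b :=
  (measurable_iterInt_param (Y := fun _ => Y) (fun i => (hY i).comp measurable_snd) w).comp
    (by fun_prop : Measurable fun b : ℝ => ((0 : ℝ), a, b))

/-- The recursion sees the letters only under an integral sign. This is what makes the break points
of the cross-sections, where derivatives take default values, irrelevant. -/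
theorem iterInt_congr {Y Z : ι → ℝ → ℂ} (h : ∀ i, ∀ᵐ x, Y i x = Z i x) (w : List ι) :
    ∀ a b : ℝ, iterInt Y w a b = iterInt Z w a b := by
  induction w with
  | nil => intro a b; rfl
  | cons i w ih =>
    intro a b
    refine intervalIntegral.integral_congr_ae ?_
    filter_upwards [h i] with x hx _
    rw [hx, ih]

/-- Dominated convergence once per letter of the word; on intervals of length at most `1` the inner
iterated integral is bounded by a power of the bound on the letters. -/
theorem tendsto_iterInt {β : Type*} {l : Filter β} [l.IsCountablyGenerated] {Y : β → ι → ℝ → ℂ}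
    {Z : ι → ℝ → ℂ} {K : ℝ} (hm : ∀ᶠ n in l, ∀ i, Measurable (Y n i))
    (hK : ∀ᶠ n in l, ∀ i x, ‖Y n i x‖ ≤ K) (hl : ∀ i x, Tendsto (fun n => Y n i x) l (𝓝 (Z i x)))
    (w : List ι) : ∀ {a b : ℝ}, |b - a| ≤ 1 →
      Tendsto (fun n => iterInt (Y n) w a b) l (𝓝 (iterInt Z w a b)) := by
  induction w with
  | nil => intro a b _; exact tendsto_const_nhds
  | cons i w ih =>
    intro a b h
    refine intervalIntegral.tendsto_integral_filter_of_dominated_convergence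
      (fun _ => |K| * |K| ^ w.length) ?_ ?_ intervalIntegrable_const ?_
    · filter_upwards [hm] with n hn
      exact ((hn i).mul (measurable_iterInt hn w a)).aestronglyMeasurable
    · filter_upwards [hK] with n hn
      refine Eventually.of_forall fun x hx => ?_
      rw [norm_mul]
      refine mul_le_mul ((hn i x).trans (le_abs_self K)) ?_ (norm_nonneg _) (abs_nonneg _)
      exact norm_iterInt_le (fun i x => (hn i x).trans (le_abs_self K)) w
        ((Set.abs_sub_left_of_mem_uIcc (Set.uIoc_subset_uIcc hx)).trans h)
    · refine Eventually.of_forall fun x hx => (hl i x).mul (ih ?_)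
      exact (Set.abs_sub_left_of_mem_uIcc (Set.uIoc_subset_uIcc hx)).trans h

theorem intervalIntegrable_of_bound {f : ℝ → ℂ} (hf : Measurable f) {K a b : ℝ}
    (hK : ∀ x ∈ Set.uIoc a b, ‖f x‖ ≤ K) : IntervalIntegrable f volume a b := by
  refine (intervalIntegrable_const (c := K)).mono_fun' hf.aestronglyMeasurable ?_
  filter_upwards [ae_restrict_mem measurableSet_uIoc] with x hx using hK x hx

theorem integrable_letter_mul {Y : ι → ℝ → ℂ} {K : ℝ} (hm : ∀ i, Measurable (Y i))
    (hK : ∀ i x, ‖Y i x‖ ≤ K) (i : ι) (w : List ι) {a c d : ℝ}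
    (h : ∀ x ∈ Set.uIcc c d, |x - a| ≤ 1) :
    IntervalIntegrable (fun x => Y i x * iterInt Y w a x) volume c d := by
  refine intervalIntegrable_of_bound (f := fun x => Y i x * iterInt Y w a x)
    ((hm i).mul (measurable_iterInt hm w a)) (K := K * K ^ w.length) fun x hx => ?_
  rw [norm_mul]
  exact mul_le_mul (hK i x) (norm_iterInt_le hK w (h x (Set.uIoc_subset_uIcc hx)))
    (norm_nonneg _) ((norm_nonneg _).trans (hK i 0))

theorem intervalIntegrable_sum {κ : Type*} {s : Finset κ} {f : κ → ℝ → ℂ} {a b : ℝ}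
    (h : ∀ i ∈ s, IntervalIntegrable (f i) volume a b) :
    IntervalIntegrable (fun x => ∑ i ∈ s, f i x) volume a b := by
  simpa only [Finset.sum_fn] using IntervalIntegrable.sum s h

/-! ### Parallel transport in an algebra, as a sum over words. -/

variable [Fintype ι] {R : Type*} [Ring R] [Algebra ℂ R]

/-- The degree `n` part of the parallel transport of `∑ i, Y i ℓ i`, as a sum over words. -/
noncomputable def wordSum (Y : ι → ℝ → ℂ) (ℓ : ι → R) (n : ℕ) (a b : ℝ) : R :=
  ∑ w : Fin n → ι, iterInt Y (List.ofFn w) a b • (List.ofFn fun i => ℓ (w i)).prod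

theorem wordSum_zero (Y : ι → ℝ → ℂ) (ℓ : ι → R) (a b : ℝ) : wordSum Y ℓ 0 a b = 1 := by
  simp [wordSum, iterInt]

/-- The connection `∑ i, Y i ℓ i` at the parameter `x`. -/
noncomputable def connAt (Y : ι → ℝ → ℂ) (ℓ : ι → R) (x : ℝ) : R := ∑ i, Y i x • ℓ i

/-- `R` carries no topology, hence no integral. The transport equation is tested on linear
functionals instead; these separate the points of a complex vector space. -/
theorem dual_connAt_mul_wordSum (Y : ι → ℝ → ℂ) (ℓ : ι → R) (n : ℕ) (a x : ℝ)
    (φ : R →ₗ[ℂ] ℂ) : φ (connAt Y ℓ x * wordSum Y ℓ n a x)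
      = ∑ i, ∑ w : Fin n → ι, (Y i x * iterInt Y (List.ofFn w) a x) *
          φ (ℓ i * (List.ofFn fun j => ℓ (w j)).prod) := by
  simp only [connAt, wordSum, Finset.sum_mul, Finset.mul_sum, map_sum, smul_mul_smul_comm,
    map_smul, smul_eq_mul]
  exact Finset.sum_comm

theorem integrable_dual_connAt_mul_wordSum {Y : ι → ℝ → ℂ} {K : ℝ} (hm : ∀ i, Measurable (Y i))
    (hK : ∀ i x, ‖Y i x‖ ≤ K) (ℓ : ι → R) (n : ℕ) (φ : R →ₗ[ℂ] ℂ) {a c d : ℝ}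
    (h : ∀ x ∈ Set.uIcc c d, |x - a| ≤ 1) :
    IntervalIntegrable (fun x => φ (connAt Y ℓ x * wordSum Y ℓ n a x)) volume c d := by
  simp only [dual_connAt_mul_wordSum]
  refine intervalIntegrable_sum fun i _ => intervalIntegrable_sum fun w _ => ?_
  exact (integrable_letter_mul hm hK i _ h).mul_const _

/-- The integrated form of `dW/db = ∇W` in degree `n + 1`. The first letter of a word is integrated
last, so splitting it off with `Fin.consEquiv` separates the factor `∇` from the shorter transport.
-/
theorem dual_wordSum_succ {Y : ι → ℝ → ℂ} {K : ℝ} (hm : ∀ i, Measurable (Y i))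
    (hK : ∀ i x, ‖Y i x‖ ≤ K) (ℓ : ι → R) (n : ℕ) {a b : ℝ} (h : |b - a| ≤ 1) (φ : R →ₗ[ℂ] ℂ) :
    φ (wordSum Y ℓ (n + 1) a b)
      = ∫ x in a..b, φ (connAt Y ℓ x * wordSum Y ℓ n a x) := by
  have hx : ∀ x ∈ Set.uIcc a b, |x - a| ≤ 1 := fun x hx =>
    (Set.abs_sub_left_of_mem_uIcc hx).trans h
  simp only [dual_connAt_mul_wordSum]
  rw [intervalIntegral.integral_finsetSum fun i _ => intervalIntegrable_sum fun w _ =>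
    (integrable_letter_mul hm hK i _ hx).mul_const _]
  rw [wordSum, map_sum, ← (Fin.consEquiv fun _ => ι).sum_comp, Fintype.sum_prod_type]
  refine Finset.sum_congr rfl fun i _ => ?_
  rw [intervalIntegral.integral_finsetSum fun w _ =>
    (integrable_letter_mul hm hK i _ hx).mul_const _]
  refine Finset.sum_congr rfl fun w _ => ?_
  rw [map_smul, smul_eq_mul, intervalIntegral.integral_mul_const]
  simp [Fin.consEquiv, List.ofFn_succ, iterInt]

/-- Parallel transport is multiplicative under subdivision of the interval. -/
theorem wordSum_mul {Y : ι → ℝ → ℂ} {K : ℝ} (hm : ∀ i, Measurable (Y i))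
    (hK : ∀ i x, ‖Y i x‖ ≤ K) (ℓ : ι → R) {a b : ℝ} (hab : a ≤ b) (n : ℕ) :
    ∀ {c : ℝ}, b ≤ c → c - a ≤ 1 → wordSum Y ℓ n a c
      = ∑ p ∈ Finset.HasAntidiagonal.antidiagonal n, wordSum Y ℓ p.1 b c * wordSum Y ℓ p.2 a b := by
  induction n with
  | zero => intro c _ _; simp [wordSum_zero]
  | succ n ih =>
    intro c hbc hca
    have habs : ∀ {u v : ℝ}, u ≤ v → v - u ≤ 1 → |v - u| ≤ 1 := fun h h' => by
      rwa [abs_of_nonneg (sub_nonneg.2 h)]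
    rw [← sub_eq_zero, ← Module.forall_dual_apply_eq_zero_iff ℂ]
    intro φ
    rw [map_sub, sub_eq_zero, Finset.Nat.sum_antidiagonal_succ, map_add, wordSum_zero, one_mul,
      map_sum]
    -- The outermost variable is cut at `b`. Below `b` no letter lies in `[b, c]`, which is the term
    -- `(0, n + 1)` of the convolution; above `b` the induction hypothesis distributes the remaining
    -- letters.
    rw [dual_wordSum_succ hm hK ℓ n (habs (hab.trans hbc) hca),
      dual_wordSum_succ hm hK ℓ n (habs hab (by linarith)),
      ← intervalIntegral.integral_add_adjacent_intervals (b := b)]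
    · congr 1
      have e : ∀ p : ℕ × ℕ, φ (wordSum Y ℓ (p.1 + 1) b c * wordSum Y ℓ p.2 a b)
          = ∫ x in b..c, φ (connAt Y ℓ x * wordSum Y ℓ p.1 b x * wordSum Y ℓ p.2 a b) :=
        fun p => dual_wordSum_succ hm hK ℓ p.1 (habs hbc (by linarith))
          (φ ∘ₗ LinearMap.mulRight ℂ (wordSum Y ℓ p.2 a b))
      simp only [e]
      rw [← intervalIntegral.integral_finsetSum]
      · refine intervalIntegral.integral_congr fun x hx => ?_
        rw [Set.uIcc_of_le hbc] at hx
        simp only [ih hx.1 (by linarith [hx.2] : x - a ≤ 1), Finset.mul_sum, map_sum, mul_assoc]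
      · intro p _
        refine integrable_dual_connAt_mul_wordSum hm hK ℓ p.1
          (φ ∘ₗ LinearMap.mulRight ℂ (wordSum Y ℓ p.2 a b)) fun x hx => ?_
        rw [Set.uIcc_of_le hbc] at hx
        exact habs hx.1 (by linarith [hx.2])
    · refine integrable_dual_connAt_mul_wordSum hm hK ℓ n φ fun x hx => ?_
      rw [Set.uIcc_of_le hab] at hx
      exact habs hx.1 (by linarith [hx.2])
    · refine integrable_dual_connAt_mul_wordSum hm hK ℓ n φ fun x hx => ?_
      rw [Set.uIcc_of_le hbc] at hx
      exact habs (hab.trans hx.1) (by linarith [hx.2])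

/-- The parallel transport of a constant connection. -/
theorem wordSum_const {Y : ι → ℝ → ℂ} {K : ℝ} (hm : ∀ i, Measurable (Y i))
    (hK : ∀ i x, ‖Y i x‖ ≤ K) {ℓ : ι → R} {a : ℝ} {X : R} (n : ℕ) :
    ∀ {b : ℝ}, a ≤ b → b - a ≤ 1 → (∀ x ∈ Set.Ioo a b, connAt Y ℓ x = X) →
      wordSum Y ℓ n a b = (((b - a : ℝ) : ℂ) ^ n / (n.factorial : ℂ)) • X ^ n := by
  induction n with
  | zero => intro b _ _ _; simp [wordSum_zero]
  | succ n ih =>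
    intro b hab hb hX
    rw [← sub_eq_zero, ← Module.forall_dual_apply_eq_zero_iff ℂ]
    intro φ
    rw [map_sub, sub_eq_zero, dual_wordSum_succ hm hK ℓ n
      (by rwa [abs_of_nonneg (sub_nonneg.2 hab)])]
    have e : ∫ x in a..b, φ (connAt Y ℓ x * wordSum Y ℓ n a x)
        = ∫ x in a..b, (((x - a) ^ n : ℝ) : ℂ) * ((n.factorial : ℂ)⁻¹ * φ (X ^ (n + 1))) := by
      -- The connection is only known in the open interval: the endpoints will be break points of
      -- the cross-sections.
      rw [intervalIntegral.integral_of_le hab, intervalIntegral.integral_of_le hab,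
        integral_Ioc_eq_integral_Ioo, integral_Ioc_eq_integral_Ioo]
      refine setIntegral_congr_fun measurableSet_Ioo fun x hx => ?_
      rw [hX x hx, ih hx.1.le (by linarith [hx.2]) fun y hy => hX y ⟨hy.1, hy.2.trans hx.2⟩,
        mul_smul_comm, ← pow_succ', map_smul, smul_eq_mul]
      push_cast
      ring
    rw [e, intervalIntegral.integral_mul_const, intervalIntegral.integral_ofReal,
      intervalIntegral.integral_comp_sub_right (fun x => x ^ n), integral_pow, map_smul,
      smul_eq_mul, Nat.factorial_succ]
    have h1 : ((n : ℂ) + 1) ≠ 0 := Nat.cast_add_one_ne_zero n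
    have h2 : (n.factorial : ℂ) ≠ 0 := Nat.cast_ne_zero.2 n.factorial_ne_zero
    push_cast
    field_simp
    simp

end IterInt

/-! ### The 2-path in angular coordinates -/

theorem expPi_add (x y : ℝ) : expPi (x + y) = expPi x * expPi y := by
  simp only [expPi, ← Complex.exp_add]; push_cast; ring_nf

theorem expPi_zero : expPi 0 = 1 := by simp [expPi]

theorem expPi_one : expPi 1 = -1 := by simp [expPi, Complex.exp_pi_mul_I]

theorem expPi_neg_one : expPi (-1) = -1 := by
  have h := expPi_add (-1) 1
  rw [expPi_one, neg_add_cancel, expPi_zero] at h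
  linear_combination h

theorem expPi_sub_one (x : ℝ) : expPi (x - 1) = -expPi x := by
  rw [sub_eq_add_neg, expPi_add, expPi_neg_one, mul_neg_one]

theorem norm_expPi (x : ℝ) : ‖expPi x‖ = 1 := by
  have : (Real.pi * Complex.I * x : ℂ) = ((Real.pi * x : ℝ) : ℂ) * Complex.I := by push_cast; ring
  rw [expPi, this, Complex.norm_exp_ofReal_mul_I]

theorem contDiff_expPi : ContDiff ℝ (⊤ : ℕ∞) expPi := by
  unfold expPi
  exact (contDiff_const.mul Complex.ofRealCLM.contDiff).cexp

theorem hasDerivAt_expPi (x : ℝ) : HasDerivAt expPi (Real.pi * Complex.I * expPi x) x := by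
  have h : HasDerivAt (fun y : ℝ => (Real.pi * Complex.I * y : ℂ)) (Real.pi * Complex.I * 1) x :=
    (Complex.ofRealCLM.hasDerivAt (x := x)).const_mul _
  have h2 : HasDerivAt expPi (expPi x * (Real.pi * Complex.I * 1)) x := h.cexp
  rwa [mul_one, mul_comm] at h2

/-- The circle of centre `ε / 2` and radius `1 - ε / 2`. -/
noncomputable def circ (ε θ : ℝ) : ℂ := ε / 2 + (1 - ε / 2) * expPi θ

theorem circ_zero (ε : ℝ) : circ ε 0 = 1 := by rw [circ, expPi_zero]; ring

theorem circ_one (ε : ℝ) : circ ε 1 = ε - 1 := by rw [circ, expPi_one]; ring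

/-- The radius minus the distance of the centre from the origin, `(1 - ε/2) - ε/2`. It keeps `v`
away from `0` and `z` finite. -/
theorem norm_circ_ge {ε : ℝ} (h0 : 0 ≤ ε) (h1 : ε ≤ 1) (θ : ℝ) : 1 - ε ≤ ‖circ ε θ‖ := by
  have h := norm_sub_norm_le ((1 - ε / 2 : ℂ) * expPi θ) (-(ε / 2 : ℂ))
  have e1 : ‖((1 - ε / 2 : ℂ) * expPi θ)‖ = 1 - ε / 2 := by
    rw [norm_mul, norm_expPi, mul_one]
    have : (1 - ε / 2 : ℂ) = ((1 - ε / 2 : ℝ) : ℂ) := by push_cast; ring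
    rw [this, Complex.norm_real, Real.norm_of_nonneg (by linarith)]
  have e2 : ‖-(ε / 2 : ℂ)‖ = ε / 2 := by
    have : (-(ε / 2) : ℂ) = ((-(ε / 2) : ℝ) : ℂ) := by push_cast; ring
    rw [this, Complex.norm_real, norm_neg, Real.norm_of_nonneg (by linarith)]
  rw [e1, e2, sub_neg_eq_add, add_comm] at h
  rw [circ]
  linarith

theorem circ_ne_zero {ε : ℝ} (h0 : 0 ≤ ε) (h1 : ε < 1) (θ : ℝ) : circ ε θ ≠ 0 := by
  have h := norm_circ_ge h0 h1.le θ
  exact norm_pos_iff.1 (by linarith)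

/-- The point `z = 1` corresponds to the value `ε` on the circle, so this bound keeps `z` away from
`1` once `ε < 1/2`. -/
theorem norm_sub_circ_ge {ε : ℝ} (h0 : 0 ≤ ε) (h1 : ε ≤ 1) (θ : ℝ) :
    1 - 2 * ε ≤ ‖(ε : ℂ) - circ ε θ‖ := by
  have h := norm_sub_norm_le (circ ε θ) (ε : ℂ)
  rw [norm_sub_rev, Complex.norm_real, Real.norm_of_nonneg h0] at h
  linarith [norm_circ_ge h0 h1 θ]

theorem sub_circ_ne_zero {ε : ℝ} (h0 : 0 ≤ ε) (h1 : ε < 1 / 2) (θ : ℝ) :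
    (ε : ℂ) - circ ε θ ≠ 0 := by
  have h := norm_sub_circ_ge h0 (by linarith) θ
  exact norm_pos_iff.1 (by linarith)

theorem contDiff_circ (ε : ℝ) : ContDiff ℝ (⊤ : ℕ∞) (circ ε) :=
  contDiff_const.add (contDiff_const.mul contDiff_expPi)

theorem hasDerivAt_circ (ε θ : ℝ) :
    HasDerivAt (circ ε) ((1 - ε / 2) * (Real.pi * Complex.I * expPi θ)) θ :=
  ((hasDerivAt_expPi θ).const_mul _).const_add _

/-- The point with `ε / z` and `v / a` on the circle, at the angles `α` and `β`. -/
noncomputable def torusPt (ε : ℝ) (a : ℂ) (α β : ℝ) : ℂ × ℂ := (ε / circ ε α, circ ε β * a)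

theorem torusPt_mem {ε : ℝ} (h0 : 0 < ε) (h1 : ε < 1 / 2) {a : ℂ} (ha : a ≠ 0) (α β : ℝ) :
    torusPt ε a α β ∈ baseSpace := by
  have hc := circ_ne_zero h0.le (by linarith) α
  refine ⟨div_ne_zero (Complex.ofReal_ne_zero.2 h0.ne') hc, fun h => ?_,
    mul_ne_zero (circ_ne_zero h0.le (by linarith) β) ha⟩
  rw [torusPt, div_eq_one_iff_eq hc] at h
  exact sub_circ_ne_zero h0.le h1 α (sub_eq_zero.2 h)

theorem contDiff_torusPt {ε : ℝ} (h0 : 0 ≤ ε) (h1 : ε < 1) (a : ℂ) :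
    ContDiff ℝ (⊤ : ℕ∞) fun x : ℝ × ℝ => torusPt ε a x.1 x.2 :=
  (contDiff_const.mul (((contDiff_circ ε).comp contDiff_fst).inv
    fun x : ℝ × ℝ => circ_ne_zero h0 h1 x.1)).prodMk
      (((contDiff_circ ε).comp contDiff_snd).mul contDiff_const)

theorem qVI_eq (ε : ℝ) (a : ℂ) (r : ℝ) : qVI ε a r = torusPt ε a r r := rfl

theorem cVI_eq (ε r : ℝ) : cVI ε r = ε / circ ε (1 - r) := by
  rw [cVI, circ, ← mul_div_mul_left (ε : ℂ) _ (two_ne_zero (α := ℂ))]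
  congr 1
  ring

theorem cIV_eq {ε : ℝ} (h0 : ε ≠ 0) (r : ℝ) : cIV ε r * ε = circ ε (-r) := by
  have h : (ε : ℂ) ≠ 0 := Complex.ofReal_ne_zero.2 h0
  rw [cIV, circ]
  field_simp

theorem qSE_eq (ε : ℝ) (a : ℂ) (r : ℝ) : qSE ε a r = torusPt ε a (r - 1) r := by
  rw [qSE, torusPt, circ, circ, expPi_sub_one,
    ← mul_div_mul_left (ε : ℂ) (ε / 2 + _) (two_ne_zero (α := ℂ))]
  refine Prod.ext (congrArg (fun x => 2 * (ε : ℂ) / x) ?_) rfl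
  ring

/-- The angle of `ε / z` along the 2-path. -/
noncomputable def angleZ (s r : ℝ) : ℝ :=
  if r ≤ (1 - s) / 2 then 2 * r else if r ≤ 1 - s / 2 then 2 - 2 * r - 2 * s else 2 * r - 2

/-- The angle of `v / a` along the 2-path. -/
noncomputable def angleV (s r : ℝ) : ℝ :=
  if r ≤ (1 - s) / 2 then 2 * r else if r ≤ 1 - s / 2 then 1 - s else 2 * r - 1

/-- All the curves in the definition of `pathL` are arcs of the same circle in the coordinates `ε /
z` and `v / a`. From here on the geometry is that of two piecewise affine angles, and `a` only
rescales `v`. -/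
theorem pathL_eq {ε : ℝ} (h0 : ε ≠ 0) (a : ℂ) (s r : ℝ) :
    pathL ε a s r = torusPt ε a (angleZ s r) (angleV s r) := by
  rw [pathL, angleZ, angleV]
  split_ifs
  · rfl
  · rw [cVI_eq, cIV_eq h0, torusPt]
    ring_nf
  · rw [qSE_eq]
    ring_nf

theorem continuous_angleZ : Continuous fun x : ℝ × ℝ => angleZ x.1 x.2 := by
  unfold angleZ
  refine Continuous.if_le (by fun_prop) (Continuous.if_le (by fun_prop) (by fun_prop)
    (by fun_prop) (by fun_prop) ?_) (by fun_prop) (by fun_prop) ?_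
  · intro x hx; linarith
  · intro x hx
    rw [if_pos (by linarith)]; linarith

theorem continuous_angleV : Continuous fun x : ℝ × ℝ => angleV x.1 x.2 := by
  unfold angleV
  refine Continuous.if_le (by fun_prop) (Continuous.if_le (by fun_prop) (by fun_prop)
    (by fun_prop) (by fun_prop) ?_) (by fun_prop) (by fun_prop) ?_
  · intro x hx; linarith
  · intro x hx
    rw [if_pos (by linarith)]; linarith

/-- This and the next two lemmas hold on closed pieces although the definitions use strict
alternatives, because neighbouring branches agree on the lines `2r + s = 1` and `2r + s = 2`.
Smoothness up to the edges of the polygons rests on this. -/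
theorem angles_lower {s r : ℝ} (h : r ≤ (1 - s) / 2) :
    angleZ s r = 2 * r ∧ angleV s r = 2 * r := by
  rw [angleZ, angleV, if_pos h, if_pos h]; exact ⟨rfl, rfl⟩

theorem angles_middle {s r : ℝ} (h : (1 - s) / 2 ≤ r) (h' : r ≤ 1 - s / 2) :
    angleZ s r = 2 - 2 * r - 2 * s ∧ angleV s r = 1 - s := by
  rw [angleZ, angleV]
  rcases h.eq_or_lt with h | h
  · rw [if_pos h.ge, if_pos h.ge]; constructor <;> linarith
  · rw [if_neg h.not_ge, if_neg h.not_ge, if_pos h', if_pos h']; exact ⟨rfl, rfl⟩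

theorem angles_upper {s r : ℝ} (h : 1 - s / 2 ≤ r) :
    angleZ s r = 2 * r - 2 ∧ angleV s r = 2 * r - 1 := by
  rw [angleZ, angleV, if_neg (by linarith : ¬ r ≤ (1 - s) / 2),
    if_neg (by linarith : ¬ r ≤ (1 - s) / 2)]
  rcases h.eq_or_lt with h | h
  · rw [if_pos h.ge, if_pos h.ge]; constructor <;> linarith
  · rw [if_neg h.not_ge, if_neg h.not_ge]; exact ⟨rfl, rfl⟩

theorem continuous_pathL {ε : ℝ} (h0 : 0 < ε) (h1 : ε < 1) (a : ℂ) :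
    Continuous fun x : ℝ × ℝ => pathL ε a x.1 x.2 := by
  simp only [pathL_eq h0.ne']
  exact Continuous.comp (g := fun x : ℝ × ℝ => torusPt ε a x.1 x.2)
    (f := fun x : ℝ × ℝ => (angleZ x.1 x.2, angleV x.1 x.2))
    (contDiff_torusPt h0.le h1 a).continuous (continuous_angleZ.prodMk continuous_angleV)

/-! ### The 2-path is a 2-path -/

theorem pathL_zero_eq {ε : ℝ} (h0 : ε ≠ 0) (a : ℂ) {r : ℝ} (hr : r ≤ 1) :
    pathL ε a 0 r = concat (fun r => (cVI ε r, (ε - 1) * a)) (qVI ε a) r := by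
  rw [pathL, concat]
  simp only [sub_zero, zero_div, if_pos hr, mul_zero, add_zero, zero_sub]
  rw [cIV_eq h0, neg_neg, circ_one]

theorem pathL_one_eq {ε : ℝ} (h0 : ε ≠ 0) (a : ℂ) {r : ℝ} (hr : 0 ≤ r) :
    pathL ε a 1 r = concat (qSE ε a) (fun r => (cVI ε (r + 1), a)) r := by
  -- For `s = 1` the first branch of `pathL` has shrunk to the point `r = 0`, where the value comes
  -- from `qVI` and not from `cVI`; both have all angles equal to `0` there.
  rcases hr.eq_or_lt with rfl | hr
  · simp only [pathL, concat, sub_self, zero_div, le_refl, if_true]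
    norm_num
    rw [qVI_eq, cVI_eq, torusPt, sub_self, circ_zero, one_mul]
  · rw [pathL, concat, if_neg (by linarith : ¬ r ≤ (1 - 1) / 2)]
    have e : (1 : ℝ) - 1 / 2 = 1 / 2 := by norm_num
    rw [e]
    congr 1
    rw [sub_self, cIV_eq h0, neg_zero, circ_zero, one_mul]
    ring_nf


/-! ### Smoothness on the three polygons of the square. -/

theorem contDiffOn_pathL {ε : ℝ} (h0 : 0 < ε) (h1 : ε < 1) (a : ℂ) {S : Set (ℝ × ℝ)}
    {f g : ℝ × ℝ → ℝ} (hf : ContDiff ℝ (⊤ : ℕ∞) f) (hg : ContDiff ℝ (⊤ : ℕ∞) g)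
    (h : ∀ x ∈ S, angleZ x.1 x.2 = f x ∧ angleV x.1 x.2 = g x) :
    ContDiffOn ℝ (⊤ : ℕ∞) (fun x : ℝ × ℝ => pathL ε a x.1 x.2) S := by
  have hc : ContDiff ℝ (⊤ : ℕ∞) fun x : ℝ × ℝ => torusPt ε a (f x) (g x) :=
    ContDiff.comp (g := fun x : ℝ × ℝ => torusPt ε a x.1 x.2) (f := fun x => (f x, g x))
      (contDiff_torusPt h0.le h1 a) (hf.prodMk hg)
  refine hc.contDiffOn.congr fun x hx => ?_
  rw [pathL_eq h0.ne', (h x hx).1, (h x hx).2]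

/-- The part of the square below both lines along which the 2-path is broken. -/
def lowerPart : Set (ℝ × ℝ) := {x | 0 ≤ x.1 ∧ 0 ≤ x.2 ∧ 2 * x.2 + x.1 ≤ 1}

/-- The part of the square between the two lines. -/
def middlePart : Set (ℝ × ℝ) := {x | 0 ≤ x.1 ∧ x.1 ≤ 1 ∧ 1 ≤ 2 * x.2 + x.1 ∧ 2 * x.2 + x.1 ≤ 2}

/-- The part of the square above both lines. -/
def upperPart : Set (ℝ × ℝ) := {x | x.1 ≤ 1 ∧ x.2 ≤ 1 ∧ 2 ≤ 2 * x.2 + x.1}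

theorem contDiffOn_pathL_lower {ε : ℝ} (h0 : 0 < ε) (h1 : ε < 1) (a : ℂ) :
    ContDiffOn ℝ (⊤ : ℕ∞) (fun x : ℝ × ℝ => pathL ε a x.1 x.2) lowerPart :=
  contDiffOn_pathL h0 h1 a (f := fun x => 2 * x.2) (g := fun x => 2 * x.2) (by fun_prop)
    (by fun_prop) fun x hx => angles_lower (by linarith [hx.2.2])

theorem contDiffOn_pathL_middle {ε : ℝ} (h0 : 0 < ε) (h1 : ε < 1) (a : ℂ) :
    ContDiffOn ℝ (⊤ : ℕ∞) (fun x : ℝ × ℝ => pathL ε a x.1 x.2) middlePart :=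
  contDiffOn_pathL h0 h1 a (f := fun x => 2 - 2 * x.2 - 2 * x.1) (g := fun x => 1 - x.1)
    (by fun_prop) (by fun_prop) fun x hx =>
      angles_middle (by linarith [hx.2.2.1]) (by linarith [hx.2.2.2])

theorem contDiffOn_pathL_upper {ε : ℝ} (h0 : 0 < ε) (h1 : ε < 1) (a : ℂ) :
    ContDiffOn ℝ (⊤ : ℕ∞) (fun x : ℝ × ℝ => pathL ε a x.1 x.2) upperPart :=
  contDiffOn_pathL h0 h1 a (f := fun x => 2 * x.2 - 2) (g := fun x => 2 * x.2 - 1) (by fun_prop)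
    (by fun_prop) fun x hx => angles_upper (by linarith [hx.2.2])

/-- The vertices of the three parts of the square. -/
noncomputable def vertices : Fin 3 → Finset (ℝ × ℝ) :=
  ![{(0, 0), (0, 1 / 2), (1, 0)}, {(0, 1 / 2), (0, 1), (1, 1 / 2), (1, 0)},
    {(0, 1), (1, 1), (1, 1 / 2)}]

theorem convexHull_vertices_zero : convexHull ℝ (vertices 0 : Set (ℝ × ℝ)) = lowerPart := by
  apply subset_antisymm
  · refine convexHull_min ?_ ?_
    · intro x hx
      simp only [vertices, Matrix.cons_val_zero, Finset.coe_insert, Finset.coe_singleton,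
        Set.mem_insert_iff, Set.mem_singleton_iff] at hx
      rcases hx with rfl | rfl | rfl <;> norm_num [lowerPart]
    · intro x hx y hy b c hb hc h
      obtain ⟨h1, h2, h3⟩ := hx
      obtain ⟨k1, k2, k3⟩ := hy
      refine ⟨?_, ?_, ?_⟩ <;> simp only [Prod.fst_add, Prod.snd_add, Prod.smul_fst,
        Prod.smul_snd, smul_eq_mul] <;> nlinarith
  · rintro ⟨s, r⟩ ⟨h1, h2, h3⟩
    -- The weights are the barycentric coordinates of `(s, r)` in the triangle.
    have := (convex_convexHull ℝ (vertices 0 : Set (ℝ × ℝ))).sum_mem (t := Finset.univ)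
      (w := ![1 - s - 2 * r, 2 * r, s]) (z := ![(0, 0), (0, 1 / 2), (1, 0)])
      (by intro i _; fin_cases i <;> simp at * <;> linarith)
      (by simp [Fin.sum_univ_three])
      (by intro i _; apply subset_convexHull; fin_cases i <;> simp [vertices])
    convert this using 1
    simp [Fin.sum_univ_three]
    ring

theorem convexHull_vertices_one : convexHull ℝ (vertices 1 : Set (ℝ × ℝ)) = middlePart := by
  apply subset_antisymm
  · refine convexHull_min ?_ ?_
    · intro x hx
      simp only [vertices, Matrix.cons_val_one, Finset.coe_insert, Finset.coe_singleton,
        Set.mem_insert_iff, Set.mem_singleton_iff, Matrix.cons_val_zero] at hx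
      rcases hx with rfl | rfl | rfl | rfl <;> norm_num [middlePart]
    · intro x hx y hy b c hb hc h
      obtain ⟨h1, h2, h3, h4⟩ := hx
      obtain ⟨k1, k2, k3, k4⟩ := hy
      refine ⟨?_, ?_, ?_, ?_⟩ <;> simp only [Prod.fst_add, Prod.snd_add, Prod.smul_fst,
        Prod.smul_snd, smul_eq_mul] <;> nlinarith
  · rintro ⟨s, r⟩ ⟨h1, h2, h3, h4⟩
    simp only at h1 h2 h3 h4
    -- The parallelogram is the unit square in the coordinates `s` and `x = 2r + s - 1`; the weights
    -- are the products of bilinear interpolation, with `1 - x = 2 - 2r - s`.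
    have := (convex_convexHull ℝ (vertices 1 : Set (ℝ × ℝ))).sum_mem (t := Finset.univ)
      (w := ![(1 - s) * (2 - 2 * r - s), (1 - s) * (2 * r + s - 1), s * (2 * r + s - 1),
        s * (2 - 2 * r - s)]) (z := ![(0, 1 / 2), (0, 1), (1, 1 / 2), (1, 0)])
      (by
        intro i _
        fin_cases i
        · exact mul_nonneg (by linarith) (by linarith)
        · exact mul_nonneg (by linarith) (by linarith)
        · exact mul_nonneg (by linarith) (by linarith)
        · exact mul_nonneg (by linarith) (by linarith))
      (by simp [Fin.sum_univ_four]; ring)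
      (by intro i _; apply subset_convexHull; fin_cases i <;> simp [vertices])
    convert this using 1
    simp [Fin.sum_univ_four]
    constructor <;> ring

theorem convexHull_vertices_two : convexHull ℝ (vertices 2 : Set (ℝ × ℝ)) = upperPart := by
  apply subset_antisymm
  · refine convexHull_min ?_ ?_
    · intro x hx
      simp only [vertices, Matrix.cons_val, Finset.coe_insert, Finset.coe_singleton,
        Set.mem_insert_iff, Set.mem_singleton_iff] at hx
      rcases hx with rfl | rfl | rfl <;> norm_num [upperPart]
    · intro x hx y hy b c hb hc h
      obtain ⟨h1, h2, h3⟩ := hx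
      obtain ⟨k1, k2, k3⟩ := hy
      refine ⟨?_, ?_, ?_⟩ <;> simp only [Prod.fst_add, Prod.snd_add, Prod.smul_fst,
        Prod.smul_snd, smul_eq_mul] <;> nlinarith
  · rintro ⟨s, r⟩ ⟨h1, h2, h3⟩
    simp only at h1 h2 h3
    have := (convex_convexHull ℝ (vertices 2 : Set (ℝ × ℝ))).sum_mem (t := Finset.univ)
      (w := ![1 - s, 2 * r + s - 2, 2 - 2 * r]) (z := ![(0, 1), (1, 1), (1, 1 / 2)])
      (by
        intro i _
        fin_cases i
        · exact sub_nonneg.2 h1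
        · exact sub_nonneg.2 h3
        · exact sub_nonneg.2 (by linarith : 2 * r ≤ 2))
      (by simp [Fin.sum_univ_three]; ring)
      (by intro i _; apply subset_convexHull; fin_cases i <;> simp [vertices])
    convert this using 1
    simp [Fin.sum_univ_three]
    ring

/-- A line has empty interior: a small shift of a common interior point in the `r` direction stays
in both sets but changes `2r + s`. -/
theorem disjoint_interior_of_inter_subset_line {S T : Set (ℝ × ℝ)} {c : ℝ}
    (h : S ∩ T ⊆ {x | 2 * x.2 + x.1 = c}) : Disjoint (interior S) (interior T) := by
  rw [Set.disjoint_iff_inter_eq_empty, ← interior_inter, Set.eq_empty_iff_forall_notMem]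
  intro x hx
  have hc : Tendsto (fun δ : ℝ => (x.1, x.2 + δ)) (𝓝[>] 0) (𝓝 x) := by
    have : Continuous fun δ : ℝ => (x.1, x.2 + δ) := by fun_prop
    simpa using (this.tendsto 0).mono_left nhdsWithin_le_nhds
  have h1 := hc.eventually (isOpen_interior.mem_nhds hx)
  obtain ⟨δ, hδ, hpos⟩ := (h1.and self_mem_nhdsWithin).exists
  have e1 : 2 * x.2 + x.1 = c := h (interior_subset hx)
  have e2 : 2 * (x.2 + δ) + x.1 = c := h (interior_subset hδ)
  have : (0 : ℝ) < δ := hpos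
  linarith

theorem interior_nonempty_of_open_subset {S T : Set (ℝ × ℝ)} (hT : IsOpen T) (h : T ⊆ S)
    (hn : T.Nonempty) : (interior S).Nonempty := hn.mono (interior_maximal h hT)

/-- The two bounding 1-paths are the sections `s = 0` and `s = 1`. In each of them one of the three
pieces degenerates to a point, so the only genuine break is at `r = 1/2`. -/
theorem isOnePath_of_pathL {ε : ℝ} (h0 : 0 < ε) (h1 : ε < 1 / 2) {a : ℂ} (ha : a ≠ 0) (s : ℝ)
    {p : ℝ → ℂ × ℂ} (hp : ∀ r ∈ Set.Icc (0 : ℝ) 1, p r = pathL ε a s r) {S S' : Set (ℝ × ℝ)}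
    (hS : ContDiffOn ℝ (⊤ : ℕ∞) (fun x : ℝ × ℝ => pathL ε a x.1 x.2) S)
    (hS' : ContDiffOn ℝ (⊤ : ℕ∞) (fun x : ℝ × ℝ => pathL ε a x.1 x.2) S')
    (hm : ∀ r ∈ Set.Icc (0 : ℝ) (1 / 2), (s, r) ∈ S)
    (hm' : ∀ r ∈ Set.Icc (1 / 2 : ℝ) 1, (s, r) ∈ S') : IsOnePath p := by
  have hg : ContDiff ℝ (⊤ : ℕ∞) fun r : ℝ => (s, r) := by fun_prop
  refine ⟨?_, ?_, 2, fun i => i / 2, by norm_num, by norm_num, ?_⟩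
  · have hc : Continuous fun r => pathL ε a s r :=
      (continuous_pathL h0 (by linarith) a).comp (f := fun r : ℝ => (s, r)) (by fun_prop)
    exact hc.continuousOn.congr hp
  · intro r hr
    rw [hp r hr, pathL_eq h0.ne']
    exact torusPt_mem h0 h1 ha _ _
  · intro i hi
    refine ⟨by push_cast; linarith, ?_⟩
    interval_cases i
    · norm_num
      refine (hS.comp (s := Set.Icc 0 (1 / 2)) hg.contDiffOn hm).congr fun r hr => ?_
      exact hp r ⟨hr.1, by linarith [hr.2]⟩
    · norm_num
      refine (hS'.comp (s := Set.Icc (1 / 2) 1) hg.contDiffOn hm').congr fun r hr => ?_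
      exact hp r ⟨by linarith [hr.1], hr.2⟩

theorem isTwoPath_pathL {ε : ℝ} (h0 : 0 < ε) (h1 : ε ≤ 1 / 4) {a : ℂ} (ha : a ≠ 0) :
    IsTwoPath (pathL ε a) (concat (fun r => (cVI ε r, (ε - 1) * a)) (qVI ε a))
      (concat (qSE ε a) (fun r => (cVI ε (r + 1), a))) := by
  have hlt : ε < 1 / 2 := by linarith
  have hp : ∀ r ∈ Set.Icc (0 : ℝ) 1,
      concat (fun r => (cVI ε r, (ε - 1) * a)) (qVI ε a) r = pathL ε a 0 r :=
    fun r hr => (pathL_zero_eq h0.ne' a hr.2).symm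
  have hq : ∀ r ∈ Set.Icc (0 : ℝ) 1,
      concat (qSE ε a) (fun r => (cVI ε (r + 1), a)) r = pathL ε a 1 r :=
    fun r hr => (pathL_one_eq h0.ne' a hr.1).symm
  have m0 : (0 : ℝ) ∈ Set.Icc (0 : ℝ) 1 := by simp
  have m1 : (1 : ℝ) ∈ Set.Icc (0 : ℝ) 1 := by simp
  have hl := contDiffOn_pathL_lower h0 (by linarith) a
  have hm := contDiffOn_pathL_middle h0 (by linarith) a
  have hu := contDiffOn_pathL_upper h0 (by linarith) a
  have start : ∀ s ∈ Set.Icc (0 : ℝ) 1, pathL ε a s 0 = torusPt ε a 0 0 := by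
    intro s hs
    have h := angles_lower (s := s) (r := 0) (by linarith [hs.2])
    rw [pathL_eq h0.ne', h.1, h.2, mul_zero]
  have finish : ∀ s ∈ Set.Icc (0 : ℝ) 1, pathL ε a s 1 = torusPt ε a 0 1 := by
    intro s hs
    have h := angles_upper (s := s) (r := 1) (by linarith [hs.1])
    rw [pathL_eq h0.ne', h.1, h.2]
    norm_num
  refine ⟨?_, ?_, ?_, ?_, (continuous_pathL h0 (by linarith) a).continuousOn, ?_, ?_, ?_, ?_⟩
  · refine isOnePath_of_pathL h0 hlt ha 0 hp hl hm ?_ ?_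
    · intro r hr
      exact ⟨le_rfl, hr.1, by dsimp only; linarith [hr.2]⟩
    · intro r hr
      exact ⟨le_rfl, zero_le_one, by dsimp only; linarith [hr.1], by dsimp only; linarith [hr.2]⟩
  · refine isOnePath_of_pathL h0 hlt ha 1 hq hm hu ?_ ?_
    · intro r hr
      exact ⟨zero_le_one, le_rfl, by dsimp only; linarith [hr.1], by dsimp only; linarith [hr.2]⟩
    · intro r hr
      exact ⟨le_rfl, hr.2, by dsimp only; linarith [hr.1]⟩
  · rw [hp 0 m0, hq 0 m0, start 0 m0, start 1 m1]
  · rw [hp 1 m1, hq 1 m1, finish 0 m0, finish 1 m1]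
  · intro x _
    dsimp only
    rw [pathL_eq h0.ne']
    exact torusPt_mem h0 hlt ha _ _
  · refine ⟨3, vertices, ?_, ?_, ?_, ?_⟩
    · ext ⟨s, r⟩
      simp only [Set.mem_iUnion, Fin.exists_fin_succ, IsEmpty.exists_iff, or_false,
        Fin.succ_zero_eq_one, Fin.succ_one_eq_two, convexHull_vertices_zero,
        convexHull_vertices_one, convexHull_vertices_two]
      simp only [lowerPart, middlePart, upperPart, Set.mem_ofPred_eq, Set.mem_prod, Set.mem_Icc]
      constructor
      · rintro (⟨h1, h2, h3⟩ | ⟨h1, h2, h3, h4⟩ | ⟨h1, h2, h3⟩) <;>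
          refine ⟨⟨?_, ?_⟩, ?_, ?_⟩ <;> linarith
      · rintro ⟨⟨h1, h2⟩, h3, h4⟩
        rcases le_total (2 * r + s) 1 with h | h
        · exact Or.inl ⟨h1, h3, h⟩
        rcases le_total (2 * r + s) 2 with h' | h'
        · exact Or.inr (Or.inl ⟨h1, h2, h, h'⟩)
        · exact Or.inr (Or.inr ⟨h2, h4, h'⟩)
    · intro i
      fin_cases i
      · refine interior_nonempty_of_open_subset
          (T := {x | 0 < x.1} ∩ ({x | 0 < x.2} ∩ {x | 2 * x.2 + x.1 < 1})) ?_ ?_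
          ⟨(1 / 4, 1 / 4), by norm_num⟩
        · exact (isOpen_lt (by fun_prop) (by fun_prop)).inter
            ((isOpen_lt (by fun_prop) (by fun_prop)).inter (isOpen_lt (by fun_prop) (by fun_prop)))
        · refine Set.Subset.trans ?_ convexHull_vertices_zero.ge
          rintro x ⟨h1, h2, h3⟩
          exact ⟨h1.le, h2.le, h3.le⟩
      · refine interior_nonempty_of_open_subset
          (T := {x | 0 < x.1} ∩ ({x | x.1 < 1} ∩ ({x | 1 < 2 * x.2 + x.1} ∩
            {x | 2 * x.2 + x.1 < 2}))) ?_ ?_ ⟨(1 / 2, 1 / 2), by norm_num⟩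
        · exact (isOpen_lt (by fun_prop) (by fun_prop)).inter
            ((isOpen_lt (by fun_prop) (by fun_prop)).inter
              ((isOpen_lt (by fun_prop) (by fun_prop)).inter
                (isOpen_lt (by fun_prop) (by fun_prop))))
        · refine Set.Subset.trans ?_ convexHull_vertices_one.ge
          rintro x ⟨h1, h2, h3, h4⟩
          exact ⟨h1.le, h2.le, h3.le, h4.le⟩
      · refine interior_nonempty_of_open_subset
          (T := {x | x.1 < 1} ∩ ({x | x.2 < 1} ∩ {x | 2 < 2 * x.2 + x.1})) ?_ ?_
          ⟨(3 / 4, 3 / 4), by norm_num⟩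
        · exact (isOpen_lt (by fun_prop) (by fun_prop)).inter
            ((isOpen_lt (by fun_prop) (by fun_prop)).inter (isOpen_lt (by fun_prop) (by fun_prop)))
        · refine Set.Subset.trans ?_ convexHull_vertices_two.ge
          rintro x ⟨h1, h2, h3⟩
          exact ⟨h1.le, h2.le, h3.le⟩
    · have d01 : Disjoint (interior (convexHull ℝ (vertices 0 : Set (ℝ × ℝ))))
          (interior (convexHull ℝ (vertices 1 : Set (ℝ × ℝ)))) := by
        rw [convexHull_vertices_zero, convexHull_vertices_one]
        exact disjoint_interior_of_inter_subset_line (c := 1) fun x hx =>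
          le_antisymm hx.1.2.2 hx.2.2.2.1
      have d12 : Disjoint (interior (convexHull ℝ (vertices 1 : Set (ℝ × ℝ))))
          (interior (convexHull ℝ (vertices 2 : Set (ℝ × ℝ)))) := by
        rw [convexHull_vertices_one, convexHull_vertices_two]
        exact disjoint_interior_of_inter_subset_line (c := 2) fun x hx =>
          le_antisymm hx.1.2.2.2 hx.2.2.2
      have d02 : Disjoint (interior (convexHull ℝ (vertices 0 : Set (ℝ × ℝ))))
          (interior (convexHull ℝ (vertices 2 : Set (ℝ × ℝ)))) := by
        rw [convexHull_vertices_zero, convexHull_vertices_two]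
        -- The two triangles do not meet at all, so any line serves.
        exact disjoint_interior_of_inter_subset_line (c := 1) fun x hx =>
          le_antisymm hx.1.2.2 (by linarith [hx.2.2.2])
      intro i j hij
      fin_cases i <;> fin_cases j
      exacts [absurd rfl hij, d01, d02, d01.symm, absurd rfl hij, d12, d02.symm, d12.symm,
        absurd rfl hij]
    · intro i
      fin_cases i
      · exact hl.mono convexHull_vertices_zero.le
      · exact hm.mono convexHull_vertices_one.le
      · exact hu.mono convexHull_vertices_two.le
  · intro s hs
    rw [hp 0 m0, hp 1 m1, start s hs, finish s hs, start 0 m0, finish 0 m0]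
    exact ⟨rfl, rfl⟩
  · intro r hr
    exact ⟨(hp r hr).symm, (hq r hr).symm⟩

/-! ### The connection along the 2-path -/

/-- The logarithmic derivative of `circ ε`. -/
noncomputable def logCirc (ε θ : ℝ) : ℂ :=
  (1 - ε / 2) * (Real.pi * Complex.I * expPi θ) / circ ε θ

/-- The quotient of `dz / (z - 1)` by `dz / z` at `z = ε / circ ε θ`. -/
noncomputable def ratioCirc (ε θ : ℝ) : ℂ := ε / (ε - circ ε θ)

/-- The derivative is written as a multiple of the function itself, so that the forms `dz/z` and
`dv/v` are read off by cancellation. -/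
theorem hasDerivAt_circ_comp {ε : ℝ} (h0 : 0 ≤ ε) (h1 : ε < 1) {f : ℝ → ℝ} {f' x : ℝ}
    (hf : HasDerivAt f f' x) : HasDerivAt (fun y => circ ε (f y))
      (f' * logCirc ε (f x) * circ ε (f x)) x := by
  have h := (hasDerivAt_circ ε (f x)).scomp x hf
  have e : (f' : ℂ) * logCirc ε (f x) * circ ε (f x)
      = f' • ((1 - ε / 2) * (Real.pi * Complex.I * expPi (f x)) : ℂ) := by
    rw [mul_assoc, logCirc, div_mul_cancel₀ _ (circ_ne_zero h0 h1 _), Complex.real_smul]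
  rw [e]
  exact h

theorem hasDerivAt_torusPt_fst {ε : ℝ} (h0 : 0 ≤ ε) (h1 : ε < 1) {f : ℝ → ℝ} {f' x : ℝ}
    (hf : HasDerivAt f f' x) : HasDerivAt (fun y => (ε : ℂ) / circ ε (f y))
      (-(f' * logCirc ε (f x)) * (ε / circ ε (f x))) x := by
  have hc := circ_ne_zero h0 h1 (f x)
  have h := ((hasDerivAt_circ_comp h0 h1 hf).fun_inv hc).const_mul (ε : ℂ)
  have e : -((f' : ℂ) * logCirc ε (f x)) * (ε / circ ε (f x))
      = ε * (-(f' * logCirc ε (f x) * circ ε (f x)) / circ ε (f x) ^ 2) := by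
    field_simp
  rw [e]
  exact h

theorem hasDerivAt_torusPt_snd {ε : ℝ} (h0 : 0 ≤ ε) (h1 : ε < 1) (a : ℂ) {f : ℝ → ℝ} {f' x : ℝ}
    (hf : HasDerivAt f f' x) : HasDerivAt (fun y => circ ε (f y) * a)
      (f' * logCirc ε (f x) * (circ ε (f x) * a)) x := by
  rw [← mul_assoc]
  exact (hasDerivAt_circ_comp h0 h1 hf).mul_const a

/-- The derivative of `angleZ` along the cross-sections. -/
noncomputable def slopeZ (s r : ℝ) : ℝ :=
  if r ≤ (1 - s) / 2 then 2 else if r ≤ 1 - s / 2 then -2 else 2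

/-- The derivative of `angleV` along the cross-sections. -/
noncomputable def slopeV (s r : ℝ) : ℝ :=
  if r ≤ (1 - s) / 2 then 2 else if r ≤ 1 - s / 2 then 0 else 2

theorem generic_cases {s r : ℝ} (h : r ≠ (1 - s) / 2) (h' : r ≠ 1 - s / 2) :
    r < (1 - s) / 2 ∨ ((1 - s) / 2 < r ∧ r < 1 - s / 2) ∨ 1 - s / 2 < r := by
  rcases h.lt_or_gt with h | h
  · exact Or.inl h
  rcases h'.lt_or_gt with h' | h'
  · exact Or.inr (Or.inl ⟨h, h'⟩)
  · exact Or.inr (Or.inr h')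

theorem hasDerivAt_angles {s r : ℝ} (h : r ≠ (1 - s) / 2) (h' : r ≠ 1 - s / 2) :
    HasDerivAt (fun x => angleZ s x) (slopeZ s r) r ∧
      HasDerivAt (fun x => angleV s x) (slopeV s r) r := by
  have hid := hasDerivAt_id r
  rcases generic_cases h h' with h | ⟨h, h'⟩ | h
  · rw [slopeZ, slopeV, if_pos h.le, if_pos h.le]
    have hl : HasDerivAt (fun x : ℝ => 2 * x) 2 r := by simpa using hid.const_mul 2
    have he := (gt_mem_nhds h).mono fun x hx => angles_lower (le_of_lt hx)
    exact ⟨hl.congr_of_eventuallyEq (he.mono fun x hx => hx.1),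
      hl.congr_of_eventuallyEq (he.mono fun x hx => hx.2)⟩
  · rw [slopeZ, slopeV, if_neg h.not_ge, if_neg h.not_ge, if_pos h'.le, if_pos h'.le]
    have hl : HasDerivAt (fun x : ℝ => 2 - 2 * x - 2 * s) (-2) r := by
      simpa using ((hid.const_mul 2).const_sub 2).sub_const (2 * s)
    have he := ((lt_mem_nhds h).and (gt_mem_nhds h')).mono fun x hx =>
      angles_middle (le_of_lt hx.1) (le_of_lt hx.2)
    exact ⟨hl.congr_of_eventuallyEq (he.mono fun x hx => hx.1),
      (hasDerivAt_const r (1 - s)).congr_of_eventuallyEq (he.mono fun x hx => hx.2)⟩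
  · have hn : ¬ r ≤ (1 - s) / 2 := by linarith
    rw [slopeZ, slopeV, if_neg hn, if_neg hn, if_neg h.not_ge, if_neg h.not_ge]
    have hl : ∀ c : ℝ, HasDerivAt (fun x : ℝ => 2 * x - c) 2 r := fun c => by
      simpa using (hid.const_mul 2).sub_const c
    have he := (lt_mem_nhds h).mono fun x hx => angles_upper (le_of_lt hx)
    exact ⟨(hl 2).congr_of_eventuallyEq (he.mono fun x hx => hx.1),
      (hl 1).congr_of_eventuallyEq (he.mono fun x hx => hx.2)⟩

/-- `dz/z`, `dz/(z-1)` and `dv/v` along the cross-sections of the 2-path. -/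
noncomputable def pathForm (ε s : ℝ) : Fin 3 → ℝ → ℂ :=
  ![fun r => -(slopeZ s r * logCirc ε (angleZ s r)),
    fun r => -(slopeZ s r * logCirc ε (angleZ s r)) * ratioCirc ε (angleZ s r),
    fun r => slopeV s r * logCirc ε (angleV s r)]

/-- `2 dz ∧ dv / (z v)` on the partial derivatives of the 2-path. -/
noncomputable def surfFormL (ε s r : ℝ) : ℂ :=
  if r ≤ (1 - s) / 2 then 0
  else if r ≤ 1 - s / 2 then 2 * logCirc ε (angleZ s r) * logCirc ε (angleV s r) else 0

/-- `2 dz ∧ dv / ((z - 1) v)` on the partial derivatives of the 2-path. -/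
noncomputable def surfFormR (ε s r : ℝ) : ℂ := surfFormL ε s r * ratioCirc ε (angleZ s r)

/-- The factor `z / (z - 1)` converts `dz/z` into `dz/(z-1)`. Its value `ε / (ε - circ ε θ)` is of
order `ε`, which is why `dz/(z-1)` and `R` leave no trace in the limit. -/
theorem div_sub_one_eq {ε : ℝ} (h0 : 0 < ε) (h1 : ε < 1 / 2) (θ : ℝ) :
    (ε / circ ε θ : ℂ) / (ε / circ ε θ - 1) = ratioCirc ε θ := by
  have hc := circ_ne_zero h0.le (by linarith) θ
  have hs := sub_circ_ne_zero h0.le h1 θ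
  rw [ratioCirc, div_sub_one hc, div_div_div_cancel_right₀ hc]

theorem deriv_pathL_r {ε : ℝ} (h0 : 0 < ε) (h1 : ε < 1 / 2) (a : ℂ) {s r : ℝ}
    (h : r ≠ (1 - s) / 2) (h' : r ≠ 1 - s / 2) :
    deriv (fun x => (pathL ε a s x).1) r
      = -(slopeZ s r * logCirc ε (angleZ s r)) * (ε / circ ε (angleZ s r)) ∧
    deriv (fun x => (pathL ε a s x).2) r
      = slopeV s r * logCirc ε (angleV s r) * (circ ε (angleV s r) * a) := by
  simp only [pathL_eq h0.ne', torusPt]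
  obtain ⟨hz, hv⟩ := hasDerivAt_angles h h'
  exact ⟨(hasDerivAt_torusPt_fst h0.le (by linarith) hz).deriv,
    (hasDerivAt_torusPt_snd h0.le (by linarith) a hv).deriv⟩

theorem connForm_pathL {ε : ℝ} (h0 : 0 < ε) (h1 : ε < 1 / 2) {a : ℂ} (ha : a ≠ 0) {s r : ℝ}
    (h : r ≠ (1 - s) / 2) (h' : r ≠ 1 - s / 2) (i : Fin 3) :
    connForm (pathL ε a s) i r = pathForm ε s i r := by
  obtain ⟨e1, e2⟩ := deriv_pathL_r h0 h1 a h h'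
  obtain ⟨m1, m2, m3⟩ := torusPt_mem h0 h1 ha (angleZ s r) (angleV s r)
  have hp := pathL_eq h0.ne' a s r
  fin_cases i
  · change deriv (fun x => (pathL ε a s x).1) r / (pathL ε a s r).1 = _
    rw [e1, hp]
    exact mul_div_cancel_right₀ _ m1
  · change deriv (fun x => (pathL ε a s x).1) r / ((pathL ε a s r).1 - 1) = _
    rw [e1, hp, torusPt, mul_div_assoc, div_sub_one_eq h0 h1]
    rfl
  · change deriv (fun x => (pathL ε a s x).2) r / (pathL ε a s r).2 = _
    rw [e2, hp]
    exact mul_div_cancel_right₀ _ m3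

theorem deriv_pathL_s {ε : ℝ} (h0 : 0 < ε) (h1 : ε < 1 / 2) (a : ℂ) {s r : ℝ}
    (h : (1 - s) / 2 < r) (h' : r < 1 - s / 2) :
    partialS (pathL ε a) s r = (2 * logCirc ε (angleZ s r) * (ε / circ ε (angleZ s r)),
      -(logCirc ε (angleV s r) * (circ ε (angleV s r) * a))) := by
  have hid := hasDerivAt_id s
  have n1 : ∀ᶠ x in 𝓝 s, (1 - x) / 2 < r :=
    ContinuousAt.eventually_lt (by fun_prop) continuousAt_const h
  have n2 : ∀ᶠ x in 𝓝 s, r < 1 - x / 2 :=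
    ContinuousAt.eventually_lt continuousAt_const (by fun_prop) h'
  have he := (n1.and n2).mono fun x hx => angles_middle (le_of_lt hx.1) (le_of_lt hx.2)
  have hz : HasDerivAt (fun x => angleZ x r) (-2) s := by
    have hl : HasDerivAt (fun x : ℝ => 2 - 2 * r - 2 * x) (-2) s := by
      simpa using (hid.const_mul 2).const_sub (2 - 2 * r)
    exact hl.congr_of_eventuallyEq (he.mono fun x hx => hx.1)
  have hv : HasDerivAt (fun x => angleV x r) (-1) s :=
    (hid.const_sub 1).congr_of_eventuallyEq (he.mono fun x hx => hx.2)
  simp only [partialS, pathL_eq h0.ne', torusPt]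
  rw [(hasDerivAt_torusPt_fst h0.le (by linarith) hz).deriv,
    (hasDerivAt_torusPt_snd h0.le (by linarith) a hv).deriv]
  push_cast
  refine Prod.ext ?_ ?_ <;> dsimp only <;> ring

/-- Outside the band the sections all run along the same curve with the same parametrisation, so
nothing depends on `s` locally and the surface form vanishes. -/
theorem deriv_pathL_s_of_outer {ε : ℝ} (h0 : 0 < ε) (a : ℂ) {s r : ℝ}
    (h : r < (1 - s) / 2 ∨ 1 - s / 2 < r) : partialS (pathL ε a) s r = 0 := by
  have key : ∀ᶠ x in 𝓝 s, angleZ x r = angleZ s r ∧ angleV x r = angleV s r := by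
    rcases h with h | h
    · have n1 : ∀ᶠ x in 𝓝 s, r < (1 - x) / 2 :=
        ContinuousAt.eventually_lt continuousAt_const (by fun_prop) h
      filter_upwards [n1] with x hx
      rw [(angles_lower hx.le).1, (angles_lower hx.le).2, (angles_lower h.le).1,
        (angles_lower h.le).2]
      exact ⟨rfl, rfl⟩
    · have n1 : ∀ᶠ x in 𝓝 s, 1 - x / 2 < r :=
        ContinuousAt.eventually_lt (by fun_prop) continuousAt_const h
      filter_upwards [n1] with x hx
      rw [(angles_upper hx.le).1, (angles_upper hx.le).2, (angles_upper h.le).1,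
        (angles_upper h.le).2]
      exact ⟨rfl, rfl⟩
  have e : (fun x => pathL ε a x r) =ᶠ[𝓝 s] fun _ => pathL ε a s r := by
    filter_upwards [key] with x hx
    rw [pathL_eq h0.ne', pathL_eq h0.ne', hx.1, hx.2]
  have e1 := (e.fun_comp Prod.fst).deriv_eq
  have e2 := (e.fun_comp Prod.snd).deriv_eq
  simp only [Function.comp_def, deriv_const] at e1 e2
  exact Prod.ext e1 e2

/-- Inside the band `∂v/∂r = 0`, so only `-(∂z/∂r)(∂v/∂s)/2` survives in the wedge. The slope `-2`
of `angleZ` in `r`, the slope `-1` of `angleV` in `s` and the sign from `z = ε / circ` combine with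
the factor `2` of `Δ` into the `2` of `surfFormL`. -/
theorem surfForm_pathL {ε : ℝ} (h0 : 0 < ε) (h1 : ε < 1 / 2) {a : ℂ} (ha : a ≠ 0) {s r : ℝ}
    (h : r ≠ (1 - s) / 2) (h' : r ≠ 1 - s / 2) :
    formL (pathL ε a) s r = surfFormL ε s r ∧ formR (pathL ε a) s r = surfFormR ε s r := by
  have outer : r < (1 - s) / 2 ∨ 1 - s / 2 < r →
      formL (pathL ε a) s r = 0 ∧ formR (pathL ε a) s r = 0 := by
    intro ho
    rw [formL, formR, deriv_pathL_s_of_outer h0 a ho]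
    simp [wedge]
  rw [surfFormR, surfFormL]
  rcases generic_cases h h' with ho | ⟨hl, hu⟩ | ho
  · rw [if_pos ho.le, zero_mul]
    exact outer (Or.inl ho)
  · rw [if_neg hl.not_ge, if_pos hu.le]
    obtain ⟨e1, e2⟩ := deriv_pathL_r h0 h1 a h h'
    obtain ⟨m1, m2, m3⟩ := torusPt_mem h0 h1 ha (angleZ s r) (angleV s r)
    rw [formL, formR, deriv_pathL_s h0 h1 a hl hu, partialR, e1, e2, pathL_eq h0.ne', wedge,
      slopeZ, slopeV, if_neg hl.not_ge, if_pos hu.le, if_neg hl.not_ge, if_pos hu.le,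
      ← div_sub_one_eq h0 h1]
    simp only [torusPt] at m1 m2 m3 ⊢
    have m2' := sub_ne_zero.2 m2
    generalize (ε : ℂ) / circ ε (angleZ s r) = z at *
    generalize circ ε (angleV s r) * a = v at *
    push_cast
    constructor <;> field_simp <;> ring
  · have hn : ¬ r ≤ (1 - s) / 2 := by linarith
    rw [if_neg hn, if_neg ho.not_ge, zero_mul]
    exact outer (Or.inr ho)

theorem ae_generic (s : ℝ) : ∀ᵐ r : ℝ, r ≠ (1 - s) / 2 ∧ r ≠ 1 - s / 2 :=
  (Measure.ae_ne volume _).and (Measure.ae_ne volume _)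

theorem iterInt_connForm_pathL {ε : ℝ} (h0 : 0 < ε) (h1 : ε < 1 / 2) {a : ℂ} (ha : a ≠ 0) (s : ℝ)
    (w : List (Fin 3)) (x y : ℝ) :
    iterInt (connForm (pathL ε a s)) w x y = iterInt (pathForm ε s) w x y :=
  iterInt_congr (fun i => (ae_generic s).mono fun _ hr => connForm_pathL h0 h1 ha hr.1 hr.2 i) w x y

/-! ### Bounds, measurability and limits -/

theorem continuous_circ_uncurry : Continuous fun x : ℝ × ℝ => circ x.1 x.2 := by
  have := contDiff_expPi.continuous
  unfold circ
  fun_prop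

theorem measurable_logCirc (ε : ℝ) : Measurable (logCirc ε) := by
  have h1 := contDiff_expPi.continuous.measurable
  have h2 := (contDiff_circ ε).continuous.measurable
  unfold logCirc
  fun_prop

theorem measurable_ratioCirc (ε : ℝ) : Measurable (ratioCirc ε) := by
  have h2 := (contDiff_circ ε).continuous.measurable
  unfold ratioCirc
  fun_prop

theorem measurable_ite_lines {f g h : ℝ × ℝ → ℂ} (hf : Measurable f) (hg : Measurable g)
    (hh : Measurable h) : Measurable fun p : ℝ × ℝ =>
      if p.2 ≤ (1 - p.1) / 2 then f p else if p.2 ≤ 1 - p.1 / 2 then g p else h p :=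
  Measurable.ite (measurableSet_le (by fun_prop) (by fun_prop)) hf
    (Measurable.ite (measurableSet_le (by fun_prop) (by fun_prop)) hg hh)

theorem measurable_slopeZ : Measurable fun p : ℝ × ℝ => (slopeZ p.1 p.2 : ℂ) := by
  simp only [slopeZ, apply_ite (fun x : ℝ => (x : ℂ))]
  exact measurable_ite_lines measurable_const measurable_const measurable_const

theorem measurable_slopeV : Measurable fun p : ℝ × ℝ => (slopeV p.1 p.2 : ℂ) := by
  simp only [slopeV, apply_ite (fun x : ℝ => (x : ℂ))]
  exact measurable_ite_lines measurable_const measurable_const measurable_const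

theorem measurable_pathForm (ε : ℝ) (i : Fin 3) :
    Measurable fun p : ℝ × ℝ => pathForm ε p.1 i p.2 := by
  have hz := (measurable_logCirc ε).comp continuous_angleZ.measurable
  have hv := (measurable_logCirc ε).comp continuous_angleV.measurable
  have hr := (measurable_ratioCirc ε).comp continuous_angleZ.measurable
  fin_cases i
  · exact (measurable_slopeZ.mul hz).neg
  · exact (measurable_slopeZ.mul hz).neg.mul hr
  · exact measurable_slopeV.mul hv

theorem measurable_pathForm_section (ε s : ℝ) (i : Fin 3) : Measurable (pathForm ε s i) :=
  Measurable.comp (g := fun p : ℝ × ℝ => pathForm ε p.1 i p.2) (f := fun r => (s, r))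
    (measurable_pathForm ε i) measurable_prodMk_left

theorem measurable_surfFormL (ε : ℝ) : Measurable fun p : ℝ × ℝ => surfFormL ε p.1 p.2 := by
  have hz := (measurable_logCirc ε).comp continuous_angleZ.measurable
  have hv := (measurable_logCirc ε).comp continuous_angleV.measurable
  exact measurable_ite_lines measurable_const ((measurable_const.mul hz).mul hv) measurable_const

theorem measurable_surfFormR (ε : ℝ) : Measurable fun p : ℝ × ℝ => surfFormR ε p.1 p.2 :=
  (measurable_surfFormL ε).mul ((measurable_ratioCirc ε).comp continuous_angleZ.measurable)

theorem norm_logCirc_le {ε : ℝ} (h0 : 0 ≤ ε) (h1 : ε ≤ 1 / 4) (θ : ℝ) : ‖logCirc ε θ‖ ≤ 6 := by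
  have hc := norm_circ_ge h0 (by linarith) θ
  have h : ‖((1 - ε / 2 : ℂ))‖ ≤ 1 := by
    have : (1 - ε / 2 : ℂ) = ((1 - ε / 2 : ℝ) : ℂ) := by push_cast; ring
    rw [this, Complex.norm_real, Real.norm_of_nonneg (by linarith)]
    linarith
  rw [logCirc, norm_div, norm_mul, norm_mul, norm_expPi, norm_mul, Complex.norm_I, mul_one,
    mul_one, Complex.norm_real, Real.norm_of_nonneg Real.pi_pos.le, div_le_iff₀ (by linarith)]
  -- The numerator is at most `π < 4` and the denominator at least `3/4`, while `4 ≤ 6 · 3/4`.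
  have hpi := Real.pi_lt_four
  nlinarith [Real.pi_pos, norm_nonneg ((1 - ε / 2 : ℂ))]

theorem norm_ratioCirc_le {ε : ℝ} (h0 : 0 ≤ ε) (h1 : ε ≤ 1 / 4) (θ : ℝ) :
    ‖ratioCirc ε θ‖ ≤ 1 := by
  have hc := norm_sub_circ_ge h0 (by linarith) θ
  rw [ratioCirc, norm_div, Complex.norm_real, Real.norm_of_nonneg h0,
    div_le_one (by linarith)]
  linarith

/-- A slope of size at most `2` times the bound `6` on `logCirc`. This constant, like the later `72
= 2 · 6 · 6`, is crude; for domination it only matters that it does not depend on `ε`, `s`, `r`. -/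
theorem norm_pathForm_le {ε : ℝ} (h0 : 0 ≤ ε) (h1 : ε ≤ 1 / 4) (s : ℝ) (i : Fin 3) (r : ℝ) :
    ‖pathForm ε s i r‖ ≤ 12 := by
  have hz : ‖(slopeZ s r : ℂ)‖ ≤ 2 := by
    rw [Complex.norm_real, slopeZ]; split_ifs <;> norm_num
  have hv : ‖(slopeV s r : ℂ)‖ ≤ 2 := by
    rw [Complex.norm_real, slopeV]; split_ifs <;> norm_num
  have e0 : ‖-((slopeZ s r : ℂ) * logCirc ε (angleZ s r))‖ ≤ 12 := by
    rw [norm_neg, norm_mul]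
    linarith [mul_le_mul hz (norm_logCirc_le h0 h1 (angleZ s r)) (norm_nonneg _) zero_le_two]
  fin_cases i
  · exact e0
  · change ‖_ * _‖ ≤ _
    rw [norm_mul]
    linarith [mul_le_mul e0 (norm_ratioCirc_le h0 h1 (angleZ s r)) (norm_nonneg _) (by norm_num)]
  · change ‖_ * _‖ ≤ _
    rw [norm_mul]
    linarith [mul_le_mul hv (norm_logCirc_le h0 h1 (angleV s r)) (norm_nonneg _) zero_le_two]

theorem norm_surfFormL_le {ε : ℝ} (h0 : 0 ≤ ε) (h1 : ε ≤ 1 / 4) (s r : ℝ) :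
    ‖surfFormL ε s r‖ ≤ 72 := by
  rw [surfFormL]
  split_ifs
  · simp
  · rw [mul_assoc, norm_mul, norm_mul, Complex.norm_ofNat]
    linarith [mul_le_mul (norm_logCirc_le h0 h1 (angleZ s r)) (norm_logCirc_le h0 h1 (angleV s r))
      (norm_nonneg _) (by norm_num)]
  · simp

theorem norm_surfFormR_le {ε : ℝ} (h0 : 0 ≤ ε) (h1 : ε ≤ 1 / 4) (s r : ℝ) :
    ‖surfFormR ε s r‖ ≤ 72 := by
  rw [surfFormR, norm_mul]
  linarith [mul_le_mul (norm_surfFormL_le h0 h1 s r) (norm_ratioCirc_le h0 h1 (angleZ s r))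
    (norm_nonneg _) (by norm_num)]

/-! ### The limit `ε → 0` of the forms. -/

theorem circ_radius_zero (θ : ℝ) : circ 0 θ = expPi θ := by simp [circ]

theorem expPi_ne_zero (θ : ℝ) : expPi θ ≠ 0 := Complex.exp_ne_zero _

/-- At `ε = 0` the circle is centred at the origin and its logarithmic derivative no longer depends
on the angle. This makes the limit connection piecewise constant. -/
theorem logCirc_radius_zero (θ : ℝ) : logCirc 0 θ = Real.pi * Complex.I := by
  rw [logCirc, circ_radius_zero, mul_div_assoc, mul_div_cancel_right₀ _ (expPi_ne_zero θ)]
  simp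

theorem ratioCirc_radius_zero (θ : ℝ) : ratioCirc 0 θ = 0 := by simp [ratioCirc]

theorem tendsto_circ (θ : ℝ) : Tendsto (fun ε => circ ε θ) (𝓝[>] 0) (𝓝 (circ 0 θ)) :=
  ((continuous_circ_uncurry.comp (by fun_prop : Continuous fun ε : ℝ => (ε, θ))).tendsto
    0).mono_left nhdsWithin_le_nhds

theorem tendsto_logCirc (θ : ℝ) : Tendsto (fun ε => logCirc ε θ) (𝓝[>] 0) (𝓝 (logCirc 0 θ)) := by
  refine Tendsto.div ?_ (tendsto_circ θ) (by rw [circ_radius_zero]; exact expPi_ne_zero θ)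
  have : Continuous fun ε : ℝ => (1 - ε / 2 : ℂ) * (Real.pi * Complex.I * expPi θ) := by fun_prop
  exact (this.tendsto 0).mono_left nhdsWithin_le_nhds

theorem tendsto_ratioCirc (θ : ℝ) :
    Tendsto (fun ε => ratioCirc ε θ) (𝓝[>] 0) (𝓝 (ratioCirc 0 θ)) := by
  have h : Tendsto (fun ε : ℝ => (ε : ℂ)) (𝓝[>] 0) (𝓝 ((0 : ℝ) : ℂ)) :=
    (Complex.continuous_ofReal.tendsto 0).mono_left nhdsWithin_le_nhds
  refine h.div (h.sub (tendsto_circ θ)) ?_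
  rw [circ_radius_zero, Complex.ofReal_zero, zero_sub, neg_ne_zero]
  exact expPi_ne_zero θ

/-- The 2-path itself degenerates at `ε = 0`, where `z` would be `0`, but the formulas for the forms
remain meaningful there, and the limit is simply their value at `0`. -/
theorem tendsto_pathForm (s : ℝ) (i : Fin 3) (r : ℝ) :
    Tendsto (fun ε => pathForm ε s i r) (𝓝[>] 0) (𝓝 (pathForm 0 s i r)) := by
  fin_cases i
  · exact (tendsto_const_nhds.mul (tendsto_logCirc _)).neg
  · exact (tendsto_const_nhds.mul (tendsto_logCirc _)).neg.mul (tendsto_ratioCirc _)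
  · exact tendsto_const_nhds.mul (tendsto_logCirc _)

theorem tendsto_surfFormL (s r : ℝ) :
    Tendsto (fun ε => surfFormL ε s r) (𝓝[>] 0) (𝓝 (surfFormL 0 s r)) := by
  simp only [surfFormL]
  split_ifs
  · exact tendsto_const_nhds
  · exact (tendsto_const_nhds.mul (tendsto_logCirc _)).mul (tendsto_logCirc _)
  · exact tendsto_const_nhds

theorem tendsto_surfFormR (s r : ℝ) :
    Tendsto (fun ε => surfFormR ε s r) (𝓝[>] 0) (𝓝 (surfFormR 0 s r)) :=
  (tendsto_surfFormL s r).mul (tendsto_ratioCirc _)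

theorem eventually_mem_Ioc : ∀ᶠ ε : ℝ in 𝓝[>] 0, 0 < ε ∧ ε ≤ 1 / 4 :=
  Filter.mem_of_superset (Ioc_mem_nhdsGT (by norm_num : (0 : ℝ) < 1 / 4)) fun _ h => h

/-- The coefficient of a pair of words in the surface integral. -/
noncomputable def surfCoeff (Y : ℝ → Fin 3 → ℝ → ℂ) (g : ℝ → ℝ → ℂ) (w w' : List (Fin 3)) : ℂ :=
  ∫ s in (0 : ℝ)..1, ∫ r in (0 : ℝ)..1, iterInt (Y s) w r 1 * g s r * iterInt (Y s) w' 0 r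

theorem measurable_surfIntegrand {Y : ℝ → Fin 3 → ℝ → ℂ} {g : ℝ → ℝ → ℂ}
    (hY : ∀ i, Measurable fun p : ℝ × ℝ => Y p.1 i p.2)
    (hg : Measurable fun p : ℝ × ℝ => g p.1 p.2) (w w' : List (Fin 3)) :
    Measurable fun p : ℝ × ℝ =>
      iterInt (Y p.1) w p.2 1 * g p.1 p.2 * iterInt (Y p.1) w' 0 p.2 :=
  (((measurable_iterInt_param hY w).comp
    (by fun_prop : Measurable fun p : ℝ × ℝ => (p.1, p.2, (1 : ℝ)))).mul hg).mul
    ((measurable_iterInt_param hY w').comp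
      (by fun_prop : Measurable fun p : ℝ × ℝ => (p.1, (0 : ℝ), p.2)))

theorem norm_surfIntegrand_le {Y : Fin 3 → ℝ → ℂ} {g : ℝ → ℂ} {K K' : ℝ}
    (hY : ∀ i r, ‖Y i r‖ ≤ K) (hg : ∀ r, ‖g r‖ ≤ K') (w w' : List (Fin 3)) {r : ℝ}
    (hr : r ∈ Set.uIoc (0 : ℝ) 1) :
    ‖iterInt Y w r 1 * g r * iterInt Y w' 0 r‖ ≤ K ^ w.length * K' * K ^ w'.length := by
  have hK : 0 ≤ K := (norm_nonneg _).trans (hY 0 0)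
  have hK' : 0 ≤ K' := (norm_nonneg _).trans (hg 0)
  rw [Set.uIoc_of_le zero_le_one] at hr
  rw [norm_mul, norm_mul]
  gcongr
  · exact norm_iterInt_le hY w (by rw [abs_of_nonneg] <;> linarith [hr.1, hr.2])
  · exact hg r
  · exact norm_iterInt_le hY w' (by rw [abs_of_nonneg] <;> linarith [hr.1, hr.2])

theorem measurable_inner_integral {f : ℝ × ℝ → ℂ} (hf : Measurable f) :
    Measurable fun s => ∫ r in (0 : ℝ)..1, f (s, r) := by
  simp only [intervalIntegral.integral_of_le zero_le_one]
  exact (hf.stronglyMeasurable.integral_prod_right').measurable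

theorem norm_inner_integral_le {f : ℝ → ℂ} {K : ℝ} (h : ∀ r ∈ Set.uIoc (0 : ℝ) 1, ‖f r‖ ≤ K) :
    ‖∫ r in (0 : ℝ)..1, f r‖ ≤ K := by
  simpa using intervalIntegral.norm_integral_le_of_norm_le_const h

/-- Dominated convergence twice, in `s` and then in `r`, with the same constant. Pointwise in `(s,
r)` the two transports converge by `tendsto_iterInt`. -/
theorem tendsto_surfCoeff {g : ℝ → ℝ → ℝ → ℂ} {K' : ℝ}
    (hg : ∀ ε, Measurable fun p : ℝ × ℝ => g ε p.1 p.2)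
    (hb : ∀ᶠ ε in 𝓝[>] 0, ∀ s r, ‖g ε s r‖ ≤ K')
    (hl : ∀ s r, Tendsto (fun ε => g ε s r) (𝓝[>] 0) (𝓝 (g 0 s r))) (w w' : List (Fin 3)) :
    Tendsto (fun ε => surfCoeff (pathForm ε) (g ε) w w') (𝓝[>] 0)
      (𝓝 (surfCoeff (pathForm 0) (g 0) w w')) := by
  have hbound : ∀ᶠ ε in 𝓝[>] (0 : ℝ), ∀ s, ∀ r ∈ Set.uIoc (0 : ℝ) 1,
      ‖iterInt (pathForm ε s) w r 1 * g ε s r * iterInt (pathForm ε s) w' 0 r‖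
        ≤ 12 ^ w.length * K' * 12 ^ w'.length := by
    filter_upwards [hb, eventually_mem_Ioc] with ε h hε s r hr
    exact norm_surfIntegrand_le (Y := pathForm ε s) (g := g ε s)
      (norm_pathForm_le hε.1.le hε.2 s) (h s) w w' hr
  have hmeas := fun ε => measurable_surfIntegrand (measurable_pathForm ε) (hg ε) w w'
  refine intervalIntegral.tendsto_integral_filter_of_dominated_convergence
    (fun _ => 12 ^ w.length * K' * 12 ^ w'.length) ?_ ?_ intervalIntegrable_const ?_
  · exact Eventually.of_forall fun ε =>
      (measurable_inner_integral (hmeas ε)).aestronglyMeasurable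
  · filter_upwards [hbound] with ε h
    exact Eventually.of_forall fun s _ => norm_inner_integral_le (h s)
  · refine Eventually.of_forall fun s _ => ?_
    refine intervalIntegral.tendsto_integral_filter_of_dominated_convergence
      (fun _ => 12 ^ w.length * K' * 12 ^ w'.length) ?_ ?_ intervalIntegrable_const ?_
    · exact Eventually.of_forall fun ε =>
        ((hmeas ε).comp measurable_prodMk_left).aestronglyMeasurable
    · filter_upwards [hbound] with ε h
      exact Eventually.of_forall fun r hr => h s r hr
    · refine Eventually.of_forall fun r hr => ?_
      rw [Set.uIoc_of_le zero_le_one] at hr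
      have hm : ∀ᶠ ε in 𝓝[>] (0 : ℝ), ∀ i, Measurable (pathForm ε s i) :=
        Eventually.of_forall fun ε => measurable_pathForm_section ε s
      have hk : ∀ᶠ ε in 𝓝[>] (0 : ℝ), ∀ i x, ‖pathForm ε s i x‖ ≤ 12 :=
        eventually_mem_Ioc.mono fun ε hε => norm_pathForm_le hε.1.le hε.2 s
      refine ((tendsto_iterInt hm hk (tendsto_pathForm s) w ?_).mul (hl s r)).mul
        (tendsto_iterInt hm hk (tendsto_pathForm s) w' ?_)
      · rw [abs_of_nonneg] <;> linarith [hr.1, hr.2]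
      · rw [abs_of_nonneg] <;> linarith [hr.1, hr.2]

/-! ### The left congruence as a double series -/

theorem ChCat.c01_c10_c01_c10 {C : Type u} [ChCat.{v} C] {U V W X Y Z : C} (h : ChCat.H0 Y Z)
    (g : ChCat.H0 X Y) (k : ChCat.H1 W X) (f : ChCat.H0 V W) (e : ChCat.H0 U V) :
    ChCat.c01 h (ChCat.c10 (ChCat.c01 g (ChCat.c10 k f)) e)
      = ChCat.c01 (ChCat.c00 h g) (ChCat.c10 k (ChCat.c00 f e)) := by
  rw [ChCat.assoc001, ← ChCat.assoc100, ChCat.assoc010]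

/-! ### Leibniz rules for homotopy components. -/

namespace PsNat

variable {C D E : Type u} [ChCat.{v} C] [ChCat.{v} D] [ChCat.{v} E]

/-- The splitting axiom for `1 = 1 · 1` reads `x = x + x`. This is the base case of the Leibniz rule
for powers of arrows. -/
theorem hpy_one {F G : ChFunctor C D} (ξ : PsNat F G) (U : C) : ξ.hpy U U (ChCat.one U) = 0 := by
  have h := ξ.split (ChCat.one U) (ChCat.one U)
  rwa [ChCat.c00_one, ChFunctor.map_one, ChFunctor.map_one, ChCat.c10_one, ChCat.one_c01,
    left_eq_add] at h

/-- For a fixed arrow `f`, the product of endomorphisms makes `ξ ↦ ξ_f` a derivation with respect to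
the components of `ξ`; this is its power rule, with `j` factors standing to the left of `ξ_f`. -/
theorem hpy_pow {F : ChFunctor C D} (ξ : PsNat F F) (m : ℕ) {U V : C} (f : ChCat.H0 U V) :
    (ξ ^ m).hpy U V f = ∑ j ∈ Finset.range m,
      ChCat.c01 ((ξ ^ j).app V) (ChCat.c10 (ξ.hpy U V f) ((ξ ^ (m - 1 - j)).app U)) := by
  induction m with
  | zero => simp
  | succ m ih =>
    rw [pow_succ', mul_hpy, ih, Finset.sum_range_succ', add_comm, map_sum]
    congr 1
    · refine Finset.sum_congr rfl fun j _ => ?_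
      rw [pow_succ' ξ j, mul_app, ChCat.assoc001, Nat.add_sub_cancel, Nat.sub_sub, Nat.add_comm 1]
    · simp [ChCat.one_c01]

/-- The same power rule in the other variable: the splitting axiom makes `f ↦ ξ_f` a derivation
along `G`, applied here to powers of the arrow `θ_U`. -/
theorem hpy_app_pow {F : ChFunctor C D} {G : ChFunctor D E} (ξ : PsNat G G) (θ : PsNat F F) (n : ℕ)
    (U : C) : ξ.hpy (F.obj U) (F.obj U) ((θ ^ n).app U) = ∑ k ∈ Finset.range n,
      ChCat.c01 (G.map0 ((θ ^ k).app U)) (ChCat.c10 (ξ.hpy (F.obj U) (F.obj U) (θ.app U))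
        (G.map0 ((θ ^ (n - 1 - k)).app U))) := by
  induction n with
  | zero => simpa using ξ.hpy_one (F.obj U)
  | succ n ih =>
    rw [pow_succ', mul_app, split, ih, Finset.sum_range_succ', add_comm, map_sum]
    congr 1
    · refine Finset.sum_congr rfl fun j _ => ?_
      rw [pow_succ' θ j, mul_app, ChFunctor.map_c00, ChCat.assoc001, Nat.add_sub_cancel,
        Nat.sub_sub, Nat.add_comm 1]
    · simp [ChCat.one_c01, ChFunctor.map_one]

theorem post_pow_app {F : ChFunctor C D} (L : ChFunctor D E) (θ : PsNat F F) (n : ℕ) (U : C) :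
    L.map0 ((θ ^ n).app U) = ((θ.post L) ^ n).app U :=
  congrArg (fun x : PsNat (L.comp F) (L.comp F) => x.app U) (map_pow (postHom L F) θ n)

theorem pre_pow_app {F : ChFunctor D E} (L : ChFunctor C D) (ξ : PsNat F F) (n : ℕ) (U : C) :
    (ξ ^ n).app (L.obj U) = ((ξ.pre L) ^ n).app U :=
  congrArg (fun x : PsNat (F.comp L) (F.comp L) => x.app U) (map_pow (preHom F L) ξ n)

/-- The exchanger of powers is a double sum of whiskered exchangers. -/
theorem hpy_pow_app_pow {F : ChFunctor C D} {G : ChFunctor D E} (ξ : PsNat G G) (θ : PsNat F F)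
    (m n : ℕ) (U : C) : (ξ ^ m).hpy (F.obj U) (F.obj U) ((θ ^ n).app U)
      = ∑ j ∈ Finset.range m, ∑ k ∈ Finset.range n,
        ChCat.c01 ((ξ.pre F ^ j * θ.post G ^ k).app U)
          (ChCat.c10 ((Modif.exchanger ξ θ).app U)
            ((θ.post G ^ (n - 1 - k) * ξ.pre F ^ (m - 1 - j)).app U)) := by
  rw [hpy_pow]
  refine Finset.sum_congr rfl fun j _ => ?_
  rw [hpy_app_pow, map_sum, LinearMap.sum_apply, map_sum]
  refine Finset.sum_congr rfl fun k _ => ?_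
  rw [pre_pow_app, pre_pow_app, post_pow_app, post_pow_app]
  exact ChCat.c01_c10_c01_c10 _ _ _ _ _

end PsNat

namespace SymStrictMon

variable {C : Type u} [ChCat.{v} C] (M : SymStrictMon.{v} C) (t : PsNat M.tens M.tens)

/-- The factors `1/m!` and `1/n!` come out by linearity and `hpy_pow_app_pow` expands the rest.
Terms with `m = 0` or `n = 0` are empty sums, so summing over the antidiagonal matches the range `m,
n ≥ 1`; the truncated subtractions are genuine because `j < m` and `k < n`. -/
theorem leftCongruence_app (N : ℕ) (U : (C × C) × C) :
    (M.leftCongruence t N).app U =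
      ∑ p ∈ Finset.HasAntidiagonal.antidiagonal N,
        ((Real.pi * Complex.I : ℂ) ^ (p.1 + p.2) / (p.1.factorial * p.2.factorial)) •
          ∑ j ∈ Finset.range p.1, ∑ k ∈ Finset.range p.2,
            ChCat.c01 ((M.t12_3 t ^ j * M.t12 t ^ k).app U)
              (ChCat.c10 ((M.relL t).app U)
                ((M.t12 t ^ (p.2 - 1 - k) * M.t12_3 t ^ (p.1 - 1 - j)).app U)) := by
  change ∑ p ∈ Finset.HasAntidiagonal.antidiagonal N,
    (PowerSeries.coeff p.1 (fexp ((Real.pi * Complex.I : ℂ) • t))).hpy _ _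
      (((PowerSeries.coeff p.2 (fexp ((Real.pi * Complex.I : ℂ) • t))).boxId
        (ChFunctor.id C)).app U) = _
  refine Finset.sum_congr rfl fun p _ => ?_
  -- `ξ ↦ ξ ⊠ 1` is an algebra homomorphism, so it passes through the powers in the exponential.
  have e : (PowerSeries.coeff p.2 (fexp ((Real.pi * Complex.I : ℂ) • t))).boxId (ChFunctor.id C)
      = ((p.2.factorial : ℂ)⁻¹ * (Real.pi * Complex.I : ℂ) ^ p.2) •
        (t.boxId (ChFunctor.id C)) ^ p.2 := by
    have h := (map_pow (PsNat.boxIdHom M.tens (ChFunctor.id C)) t p.2)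
    have h2 := map_smul (PsNat.boxIdHom M.tens (ChFunctor.id C))
      ((p.2.factorial : ℂ)⁻¹ * (Real.pi * Complex.I : ℂ) ^ p.2) (t ^ p.2)
    rw [h] at h2
    rw [fexp, PowerSeries.coeff_mk, smul_pow, smul_smul]
    exact h2
  rw [e, fexp, PowerSeries.coeff_mk, smul_pow, smul_smul, PsNat.smul_hpy, LinearMap.smul_apply,
    PsNat.smul_app]
  have h := PsNat.hpy_pow_app_pow t (t.boxId (ChFunctor.id C)) p.1 p.2 U
  refine (congrArg _ ((map_smul _ _ _).trans (congrArg _ h))).trans ((smul_smul _ _ _).trans ?_)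
  refine congrArg (· • _) ?_
  rw [pow_add]
  field_simp

end SymStrictMon

/-! ### Limits in the module topology -/

namespace VTendsto

variable {E F : Type*} [AddCommGroup E] [Module ℂ E] [AddCommGroup F] [Module ℂ F]
  {l : Filter ℝ}

theorem congr' {f g : ℝ → E} {x : E} (h : VTendsto f l x) (e : f =ᶠ[l] g) : VTendsto g l x :=
  Filter.Tendsto.congr' e h

theorem add {f g : ℝ → E} {x y : E} (hf : VTendsto f l x) (hg : VTendsto g l y) :
    VTendsto (fun ε => f ε + g ε) l (x + y) := by
  let : TopologicalSpace E := moduleTopology ℂ E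
  have : IsModuleTopology ℂ E := ⟨rfl⟩
  have := IsModuleTopology.toContinuousAdd ℂ E
  exact Tendsto.add hf hg

theorem sum {ι : Type*} (s : Finset ι) {f : ι → ℝ → E} {x : ι → E}
    (h : ∀ i ∈ s, VTendsto (f i) l (x i)) :
    VTendsto (fun ε => ∑ i ∈ s, f i ε) l (∑ i ∈ s, x i) := by
  let : TopologicalSpace E := moduleTopology ℂ E
  have : IsModuleTopology ℂ E := ⟨rfl⟩
  have := IsModuleTopology.toContinuousAdd ℂ E
  exact tendsto_finsetSum s h

theorem smul_const {c : ℝ → ℂ} {c₀ : ℂ} (h : Tendsto c l (𝓝 c₀)) (x : E) :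
    VTendsto (fun ε => c ε • x) l (c₀ • x) := by
  let : TopologicalSpace E := moduleTopology ℂ E
  have : IsModuleTopology ℂ E := ⟨rfl⟩
  have := IsModuleTopology.toContinuousSMul ℂ E
  exact Tendsto.smul_const h x

theorem const (x : E) : VTendsto (fun _ => x) l x := by
  let : TopologicalSpace E := moduleTopology ℂ E
  exact tendsto_const_nhds

theorem map {f : ℝ → E} {x : E} (h : VTendsto f l x) (φ : E →ₗ[ℂ] F) :
    VTendsto (fun ε => φ (f ε)) l (φ x) := by
  let : TopologicalSpace E := moduleTopology ℂ E
  have : IsModuleTopology ℂ E := ⟨rfl⟩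
  let : TopologicalSpace F := moduleTopology ℂ F
  have : IsModuleTopology ℂ F := ⟨rfl⟩
  have := IsModuleTopology.toContinuousAdd ℂ F
  have := IsModuleTopology.toContinuousSMul ℂ F
  exact ((IsModuleTopology.continuous_of_linearMap φ).tendsto x).comp h

end VTendsto

namespace PsNat

variable {C D : Type u} [ChCat.{v} C] [ChCat.{v} D] {F G : ChFunctor C D}

/-- The component at an object, as a linear map. -/
def appLin (U : C) : PsNat F G →ₗ[ℂ] ChCat.H0 (F.obj U) (G.obj U) where
  toFun ξ := ξ.app U
  map_add' _ _ := rfl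
  map_smul' _ _ := rfl

/-- The homotopy component at an arrow, as a linear map. -/
def hpyLin {U V : C} (f : ChCat.H0 U V) : PsNat F G →ₗ[ℂ] ChCat.H1 (F.obj U) (G.obj V) where
  toFun ξ := ξ.hpy U V f
  map_add' _ _ := rfl
  map_smul' _ _ := rfl

/-- The bilinear map `(θ, ξ) ↦ θ_U κ ξ_U`. -/
def sandwich {F : ChFunctor C D} (U : C) (κ : ChCat.H1 (F.obj U) (F.obj U)) :
    PsNat F F →ₗ[ℂ] PsNat F F →ₗ[ℂ] ChCat.H1 (F.obj U) (F.obj U) :=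
  LinearMap.mk₂ ℂ (fun θ ξ => ChCat.c01 (θ.app U) (ChCat.c10 κ (ξ.app U)))
    (fun _ _ _ => by simp) (fun _ _ _ => by simp) (fun _ _ _ => by simp) (fun _ _ _ => by simp)

/-- Components are linear in the endomorphism, and every linear map is continuous for the module
topologies. Convergence in the algebra of endomorphisms thus implies that of all components. -/
theorem psTendsto_of_vtendsto {F : ChFunctor C D} {ξ : ℝ → PowerSeries (PsNat F F)}
    {l : Filter ℝ} {ξ₀ : PowerSeries (PsNat F F)}
    (h : ∀ n, VTendsto (fun ε => PowerSeries.coeff n (ξ ε)) l (PowerSeries.coeff n ξ₀)) :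
    PsTendsto ξ l ξ₀ :=
  fun n => ⟨fun U => (h n).map (appLin U), fun _ _ f => (h n).map (hpyLin f)⟩

end PsNat

/-- The source of a modification is determined by its target and its components, so that its
convergence is automatic. -/
theorem ModTendsto.of_target {C D : Type u} [ChCat.{v} C] [ChCat.{v} D] {F : ChFunctor C D}
    {ξ ξ' : ℝ → PowerSeries (PsNat F F)} {Ξ : ∀ ε : ℝ, FormalModif (ξ ε) (ξ' ε)} {l : Filter ℝ}
    {ξ₀ ξ₀' : PowerSeries (PsNat F F)} {Ξ₀ : FormalModif ξ₀ ξ₀'} (h : PsTendsto ξ' l ξ₀')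
    (hΞ : ∀ (n : ℕ) (U : C), VTendsto (fun ε => (Ξ ε n).app U) l ((Ξ₀ n).app U)) :
    ModTendsto Ξ l Ξ₀ := by
  refine ⟨fun n => ⟨fun U => ?_, fun U V f => ?_⟩, h, hΞ⟩
  · have e : ∀ {η η' : PsNat F F} (X : Modif η η'), η.app U = η'.app U + ChCat.d (X.app U) :=
      fun X => by rw [X.d_app]; abel
    rw [e (Ξ₀ n)]
    simp only [fun ε => e (Ξ ε n)]
    exact ((h n).1 U).add ((hΞ n U).map ChCat.d)
  · have e : ∀ {η η' : PsNat F F} (X : Modif η η'), η.hpy U V f = η'.hpy U V f +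
        (ChCat.c01 (F.map0 f) (X.app U) + (-1 : ℂ) • ChCat.c10.flip (F.map0 f) (X.app V)) := by
      intro η η' X
      have := X.nat f
      rw [LinearMap.flip_apply, neg_one_smul, ← add_assoc, ← this]
      abel
    rw [e (Ξ₀ n)]
    simp only [fun ε => e (Ξ ε n)]
    exact ((h n).2 U V f).add (((hΞ n U).map _).add
      ((hΞ n V).map ((-1 : ℂ) • ChCat.c10.flip (F.map0 f))))

/-! ### The limit connection -/

section LimitConnection

variable {R : Type*} [Ring R] [Algebra ℂ R] (ℓ : Fin 3 → R)

/-- The middle letter has disappeared. Inserting the slopes `(2, 2)`, `(-2, 0)`, `(2, 2)` of the two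
angles gives the constants `2πi(ℓ₂ - ℓ₀)`, `2πi ℓ₀`, `2πi(ℓ₂ - ℓ₀)` on the three pieces. -/
theorem connAt_pathForm_zero (s x : ℝ) : connAt (pathForm 0 s) ℓ x
    = (Real.pi * Complex.I * slopeV s x : ℂ) • ℓ 2 - (Real.pi * Complex.I * slopeZ s x : ℂ) • ℓ 0 := by
  have e0 : pathForm 0 s 0 x = -(Real.pi * Complex.I * slopeZ s x) := by
    change -(_ * _) = _
    rw [logCirc_radius_zero]; ring
  have e1 : pathForm 0 s 1 x = 0 := by
    change -(_ * _) * _ = _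
    rw [ratioCirc_radius_zero, mul_zero]
  have e2 : pathForm 0 s 2 x = Real.pi * Complex.I * slopeV s x := by
    change _ * _ = _
    rw [logCirc_radius_zero]; ring
  rw [connAt, Fin.sum_univ_three, e0, e1, e2]
  module

theorem wordSum_limit_outer {s u w : ℝ} (huw : u ≤ w) (h1 : w - u ≤ 1)
    (h : w ≤ (1 - s) / 2 ∨ 1 - s / 2 ≤ u) (n : ℕ) :
    wordSum (pathForm 0 s) ℓ n u w = ((Real.pi * Complex.I * (2 * (w - u))) ^ n / n.factorial : ℂ) •
      (ℓ 2 - ℓ 0) ^ n := by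
  rw [wordSum_const (fun i => measurable_pathForm_section 0 s i)
    (norm_pathForm_le le_rfl (by norm_num) s) (X := (2 * (Real.pi * Complex.I) : ℂ) • (ℓ 2 - ℓ 0))
    n huw h1, smul_pow, smul_smul]
  · congr 1
    rw [div_mul_eq_mul_div, ← mul_pow]
    push_cast
    ring
  · intro x hx
    have e : slopeZ s x = 2 ∧ slopeV s x = 2 := by
      rw [slopeZ, slopeV]
      rcases h with h | h
      · rw [if_pos (by linarith [hx.2]), if_pos (by linarith [hx.2])]; exact ⟨rfl, rfl⟩
      · have n1 : ¬ x ≤ (1 - s) / 2 := by linarith [hx.1]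
        have n2 : ¬ x ≤ 1 - s / 2 := by linarith [hx.1]
        rw [if_neg n1, if_neg n2, if_neg n1, if_neg n2]; exact ⟨rfl, rfl⟩
    rw [connAt_pathForm_zero, e.1, e.2]
    push_cast
    module

theorem wordSum_limit_middle {s u w : ℝ} (huw : u ≤ w) (h1 : w - u ≤ 1)
    (hu : (1 - s) / 2 ≤ u) (hw : w ≤ 1 - s / 2) (n : ℕ) :
    wordSum (pathForm 0 s) ℓ n u w = ((Real.pi * Complex.I * (2 * (w - u))) ^ n / n.factorial : ℂ) •
      ℓ 0 ^ n := by
  rw [wordSum_const (fun i => measurable_pathForm_section 0 s i)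
    (norm_pathForm_le le_rfl (by norm_num) s) (X := (2 * (Real.pi * Complex.I) : ℂ) • ℓ 0)
    n huw h1, smul_pow, smul_smul]
  · congr 1
    rw [div_mul_eq_mul_div, ← mul_pow]
    push_cast
    ring
  · intro x hx
    have n1 : ¬ x ≤ (1 - s) / 2 := by linarith [hx.1]
    have n2 : x ≤ 1 - s / 2 := by linarith [hx.2]
    rw [connAt_pathForm_zero, slopeZ, slopeV, if_neg n1, if_neg n1, if_pos n2, if_pos n2]
    push_cast
    module

/-- The limit transport from the middle part to the end of a cross-section. -/
theorem wordSum_limit_end {s r : ℝ} (hs : s ∈ Set.Icc (0 : ℝ) 1) (hr : (1 - s) / 2 ≤ r)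
    (hr' : r ≤ 1 - s / 2) (n : ℕ) : wordSum (pathForm 0 s) ℓ n r 1
      = ∑ q ∈ Finset.HasAntidiagonal.antidiagonal n,
        ((Real.pi * Complex.I) ^ (q.1 + q.2) * (s : ℂ) ^ q.1 * (2 - s - 2 * r : ℂ) ^ q.2 /
          (q.1.factorial * q.2.factorial)) • ((ℓ 2 - ℓ 0) ^ q.1 * ℓ 0 ^ q.2) := by
  obtain ⟨h0, h1⟩ := hs
  rw [wordSum_mul (fun i => measurable_pathForm_section 0 s i)
    (norm_pathForm_le le_rfl (by norm_num) s) ℓ hr' n (by linarith) (by linarith)]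
  refine Finset.sum_congr rfl fun q _ => ?_
  rw [wordSum_limit_outer ℓ (by linarith) (by linarith) (Or.inr le_rfl),
    wordSum_limit_middle ℓ hr' (by linarith) hr le_rfl, smul_mul_smul_comm]
  congr 1
  have e1 : (2 : ℂ) * ((1 : ℝ) - (1 - s / 2 : ℝ)) = s := by push_cast; ring
  have e2 : (2 : ℂ) * ((1 - s / 2 : ℝ) - r) = 2 - s - 2 * r := by push_cast; ring
  rw [e1, e2, mul_pow (Real.pi * Complex.I : ℂ), mul_pow (Real.pi * Complex.I : ℂ), pow_add]
  ring

/-- The limit transport from the start of a cross-section to the middle part. -/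
theorem wordSum_limit_start {s r : ℝ} (hs : s ∈ Set.Icc (0 : ℝ) 1) (hr : (1 - s) / 2 ≤ r)
    (hr' : r ≤ 1 - s / 2) (n : ℕ) : wordSum (pathForm 0 s) ℓ n 0 r
      = ∑ q ∈ Finset.HasAntidiagonal.antidiagonal n,
        ((Real.pi * Complex.I) ^ (q.1 + q.2) * (2 * r + s - 1 : ℂ) ^ q.1 * (1 - s : ℂ) ^ q.2 /
          (q.1.factorial * q.2.factorial)) • (ℓ 0 ^ q.1 * (ℓ 2 - ℓ 0) ^ q.2) := by
  obtain ⟨h0, h1⟩ := hs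
  rw [wordSum_mul (fun i => measurable_pathForm_section 0 s i)
    (norm_pathForm_le le_rfl (by norm_num) s) ℓ (b := (1 - s) / 2) (by linarith) n hr
    (by linarith)]
  refine Finset.sum_congr rfl fun q _ => ?_
  rw [wordSum_limit_outer ℓ (by linarith) (by linarith) (Or.inl le_rfl),
    wordSum_limit_middle ℓ hr (by linarith) le_rfl hr', smul_mul_smul_comm]
  congr 1
  have e1 : (2 : ℂ) * (r - ((1 - s) / 2 : ℝ)) = 2 * r + s - 1 := by push_cast; ring
  have e2 : (2 : ℂ) * (((1 - s) / 2 : ℝ) - (0 : ℝ)) = 1 - s := by push_cast; ring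
  rw [e1, e2, mul_pow (Real.pi * Complex.I : ℂ), mul_pow (Real.pi * Complex.I : ℂ), pow_add]
  ring

end LimitConnection

/-! ### Integrals -/

theorem integral_pow_mul_one_sub_pow (m n : ℕ) :
    ∫ x in (0 : ℝ)..1, (x : ℂ) ^ m * (1 - x : ℂ) ^ n
      = m.factorial * n.factorial / (m + n + 1).factorial := by
  have h := Complex.betaIntegral_eq_Gamma_mul_div (m + 1) (n + 1)
    (by simp; positivity) (by simp; positivity)
  have e : (m + 1 + (n + 1) : ℂ) = ((m + n + 1 : ℕ) : ℂ) + 1 := by push_cast; ring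
  rw [e, Complex.Gamma_nat_eq_factorial, Complex.Gamma_nat_eq_factorial,
    Complex.Gamma_nat_eq_factorial, Complex.betaIntegral] at h
  rw [← h]
  simp

/-- The double integral over the unit square. -/
noncomputable def squareInt (f : ℝ → ℝ → ℂ) : ℂ := ∫ s in (0 : ℝ)..1, ∫ r in (0 : ℝ)..1, f s r

/-- Measurable functions which are bounded on the unit square. -/
def SquareBounded (f : ℝ → ℝ → ℂ) : Prop :=
  (Measurable fun p : ℝ × ℝ => f p.1 p.2) ∧
    ∃ K : ℝ, ∀ s ∈ Set.uIoc (0 : ℝ) 1, ∀ r ∈ Set.uIoc (0 : ℝ) 1, ‖f s r‖ ≤ K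

theorem squareInt_sum {κ : Type*} (S : Finset κ) {f : κ → ℝ → ℝ → ℂ}
    (h : ∀ i ∈ S, SquareBounded (f i)) :
    squareInt (fun s r => ∑ i ∈ S, f i s r) = ∑ i ∈ S, squareInt (f i) := by
  have h1 : ∀ s ∈ Set.uIoc (0 : ℝ) 1, ∫ r in (0 : ℝ)..1, ∑ i ∈ S, f i s r
      = ∑ i ∈ S, ∫ r in (0 : ℝ)..1, f i s r := by
    intro s hs
    refine intervalIntegral.integral_finsetSum fun i hi => ?_
    obtain ⟨hm, K, hK⟩ := h i hi
    exact intervalIntegrable_of_bound (hm.comp measurable_prodMk_left) (hK s hs)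
  rw [squareInt, intervalIntegral.integral_congr_ae (Eventually.of_forall h1),
    intervalIntegral.integral_finsetSum]
  · rfl
  · intro i hi
    obtain ⟨hm, K, hK⟩ := h i hi
    exact intervalIntegrable_of_bound (measurable_inner_integral hm)
      fun s hs => norm_inner_integral_le (hK s hs)

theorem squareInt_mul_const (f : ℝ → ℝ → ℂ) (c : ℂ) :
    squareInt (fun s r => f s r * c) = squareInt f * c := by
  simp only [squareInt, intervalIntegral.integral_mul_const]

theorem SquareBounded.sum {κ : Type*} (S : Finset κ) {f : κ → ℝ → ℝ → ℂ}
    (h : ∀ i ∈ S, SquareBounded (f i)) : SquareBounded fun s r => ∑ i ∈ S, f i s r := by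
  choose! hm K hK using h
  refine ⟨Finset.measurable_fun_sum _ hm, ∑ i ∈ S, K i, fun s hs r hr => ?_⟩
  exact (norm_sum_le _ _).trans (Finset.sum_le_sum fun i hi => hK i hi s hs r hr)

theorem SquareBounded.mul_const {f : ℝ → ℝ → ℂ} (h : SquareBounded f) (c : ℂ) :
    SquareBounded fun s r => f s r * c := by
  obtain ⟨hm, K, hK⟩ := h
  refine ⟨hm.mul_const c, K * ‖c‖, fun s hs r hr => ?_⟩
  rw [norm_mul]
  exact mul_le_mul_of_nonneg_right (hK s hs r hr) (norm_nonneg c)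

theorem squareInt_congr {f g : ℝ → ℝ → ℂ}
    (h : ∀ s ∈ Set.Icc (0 : ℝ) 1, ∀ r ∈ Set.Icc (0 : ℝ) 1, f s r = g s r) :
    squareInt f = squareInt g := by
  refine intervalIntegral.integral_congr fun s hs => intervalIntegral.integral_congr fun r hr => ?_
  rw [Set.uIcc_of_le zero_le_one] at hs hr
  exact h s hs r hr

/-- The scalar integrands of the limit of the surface integral. -/
noncomputable def bandMonomial (j k k' j' : ℕ) (s r : ℝ) : ℂ :=
  if r ≤ (1 - s) / 2 then 0 else if r ≤ 1 - s / 2 then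
    2 * ((s : ℂ) ^ j * (1 - s : ℂ) ^ j') * ((2 * r + s - 1 : ℂ) ^ k' * (2 - s - 2 * r : ℂ) ^ k)
  else 0

theorem squareBounded_bandMonomial (j k k' j' : ℕ) : SquareBounded (bandMonomial j k k' j') := by
  refine ⟨measurable_ite_lines measurable_const (by fun_prop) measurable_const, 2,
    fun s hs r hr => ?_⟩
  rw [Set.uIoc_of_le zero_le_one] at hs hr
  rw [bandMonomial]
  split_ifs with h1 h2
  · simp
  · have b : ∀ x : ℝ, 0 ≤ x → x ≤ 1 → ∀ n : ℕ, ‖((x : ℝ) : ℂ) ^ n‖ ≤ 1 := fun x h h' n => by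
      rw [norm_pow, Complex.norm_real, Real.norm_of_nonneg h]
      exact pow_le_one₀ h h'
    have b1 := b s hs.1.le hs.2 j
    have b2 := b (1 - s) (by linarith [hs.2]) (by linarith [hs.1]) j'
    have b3 := b (2 * r + s - 1) (by linarith) (by linarith) k'
    have b4 := b (2 - s - 2 * r) (by linarith) (by linarith) k
    push_cast at b2 b3 b4
    rw [norm_mul, norm_mul, norm_mul, norm_mul, Complex.norm_ofNat]
    have c1 := mul_le_one₀ b1 (norm_nonneg _) b2
    have c2 := mul_le_one₀ b3 (norm_nonneg _) b4
    have c3 := mul_le_one₀ c1 (by positivity) c2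
    linarith
  · simp

/-- For fixed `s` the substitution `x = 2r + s - 1` carries the band onto `[0, 1]`, and its Jacobian
`1/2` cancels the `2` in `bandMonomial`. The integral then factors into a Beta integral in `s` and
one in `x`. -/
theorem squareInt_bandMonomial (j k k' j' : ℕ) : squareInt (bandMonomial j k k' j')
    = (j.factorial * j'.factorial / (j + j' + 1).factorial) *
      (k.factorial * k'.factorial / (k + k' + 1).factorial) := by
  have inner : ∀ s ∈ Set.uIcc (0 : ℝ) 1, ∫ r in (0 : ℝ)..1, bandMonomial j k k' j' s r
      = ((s : ℂ) ^ j * (1 - s : ℂ) ^ j') *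
        (k'.factorial * k.factorial / (k' + k + 1).factorial) := by
    intro s hs
    rw [Set.uIcc_of_le zero_le_one] at hs
    set F : ℝ → ℂ := fun x => (x : ℂ) ^ k' * (1 - x : ℂ) ^ k with hF
    -- As an indicator, the integrand lets the domain shrink from `(0, 1]` to the band; its section
    -- is contained in `(0, 1]` because `s ∈ [0, 1]`.
    have e1 : bandMonomial j k k' j' s = (Set.Ioc ((1 - s) / 2) (1 - s / 2)).indicator
        fun r => 2 * ((s : ℂ) ^ j * (1 - s : ℂ) ^ j') * F (2 * r + (s - 1)) := by
      funext r
      rw [bandMonomial, Set.indicator, hF]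
      by_cases h1 : r ≤ (1 - s) / 2
      · rw [if_pos h1, if_neg fun h => h1.not_gt h.1]
      by_cases h2 : r ≤ 1 - s / 2
      · rw [if_neg h1, if_pos h2, if_pos ⟨not_le.1 h1, h2⟩]
        push_cast
        ring_nf
      · rw [if_neg h1, if_neg h2, if_neg fun h => h2 h.2]
    have hsub : Set.Ioc (0 : ℝ) 1 ∩ Set.Ioc ((1 - s) / 2) (1 - s / 2)
        = Set.Ioc ((1 - s) / 2) (1 - s / 2) := by
      refine Set.inter_eq_right.2 fun x hx => ⟨?_, ?_⟩ <;> linarith [hx.1, hx.2, hs.1, hs.2]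
    rw [e1, intervalIntegral.integral_of_le zero_le_one, setIntegral_indicator measurableSet_Ioc,
      hsub, ← intervalIntegral.integral_of_le (by linarith), intervalIntegral.integral_const_mul,
      intervalIntegral.integral_comp_mul_add F two_ne_zero]
    have e2 : 2 * ((1 - s) / 2) + (s - 1) = 0 := by ring
    have e3 : 2 * (1 - s / 2) + (s - 1) = 1 := by ring
    rw [e2, e3, hF, integral_pow_mul_one_sub_pow, Complex.real_smul]
    push_cast
    ring
  rw [squareInt, intervalIntegral.integral_congr inner, intervalIntegral.integral_mul_const,
    integral_pow_mul_one_sub_pow, add_comm k' k]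
  ring

/-! ### Reindexing -/

/-- Of the factors around `L`, `j` and `j'` count the `t₍₁₂₎₃` on the left and right, `k` and `k'`
the `t₁₂`. The surface integral groups them by side, `(j + k, k' + j')`; the double series groups
them by kind, `m = j + j' + 1` and `n = k + k' + 1`. The shift by `2` is the degree of `L` in `ħ`.
-/
theorem sum_antidiagonal_reindex {E : Type*} [AddCommMonoid E] (f : ℕ → ℕ → ℕ → ℕ → E) (n : ℕ) :
    ∑ p ∈ Finset.HasAntidiagonal.antidiagonal n,
      ∑ q ∈ Finset.HasAntidiagonal.antidiagonal p.1,
        ∑ q' ∈ Finset.HasAntidiagonal.antidiagonal p.2, f q.1 q.2 q'.1 q'.2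
    = ∑ p ∈ Finset.HasAntidiagonal.antidiagonal (n + 2), ∑ j ∈ Finset.range p.1,
        ∑ k ∈ Finset.range p.2, f j k (p.2 - 1 - k) (p.1 - 1 - j) := by
  simp only [Finset.sum_sigma']
  refine Finset.sum_nbij'
    (fun x => ⟨(x.2.1.1 + x.2.2.2 + 1, x.2.1.2 + x.2.2.1 + 1), ⟨x.2.1.1, x.2.1.2⟩⟩)
    (fun x => ⟨(x.2.1 + x.2.2, x.1.2 - 1 - x.2.2 + (x.1.1 - 1 - x.2.1)),
      ⟨(x.2.1, x.2.2), (x.1.2 - 1 - x.2.2, x.1.1 - 1 - x.2.1)⟩⟩) ?_ ?_ ?_ ?_ ?_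
  · rintro ⟨⟨p1, p2⟩, ⟨⟨a, b⟩, ⟨c, d⟩⟩⟩ h
    simp only [Finset.mem_sigma, Finset.HasAntidiagonal.mem_antidiagonal, Finset.mem_range] at h ⊢
    omega
  · rintro ⟨⟨p1, p2⟩, ⟨a, b⟩⟩ h
    simp only [Finset.mem_sigma, Finset.HasAntidiagonal.mem_antidiagonal, Finset.mem_range] at h ⊢
    refine ⟨?_, trivial, trivial⟩; omega
  · rintro ⟨⟨p1, p2⟩, ⟨⟨a, b⟩, ⟨c, d⟩⟩⟩ h
    simp only [Finset.mem_sigma, Finset.HasAntidiagonal.mem_antidiagonal] at h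
    obtain ⟨h1, rfl, rfl⟩ := h
    have e1 : b + c + 1 - 1 - b = c := by omega
    have e2 : a + d + 1 - 1 - a = d := by omega
    simp only [e1, e2]
  · rintro ⟨⟨p1, p2⟩, ⟨a, b⟩⟩ h
    simp only [Finset.mem_sigma, Finset.HasAntidiagonal.mem_antidiagonal, Finset.mem_range] at h
    have e1 : a + (p1 - 1 - a) + 1 = p1 := by omega
    have e2 : b + (p2 - 1 - b) + 1 = p2 := by omega
    simp only [e1, e2]
  · rintro ⟨⟨p1, p2⟩, ⟨⟨a, b⟩, ⟨c, d⟩⟩⟩ h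
    have e1 : b + c + 1 - 1 - b = c := by omega
    have e2 : a + d + 1 - 1 - a = d := by omega
    simp only [e1, e2]

/-! ### The limit of the surface integral -/

section SurfaceLimit

theorem squareInt_sum₃ {κ : Type*} {κ₁ κ₂ : κ → Type*} {S : Finset κ} {T : ∀ i, Finset (κ₁ i)}
    {V : ∀ i, Finset (κ₂ i)} {f : ∀ i, κ₁ i → κ₂ i → ℝ → ℝ → ℂ}
    (h : ∀ i j k, SquareBounded (f i j k)) :
    squareInt (fun s r => ∑ i ∈ S, ∑ j ∈ T i, ∑ k ∈ V i, f i j k s r)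
      = ∑ i ∈ S, ∑ j ∈ T i, ∑ k ∈ V i, squareInt (f i j k) := by
  rw [squareInt_sum S fun i _ => SquareBounded.sum _ fun j _ => SquareBounded.sum _ fun k _ =>
    h i j k]
  refine Finset.sum_congr rfl fun i _ => ?_
  rw [squareInt_sum (T i) fun j _ => SquareBounded.sum _ fun k _ => h i j k]
  exact Finset.sum_congr rfl fun j _ => squareInt_sum _ fun k _ => h i j k

theorem surfFormL_zero_middle {s r : ℝ} (h : ¬ r ≤ (1 - s) / 2) (h' : r ≤ 1 - s / 2) :
    surfFormL 0 s r = 2 * (Real.pi * Complex.I) ^ 2 := by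
  rw [surfFormL, if_neg h, if_pos h', logCirc_radius_zero, logCirc_radius_zero]
  ring

theorem squareBounded_surfIntegrand (w w' : List (Fin 3)) : SquareBounded fun s r =>
    iterInt (pathForm 0 s) w r 1 * surfFormL 0 s r * iterInt (pathForm 0 s) w' 0 r :=
  ⟨measurable_surfIntegrand (measurable_pathForm 0) (measurable_surfFormL 0) w w', _,
    fun s _ _ hr => norm_surfIntegrand_le (Y := pathForm 0 s) (g := surfFormL 0 s)
      (norm_pathForm_le le_rfl (by norm_num) s) (norm_surfFormL_le le_rfl (by norm_num) s) w w' hr⟩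

variable {R E : Type*} [Ring R] [Algebra ℂ R] [AddCommGroup E] [Module ℂ E] (ℓ : Fin 3 → R)

/-- Bilinearity resums the words on either side of the relator into two transports; `Φ` stands for
insertion of the relator between them followed by a linear functional. -/
theorem sum_words_eq_wordSum (Φ : R →ₗ[ℂ] R →ₗ[ℂ] ℂ) (Y : Fin 3 → ℝ → ℂ) (m n : ℕ) (g : ℂ)
    (a b c d : ℝ) : ∑ w : Fin m → Fin 3, ∑ w' : Fin n → Fin 3,
      (iterInt Y (List.ofFn w) a b * g * iterInt Y (List.ofFn w') c d) *
        Φ (List.ofFn fun i => ℓ (w i)).prod (List.ofFn fun i => ℓ (w' i)).prod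
      = g * Φ (wordSum Y ℓ m a b) (wordSum Y ℓ n c d) := by
  simp only [wordSum, map_sum, LinearMap.sum_apply, map_smul, LinearMap.smul_apply, smul_eq_mul,
    Finset.mul_sum]
  rw [Finset.sum_comm]
  refine Finset.sum_congr rfl fun _ _ => Finset.sum_congr rfl fun _ _ => ?_
  ring

/-- On the band both transports are products of two exponentials by `wordSum_limit_end` and
`wordSum_limit_start`, and their expansion gives the monomials. Off the band both sides vanish, so
`r` is unrestricted. -/
theorem surfIntegrand_limit (Φ : R →ₗ[ℂ] R →ₗ[ℂ] ℂ) {s r : ℝ} (hs : s ∈ Set.Icc (0 : ℝ) 1)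
    (m n : ℕ) : surfFormL 0 s r *
        Φ (wordSum (pathForm 0 s) ℓ m r 1) (wordSum (pathForm 0 s) ℓ n 0 r)
      = ∑ q ∈ Finset.HasAntidiagonal.antidiagonal m, ∑ q' ∈ Finset.HasAntidiagonal.antidiagonal n,
        bandMonomial q.1 q.2 q'.1 q'.2 s r *
          ((Real.pi * Complex.I) ^ (q.1 + q.2 + q'.1 + q'.2 + 2) /
            (q.1.factorial * q.2.factorial * (q'.1.factorial * q'.2.factorial)) *
            Φ ((ℓ 2 - ℓ 0) ^ q.1 * ℓ 0 ^ q.2) (ℓ 0 ^ q'.1 * (ℓ 2 - ℓ 0) ^ q'.2)) := by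
  by_cases h1 : r ≤ (1 - s) / 2
  · simp [surfFormL, bandMonomial, h1]
  by_cases h2 : r ≤ 1 - s / 2
  · rw [surfFormL_zero_middle h1 h2, wordSum_limit_end ℓ hs (not_le.1 h1).le h2,
      wordSum_limit_start ℓ hs (not_le.1 h1).le h2]
    simp only [bandMonomial, if_neg h1, if_pos h2, map_sum, LinearMap.sum_apply, map_smul,
      LinearMap.smul_apply, smul_eq_mul, Finset.mul_sum]
    rw [Finset.sum_comm]
    refine Finset.sum_congr rfl fun q _ => Finset.sum_congr rfl fun q' _ => ?_
    simp only [pow_add]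
    ring
  · simp [surfFormL, bandMonomial, h1, h2]

theorem sum_surfCoeff_limit (Φ : R →ₗ[ℂ] R →ₗ[ℂ] E) (n : ℕ) :
    ∑ p ∈ Finset.HasAntidiagonal.antidiagonal n, ∑ w : Fin p.1 → Fin 3, ∑ w' : Fin p.2 → Fin 3,
      surfCoeff (pathForm 0) (surfFormL 0) (List.ofFn w) (List.ofFn w') •
        Φ (List.ofFn fun i => ℓ (w i)).prod (List.ofFn fun i => ℓ (w' i)).prod
    = ∑ p ∈ Finset.HasAntidiagonal.antidiagonal n,
      ∑ q ∈ Finset.HasAntidiagonal.antidiagonal p.1,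
        ∑ q' ∈ Finset.HasAntidiagonal.antidiagonal p.2,
          ((Real.pi * Complex.I : ℂ) ^ (q.1 + q.2 + q'.1 + q'.2 + 2) /
            ((q.1 + q'.2 + 1).factorial * (q.2 + q'.1 + 1).factorial)) •
            Φ ((ℓ 2 - ℓ 0) ^ q.1 * ℓ 0 ^ q.2) (ℓ 0 ^ q'.1 * (ℓ 2 - ℓ 0) ^ q'.2) := by
  -- A linear functional turns the identity in `E` into one between scalar double integrals.
  rw [← sub_eq_zero, ← Module.forall_dual_apply_eq_zero_iff ℂ]
  intro φ
  rw [map_sub, sub_eq_zero]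
  simp only [map_sum, map_smul, smul_eq_mul]
  set Ψ : R →ₗ[ℂ] R →ₗ[ℂ] ℂ := Φ.compr₂ φ with hΨ
  have hφ : ∀ x y, φ (Φ x y) = Ψ x y := fun _ _ => rfl
  simp only [hφ]
  have el : ∀ w w' : List (Fin 3), surfCoeff (pathForm 0) (surfFormL 0) w w' = squareInt
      fun s r => iterInt (pathForm 0 s) w r 1 * surfFormL 0 s r * iterInt (pathForm 0 s) w' 0 r :=
    fun _ _ => rfl
  -- The Beta values are read backwards: each coefficient on the right is written as a double
  -- integral, after which the two sides are integrals of functions that agree pointwise on the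
  -- square.
  have er : ∀ (j k k' j' : ℕ) (x : ℂ), (Real.pi * Complex.I : ℂ) ^ (j + k + k' + j' + 2) /
      ((j + j' + 1).factorial * (k + k' + 1).factorial) * x
      = squareInt (fun s r => bandMonomial j k k' j' s r *
        ((Real.pi * Complex.I) ^ (j + k + k' + j' + 2) /
            (j.factorial * k.factorial * (k'.factorial * j'.factorial)) * x)) := by
    intro j k k' j' x
    have f1 : (j.factorial : ℂ) ≠ 0 := Nat.cast_ne_zero.2 j.factorial_ne_zero
    have f2 : (k.factorial : ℂ) ≠ 0 := Nat.cast_ne_zero.2 k.factorial_ne_zero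
    have f3 : (k'.factorial : ℂ) ≠ 0 := Nat.cast_ne_zero.2 k'.factorial_ne_zero
    have f4 : (j'.factorial : ℂ) ≠ 0 := Nat.cast_ne_zero.2 j'.factorial_ne_zero
    rw [squareInt_mul_const, squareInt_bandMonomial]
    generalize (Real.pi * Complex.I : ℂ) ^ (j + k + k' + j' + 2) = z
    field_simp
  simp only [el, er, ← squareInt_mul_const]
  rw [← squareInt_sum₃ (T := fun _ => Finset.univ) (V := fun _ => Finset.univ)
      (f := fun (p : ℕ × ℕ) (w : Fin p.1 → Fin 3) (w' : Fin p.2 → Fin 3) s r =>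
        (iterInt (pathForm 0 s) (List.ofFn w) r 1 * surfFormL 0 s r *
          iterInt (pathForm 0 s) (List.ofFn w') 0 r) *
          Ψ (List.ofFn fun i => ℓ (w i)).prod (List.ofFn fun i => ℓ (w' i)).prod)
      fun _ w w' => (squareBounded_surfIntegrand _ _).mul_const _,
    ← squareInt_sum₃ (T := fun p : ℕ × ℕ => Finset.HasAntidiagonal.antidiagonal p.1)
      (V := fun p : ℕ × ℕ => Finset.HasAntidiagonal.antidiagonal p.2)
      (f := fun (_ : ℕ × ℕ) (q q' : ℕ × ℕ) s r => bandMonomial q.1 q.2 q'.1 q'.2 s r *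
          ((Real.pi * Complex.I) ^ (q.1 + q.2 + q'.1 + q'.2 + 2) /
            (q.1.factorial * q.2.factorial * (q'.1.factorial * q'.2.factorial)) *
            Ψ ((ℓ 2 - ℓ 0) ^ q.1 * ℓ 0 ^ q.2) (ℓ 0 ^ q'.1 * (ℓ 2 - ℓ 0) ^ q'.2)))
      fun _ q q' => (squareBounded_bandMonomial _ _ _ _).mul_const _]
  refine squareInt_congr fun s hs r _ => Finset.sum_congr rfl fun p _ => ?_
  rw [sum_words_eq_wordSum ℓ Ψ, surfIntegrand_limit ℓ Ψ hs]

end SurfaceLimit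

/-! ### Convergence of the transport and of the surface integral. -/

namespace SymStrictMon

variable {C : Type u} [ChCat.{v} C] (M : SymStrictMon.{v} C) (t : PsNat M.tens M.tens)

/-- Strictness enters the limit here: it identifies the constant limit connection on the outer
pieces with `2πi t₍₁₂₎₃`. -/
theorem IsStrict.letter_two_sub_letter_zero {M : SymStrictMon.{v} C} {t : PsNat M.tens M.tens}
    (ht : M.IsStrict t) : M.letter t 2 - M.letter t 0 = M.t12_3 t := by
  change M.t12 t + M.t23 t + M.t13 t - M.t12 t = _
  rw [ht.left]
  abel

/-- The formula for the homotopy component of the left congruence, by degrees of the four factors. -/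
theorem leftCongruence_app_add_two (n : ℕ) (U : (C × C) × C) :
    (M.leftCongruence t (n + 2)).app U
      = ∑ p ∈ Finset.HasAntidiagonal.antidiagonal n,
        ∑ q ∈ Finset.HasAntidiagonal.antidiagonal p.1,
          ∑ q' ∈ Finset.HasAntidiagonal.antidiagonal p.2,
            ((Real.pi * Complex.I : ℂ) ^ (q.1 + q.2 + q'.1 + q'.2 + 2) /
              ((q.1 + q'.2 + 1).factorial * (q.2 + q'.1 + 1).factorial)) •
              PsNat.sandwich U ((M.relL t).app U) (M.t12_3 t ^ q.1 * M.t12 t ^ q.2)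
                (M.t12 t ^ q'.1 * M.t12_3 t ^ q'.2) := by
  rw [leftCongruence_app, sum_antidiagonal_reindex (fun j k k' j' =>
    ((Real.pi * Complex.I : ℂ) ^ (j + k + k' + j' + 2) /
      ((j + j' + 1).factorial * (k + k' + 1).factorial)) •
      PsNat.sandwich U ((M.relL t).app U) (M.t12_3 t ^ j * M.t12 t ^ k)
        (M.t12 t ^ k' * M.t12_3 t ^ j'))]
  refine Finset.sum_congr rfl fun p _ => ?_
  rw [Finset.smul_sum]
  refine Finset.sum_congr rfl fun j hj => ?_
  rw [Finset.smul_sum]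
  refine Finset.sum_congr rfl fun k hk => ?_
  rw [Finset.mem_range] at hj hk
  have e1 : j + k + (p.2 - 1 - k) + (p.1 - 1 - j) + 2 = p.1 + p.2 := by omega
  have e2 : j + (p.1 - 1 - j) + 1 = p.1 := by omega
  have e3 : k + (p.2 - 1 - k) + 1 = p.2 := by omega
  rw [e1, e2, e3]
  rfl

theorem coeff_transport_pathL {ε : ℝ} (h0 : 0 < ε) (h1 : ε < 1 / 2) {a : ℂ} (ha : a ≠ 0) (n : ℕ) :
    PowerSeries.coeff n (M.transport t (pathL ε a 1) 0 1)
      = wordSum (pathForm ε 1) (M.letter t) n 0 1 := by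
  rw [transport, PowerSeries.coeff_mk, wordSum]
  simp only [iterInt_connForm_pathL h0 h1 ha]
  rfl

theorem surfCoeff_pathL {ε : ℝ} (h0 : 0 < ε) (h1 : ε < 1 / 2) {a : ℂ} (ha : a ≠ 0)
    (w w' : List (Fin 3)) :
    ((∫ s in (0 : ℝ)..1, ∫ r in (0 : ℝ)..1, iterInt (connForm (pathL ε a s)) w r 1 *
        formL (pathL ε a) s r * iterInt (connForm (pathL ε a s)) w' 0 r)
      = surfCoeff (pathForm ε) (surfFormL ε) w w') ∧
    ((∫ s in (0 : ℝ)..1, ∫ r in (0 : ℝ)..1, iterInt (connForm (pathL ε a s)) w r 1 *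
        formR (pathL ε a) s r * iterInt (connForm (pathL ε a s)) w' 0 r)
      = surfCoeff (pathForm ε) (surfFormR ε) w w') := by
  simp only [iterInt_connForm_pathL h0 h1 ha]
  constructor
  · refine intervalIntegral.integral_congr fun s _ => intervalIntegral.integral_congr_ae ?_
    filter_upwards [ae_generic s] with r hr _
    rw [(surfForm_pathL h0 h1 ha hr.1 hr.2).1]
  · refine intervalIntegral.integral_congr fun s _ => intervalIntegral.integral_congr_ae ?_
    filter_upwards [ae_generic s] with r hr _
    rw [(surfForm_pathL h0 h1 ha hr.1 hr.2).2]

theorem vtendsto_transport_pathL {M : SymStrictMon.{v} C} {t : PsNat M.tens M.tens}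
    (ht : M.IsStrict t) {a : ℂ} (ha : a ≠ 0) (n : ℕ) :
    VTendsto (fun ε => PowerSeries.coeff n (M.transport t (pathL ε a 1) 0 1)) (𝓝[>] 0)
      (PowerSeries.coeff n (fexp ((Real.pi * Complex.I : ℂ) • M.t12_3 t) *
        fexp ((Real.pi * Complex.I : ℂ) • M.t12 t))) := by
  have e : PowerSeries.coeff n (fexp ((Real.pi * Complex.I : ℂ) • M.t12_3 t) *
        fexp ((Real.pi * Complex.I : ℂ) • M.t12 t))
      = wordSum (pathForm 0 1) (M.letter t) n 0 1 := by
    -- For `s = 1` the band begins at `r = 0`, so the transport from the band to the end is the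
    -- whole transport; both scalar weights `s` and `2 - s - 2r` equal `1`.
    rw [wordSum_limit_end (M.letter t) (by simp) (by norm_num) (by norm_num),
      ht.letter_two_sub_letter_zero, PowerSeries.coeff_mul]
    refine Finset.sum_congr rfl fun q _ => ?_
    rw [fexp, fexp, PowerSeries.coeff_mk, PowerSeries.coeff_mk, smul_pow, smul_pow, smul_smul,
      smul_smul, smul_mul_smul_comm]
    refine congrArg₂ (· • ·) ?_ rfl
    rw [pow_add]
    push_cast
    have e1 : (2 : ℂ) - 1 - 2 * 0 = 1 := by norm_num
    rw [e1, one_pow, one_pow]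
    ring
  rw [e]
  have h : VTendsto (fun ε => wordSum (pathForm ε 1) (M.letter t) n 0 1) (𝓝[>] 0)
      (wordSum (pathForm 0 1) (M.letter t) n 0 1) := by
    -- There are finitely many words of length `n`, each contributing a convergent scalar times a
    -- fixed endomorphism.
    refine VTendsto.sum Finset.univ fun w _ => VTendsto.smul_const ?_ _
    exact tendsto_iterInt (Eventually.of_forall fun ε => measurable_pathForm_section ε 1)
      (eventually_mem_Ioc.mono fun ε hε => norm_pathForm_le hε.1.le hε.2 1) (tendsto_pathForm 1) _
      (by norm_num)
  refine h.congr' ?_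
  filter_upwards [eventually_mem_Ioc] with ε hε
  exact (coeff_transport_pathL M t hε.1 (by linarith [hε.2]) ha n).symm

theorem vtendsto_surfaceApp_pathL {M : SymStrictMon.{v} C} {t : PsNat M.tens M.tens}
    (ht : M.IsStrict t) {a : ℂ} (ha : a ≠ 0) (n : ℕ) (U : (C × C) × C) :
    VTendsto (fun ε => M.surfaceApp t (pathL ε a) n U) (𝓝[>] 0)
      ((M.leftCongruence t n).app U) := by
  match n with
  | 0 =>
    -- In degrees `0` and `1` one of the two exponents is `0`, so every inner sum is empty, in
    -- agreement with the vanishing low degrees of `surfaceApp`.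
    rw [leftCongruence_app]
    simpa [surfaceApp] using VTendsto.const _
  | 1 =>
    rw [leftCongruence_app]
    simpa [surfaceApp, Finset.Nat.antidiagonal_succ] using VTendsto.const _
  | n + 2 =>
    rw [leftCongruence_app_add_two]
    have e := sum_surfCoeff_limit (M.letter t) (PsNat.sandwich U ((M.relL t).app U)) n
    rw [ht.letter_two_sub_letter_zero] at e
    have h : VTendsto (fun ε => ∑ p ∈ Finset.HasAntidiagonal.antidiagonal n,
        ∑ w : Fin p.1 → Fin 3, ∑ w' : Fin p.2 → Fin 3,
          (surfCoeff (pathForm ε) (surfFormL ε) (List.ofFn w) (List.ofFn w') •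
              PsNat.sandwich U ((M.relL t).app U) (M.word t w) (M.word t w')
            + surfCoeff (pathForm ε) (surfFormR ε) (List.ofFn w) (List.ofFn w') •
              PsNat.sandwich U ((M.relR t).app U) (M.word t w) (M.word t w'))) (𝓝[>] 0)
        (∑ p ∈ Finset.HasAntidiagonal.antidiagonal n,
        ∑ w : Fin p.1 → Fin 3, ∑ w' : Fin p.2 → Fin 3,
          (surfCoeff (pathForm 0) (surfFormL 0) (List.ofFn w) (List.ofFn w') •
              PsNat.sandwich U ((M.relL t).app U) (M.word t w) (M.word t w')
            + surfCoeff (pathForm 0) (surfFormR 0) (List.ofFn w) (List.ofFn w') •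
              PsNat.sandwich U ((M.relR t).app U) (M.word t w) (M.word t w'))) := by
      refine VTendsto.sum _ fun p _ => VTendsto.sum _ fun w _ => VTendsto.sum _ fun w' _ =>
        VTendsto.add (VTendsto.smul_const ?_ _) (VTendsto.smul_const ?_ _)
      · exact tendsto_surfCoeff measurable_surfFormL
          (eventually_mem_Ioc.mono fun ε hε => norm_surfFormL_le hε.1.le hε.2) tendsto_surfFormL _ _
      · exact tendsto_surfCoeff measurable_surfFormR
          (eventually_mem_Ioc.mono fun ε hε => norm_surfFormR_le hε.1.le hε.2) tendsto_surfFormR _ _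
    -- The contribution of `R` carries the factor `ratioCirc`, which is `0` at `ε = 0`.
    have hR : ∀ w w' : List (Fin 3), surfCoeff (pathForm 0) (surfFormR 0) w w' = 0 := by
      intro w w'
      simp [surfCoeff, surfFormR, ratioCirc_radius_zero]
    simp only [hR, zero_smul, add_zero] at h
    have h' := h.congr' (g := fun ε => M.surfaceApp t (pathL ε a) (n + 2) U) (by
      filter_upwards [eventually_mem_Ioc] with ε hε
      rw [surfaceApp]
      simp only [(surfCoeff_pathL hε.1 (by linarith [hε.2] : ε < 1 / 2) ha _ _).1,
        (surfCoeff_pathL hε.1 (by linarith [hε.2] : ε < 1 / 2) ha _ _).2]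
      rfl)
    exact (congrArg (VTendsto _ _) e).mp h'

end SymStrictMon

theorem mainTheorem4 {C : Type u} [ChCat.{v} C] (M : SymStrictMon.{v} C)
    (t : PsNat M.tens M.tens) (ht : M.IsStrict t) (a : ℂ) (ha : a ≠ 0) :
    (∀ ε : ℝ, 0 < ε → ε ≤ 1 / 4 →
      IsTwoPath (pathL ε a)
        (concat (fun r => (cVI ε r, (ε - 1) * a)) (qVI ε a))
        (concat (qSE ε a) (fun r => (cVI ε (r + 1), a)))) ∧
    ModTendsto (fun ε => M.twoHol t (pathL ε a)) (𝓝[>] 0) (M.leftCongruence t) ∧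
    ∀ (N : ℕ) (U : (C × C) × C),
      (M.leftCongruence t N).app U =
        ∑ p ∈ Finset.HasAntidiagonal.antidiagonal N,
          ((Real.pi * Complex.I : ℂ) ^ (p.1 + p.2) / (p.1.factorial * p.2.factorial)) •
            ∑ j ∈ Finset.range p.1, ∑ k ∈ Finset.range p.2,
              ChCat.c01 ((M.t12_3 t ^ j * M.t12 t ^ k).app U)
                (ChCat.c10 ((M.relL t).app U)
                  ((M.t12 t ^ (p.2 - 1 - k) * M.t12_3 t ^ (p.1 - 1 - j)).app U)) :=
  ⟨fun _ h0 h1 => isTwoPath_pathL h0 h1 ha,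
    ModTendsto.of_target
      (PsNat.psTendsto_of_vtendsto (SymStrictMon.vtendsto_transport_pathL ht ha))
      (SymStrictMon.vtendsto_surfaceApp_pathL ht ha),
    M.leftCongruence_app t⟩
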